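/- For each $n\ge 1$ let $\mathcal C_n$ be a closed network with $n$ queues and $m_n\in\mathbb N$ customers. Queue $k$ has service rate $\mu_{k,n}(q)>0$ when it holds $q\ge1$ customers, and the routing matrix $P_n$ is stochastic and irreducible, with invariant probability vector $\pi_n=(\pi_{1,n},\dots,\pi_{n,n})$. Let $f_{k,n}(z)=\sum_{q\ge0} z^q/(\mu_{k,n}(1)\cdots\mu_{k,n}(q))$. Let $\lambda_n\ge0$ be such that there are independent $\mathbb N$-valued variables $X_{1,n},\dots,X_{n,n}$ with $$P(X_{k,n}=x)=\frac{1}{f_{k,n}(\lambda_n\pi_{k,n})}\,\frac{(\lambda_n\pi_{k,n})^x}{\mu_{k,n}(1)\cdots\mu_{k,n}(x)},$$ with finite means $m_{k,n}=E X_{k,n}$, and such that $E S_n=m_n$, where $S_n=\sum_{k=1}^n X_{k,n}$. Put $\phi_{k,n}(\theta)=E e^{i(X_{k,n}-m_{k,n})\theta}$. Let $\rho^0_n\in[0,1)$, $\omega_n(\theta)=\dfrac{1-\rho_n^0}{1-\rho_n^0e^{i\theta}}$ and $\alpha_n=\dfrac{\rho^0_n}{1-\rho^0_n}$. Let $\mathcal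 F^0_n\subset\{1,\dots,n\}$ be a nonempty set of queues such that, for all $k\in\mathcal F_n^0$ and all real $\theta$, $$\phi_{k,n}(\theta)=e^{-im_{k,n}\theta}\,\omega_n(\theta)^{\xi_{k,n}}\,\psi_{k,n}(\theta),$$ where $1\le\xi_{k,n}<\xi_{\max}<\infty$ with $\xi_{\max}$ independent of $k$ and $n$, and $\psi_{k,n}$ is differentiable with $\psi'_{k,n}(\theta)$ bounded uniformly in $\theta$, $k\in\mathcal F^0_n$ and $n$ (the power is the principal one). Put $\xi_n=\sum_{k\in\mathcal F_n^0}\xi_{k,n}$. Let $0<r\le1$, assume that $E X_{k,n}^{2+r}<\infty$ for $k\notin\mathcal F_n^0$, and put $$\hat\sigma_n^2=\sum_{k\notin\mathcal F^0_n}\operatorname{Var}X_{k,n},\qquad \hat\beta_n^{(2+r)}=\sum_{k\notin\mathcal F^0_n}E|X_{k,n}-m_{k,n}|^{2+r},\qquad \hat\delta_n^{\,r}=\frac{\hat\sigma_n^2}{2\hat\beta^{(2+r)}_n},$$ $$\hat\gamma_n^2=\sum_{k\notin\mathcal F^0_n}\ \sum_{j\ge0}\frac{P(X_{k,n}=2j)\,P(X_{k,n}=2j+1)}{P(X_{k,n}=2j)+P(X_{k,n}=2j+1)},$$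 where a summand $0/0$ is read as $0$. Assume that, as $n\to\infty$, $\rho^0_n\to1$, $\xi_n$ is bounded, $\hat\sigma_n/\alpha_n\to0$ and $\hat\delta_n\hat\gamma_n\to\infty$. Let $g_\xi(y)=y^{\xi-1}e^{-y}/\Gamma(\xi)$ for $y\ge0$ (with $0^0=1$) and $g_\xi(y)=0$ for $y<0$. Then for every $\varepsilon>0$ there is a constant $K$ such that, for all sufficiently large $n$ and all integers $x$ with $\bigl|\xi_n+\tfrac{x}{\alpha_n}\bigr|\ge\varepsilon$, $$\Bigl|\alpha_nP(S_n-m_n=x)-g_{\xi_n}\Bigl(\xi_n+\frac{x}{\alpha_n}\Bigr)\Bigr|\le K\left[\Bigl(\frac{\hat\sigma_n}{\alpha_n}\Bigr)^2+\frac1{\alpha_n}+\frac{\hat\beta_n^{(2+r)}}{\hat\sigma_n^{2+r}}\Bigl(\frac{\hat\sigma_n}{\alpha_n}\Bigr)^{2+r}+\frac{\hat\beta_n^{(2+r)}}{\hat\sigma_n^{2+r}}\Bigl(\frac{\hat\sigma_n}{\alpha_n}\Bigr)^{\xi_n-1}+\frac{e^{-\hat\gamma_n^2\hat\delta_n^2/5}}{\hat\gamma_n^2\,\hat\delta_n^{\,\xi_n+1}\,\alpha_n^{\xi_n-1}}\right].$$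 In particular, the estimate holds for each fixed integer $x$, and uniformly over all integers $x$ with $\xi_n+x/\alpha_n\ge\varepsilon$. -/

import Mathlib

open MeasureTheory ProbabilityTheory Filter
open scoped Topology

/-- A closed product-form network with `n` queues. `rate k q` is the service rate of queue `k` when
it holds `q ≥ 1` customers (`rate k 0` is never used), `routing` is the transition matrix of the
routing chain, and `visit` is its invariant probability vector. -/
structure ClosedNetwork (n : ℕ) where
  customers : ℕ
  rate : Fin n → ℕ → ℝ
  rate_pos : ∀ k q, 1 ≤ q → 0 < rate k q
  routing : Matrix (Fin n) (Fin n) ℝ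
  routing_nonneg : ∀ k l, 0 ≤ routing k l
  routing_sum : ∀ k, ∑ l, routing k l = 1
  routing_irreducible : routing.IsIrreducible
  visit : Fin n → ℝ
  visit_nonneg : ∀ k, 0 ≤ visit k
  visit_invariant : Matrix.vecMul visit routing = visit
  visit_sum : ∑ k, visit k = 1

namespace ClosedNetwork

variable {n : ℕ} (C : ClosedNetwork n)

/-- The generating function `f_k(z) = ∑_q z^q / (μ_k(1) ⋯ μ_k(q))` of queue `k`. -/
noncomputable def genFun (k : Fin n) (z : ℝ) : ℝ :=
  ∑' q : ℕ, z ^ q / ∏ i ∈ Finset.Icc 1 q, C.rate k i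

/-- The stationary probability of the value `x` for queue `k` taken in isolation, with arrival
intensity `lam * visit k`. -/
noncomputable def openProb (lam : ℝ) (k : Fin n) (x : ℕ) : ℝ :=
  (1 / C.genFun k (lam * C.visit k)) *
    ((lam * C.visit k) ^ x / ∏ i ∈ Finset.Icc 1 x, C.rate k i)

/-- `X` is the family of queue lengths of the open system of parallel queues with load `lam`:
independent variables, `X k` having point probabilities `openProb lam k`. Since `P` is a probability
measure, the law condition forces the series `genFun k (lam * visit k)` to converge. -/
structure IsOpenSystem {Ω : Type*} [MeasurableSpace Ω] (P : Measure Ω) (lam : ℝ)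
    (X : Fin n → Ω → ℕ) : Prop where
  load_nonneg : 0 ≤ lam
  measurable : ∀ k, Measurable (X k)
  indep : iIndepFun X P
  law : ∀ k x, P.real {ω | X k ω = x} = C.openProb lam k x

end ClosedNetwork

section QueueLength

variable {Ω : Type*} [MeasurableSpace Ω]

/-- The mean of an integer-valued variable. -/
noncomputable def qMean (P : Measure Ω) (Y : Ω → ℕ) : ℝ := ∫ ω, (Y ω : ℝ) ∂P

/-- The variance of an integer-valued variable. -/
noncomputable def qVar (P : Measure Ω) (Y : Ω → ℕ) : ℝ := variance (fun ω => (Y ω : ℝ)) P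

/-- The absolute central moment of order `s`. -/
noncomputable def qAbsMoment (P : Measure Ω) (Y : Ω → ℕ) (s : ℝ) : ℝ :=
  ∫ ω, |(Y ω : ℝ) - qMean P Y| ^ s ∂P

/-- The characteristic function of the centred variable. -/
noncomputable def qCharFun (P : Measure Ω) (Y : Ω → ℕ) (θ : ℝ) : ℂ :=
  ∫ ω, Complex.exp (Complex.I * (((Y ω : ℝ) - qMean P Y : ℝ) : ℂ) * (θ : ℂ)) ∂P

/-- `γ² = ∑_j p_{2j} p_{2j+1} / (p_{2j} + p_{2j+1})`, where `p_j = P(Y = j)`; a summand with zero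
denominator is zero. -/
noncomputable def qGammaSq (P : Measure Ω) (Y : Ω → ℕ) : ℝ :=
  ∑' j : ℕ, P.real {ω | Y ω = 2 * j} * P.real {ω | Y ω = 2 * j + 1} /
    (P.real {ω | Y ω = 2 * j} + P.real {ω | Y ω = 2 * j + 1})

variable {ι : Type*}

/-- `σ`, for the queues in the finite set `A`. -/
noncomputable def totSigma (P : Measure Ω) (X : ι → Ω → ℕ) (A : Finset ι) : ℝ :=
  √(∑ k ∈ A, qVar P (X k))

/-- `β^{(s)}`, for the queues in the finite set `A`. -/
noncomputable def totMoment (P : Measure Ω) (X : ι → Ω → ℕ) (A : Finset ι) (s : ℝ) : ℝ :=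
  ∑ k ∈ A, qAbsMoment P (X k) s

/-- `γ`, for the queues in the finite set `A`. -/
noncomputable def totGamma (P : Measure Ω) (X : ι → Ω → ℕ) (A : Finset ι) : ℝ :=
  √(∑ k ∈ A, qGammaSq P (X k))

/-- `δ`, for the queues in the finite set `A`: the number with `δ^r = σ² / (2 β^{(2+r)})`. -/
noncomputable def totDelta (P : Measure Ω) (X : ι → Ω → ℕ) (A : Finset ι) (r : ℝ) : ℝ :=
  ((1 / 2) * (totSigma P X A ^ 2 / totMoment P X A (2 + r))) ^ (1 / r)

end QueueLength

/-- `ω(θ) = (1 - ρ) / (1 - ρ e^{iθ})`. -/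
noncomputable def poleFactor (ρ θ : ℝ) : ℂ :=
  (1 - (ρ : ℂ)) / (1 - (ρ : ℂ) * Complex.exp (Complex.I * (θ : ℂ)))

/-- `α = ρ / (1 - ρ)`. -/
noncomputable def poleScale (ρ : ℝ) : ℝ := ρ / (1 - ρ)

/-- The error of the gamma approximation, in terms of `α`, `ξ`, `r`, `σ`, `β = β^{(2+r)}`, `γ`
and `δ`. -/
noncomputable def gammaError (α ξ r σ β γ δ : ℝ) : ℝ :=
  ((σ / α) ^ 2 + 1 / α + β / σ ^ (2 + r) * (σ / α) ^ (2 + r) + β / σ ^ (2 + r) * (σ / α) ^ (ξ - 1))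
    + Real.exp (-(γ ^ 2 * δ ^ 2 / 5)) / (γ ^ 2 * δ ^ (ξ + 1) * α ^ (ξ - 1))

/-! By Fourier inversion, `P(S = m + x)` is a Fourier coefficient of `∏ φ_k` on `[-π, π]`. The pole
factor `ω` is `1 / (1 - α (e^{iθ} - 1))`, which is `1 / (1 - iαθ)` up to a factor `exp O(|θ|)`;
hence the product over the saturable queues is the characteristic function of `α` times a gamma
variable of shape `ξ_n`, centred at its mean, up to a correction factor that is `1 + O(|θ|)`.

The other queues contribute a Gaussian factor up to a Lyapunov error as long as `|θ| ≤ δ`. Beyond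
`δ` their characteristic functions are small because pairing the consecutive values `2j` and
`2j + 1` gives `|φ_k(θ)| ≤ exp(-γ_k² (1 - cos θ))`. Gamma times Gaussian is the characteristic
function of a smoothed gamma law, whose density differs from the gamma density by `O((σ/α)²)` times
the second derivative of the latter: here the evaluation point has to stay away from the origin. -/

/-! ### Smoothness of the gamma density away from the origin -/

theorem continuous_inv_Gamma : Continuous fun x : ℝ => (Real.Gamma x)⁻¹ := by
  have h : Continuous fun x : ℝ => (Complex.Gamma x)⁻¹ :=
    Complex.differentiable_one_div_Gamma.continuous.comp Complex.continuous_ofReal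
  refine (Complex.continuous_re.comp h).congr fun x => ?_
  simp [Complex.Gamma_ofReal, ← Complex.ofReal_inv]

theorem rpow_mul_exp_neg_le_factorial {q M z : ℝ} (hq : q ≤ M) (hz : 1 ≤ z) :
    z ^ q * Real.exp (-z) ≤ (⌈M⌉₊.factorial : ℝ) := by
  have hpow : z ^ q ≤ z ^ ⌈M⌉₊ := by
    rw [← Real.rpow_natCast]
    exact Real.rpow_le_rpow_of_exponent_le hz (hq.trans (Nat.le_ceil M))
  have hexp : z ^ ⌈M⌉₊ / (⌈M⌉₊.factorial : ℝ) ≤ Real.exp z :=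
    Real.pow_div_factorial_le_exp z (by linarith) _
  rw [Real.exp_neg, ← div_eq_mul_inv, div_le_iff₀ (Real.exp_pos z)]
  rw [div_le_iff₀' (by positivity)] at hexp
  exact hpow.trans hexp

theorem exists_abs_gammaPDFReal_le_of_rpow_le (L M B : ℝ) :
    ∃ C : ℝ, 0 < C ∧ ∀ ξ ∈ Set.Icc L M, ∀ z : ℝ, (z ∈ Set.Icc 0 1 → z ^ (ξ - 1) ≤ B) →
      |gammaPDFReal ξ 1 z| ≤ C := by
  obtain ⟨G, hG⟩ := (isCompact_Icc (a := L) (b := M)).exists_bound_of_continuousOn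
    continuous_inv_Gamma.continuousOn
  refine ⟨|G| * max B (⌈M - 1⌉₊.factorial : ℝ) + 1, by positivity, fun ξ hξ z hB => ?_⟩
  rcases lt_or_ge z 0 with hz | hz
  · rw [gammaPDFReal, if_neg hz.not_ge, abs_zero]
    positivity
  have hz_rpow : z ^ (ξ - 1) * Real.exp (-z) ≤ max B (⌈M - 1⌉₊.factorial : ℝ) := by
    rcases le_total z 1 with hz1 | hz1
    · exact le_max_of_le_left ((mul_le_of_le_one_right (by positivity) (by simpa using hz)).trans
        (hB ⟨hz, hz1⟩))
    · exact le_max_of_le_right (rpow_mul_exp_neg_le_factorial (by linarith [hξ.2]) hz1)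
  calc |gammaPDFReal ξ 1 z| = ‖(Real.Gamma ξ)⁻¹‖ * (z ^ (ξ - 1) * Real.exp (-z)) := by
        rw [gammaPDFReal, if_pos hz, Real.one_rpow, one_mul, one_div, mul_assoc, abs_mul,
          abs_of_nonneg (a := z ^ (ξ - 1) * _) (by positivity), Real.norm_eq_abs]
    _ ≤ |G| * max B (⌈M - 1⌉₊.factorial : ℝ) := by
        gcongr
        exact (hG ξ hξ).trans (le_abs_self G)
    _ ≤ _ := le_add_of_nonneg_right zero_le_one

theorem exists_abs_gammaPDFReal_le (M : ℝ) :
    ∃ C : ℝ, 0 < C ∧ ∀ ξ ∈ Set.Icc 1 M, ∀ z, |gammaPDFReal ξ 1 z| ≤ C := by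
  obtain ⟨C, hC, h⟩ := exists_abs_gammaPDFReal_le_of_rpow_le 1 M 1
  exact ⟨C, hC, fun ξ hξ z =>
    h ξ hξ z fun hz => Real.rpow_le_one hz.1 hz.2 (by linarith [hξ.1])⟩

theorem exists_abs_gammaPDFReal_le_of_le_abs (L M : ℝ) {a : ℝ} (ha : 0 < a) :
    ∃ C : ℝ, 0 < C ∧ ∀ ξ ∈ Set.Icc L M, ∀ z, a ≤ |z| → |gammaPDFReal ξ 1 z| ≤ C := by
  obtain ⟨C, hC, h⟩ := exists_abs_gammaPDFReal_le_of_rpow_le L M (1 + a ^ (L - 1))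
  refine ⟨C, hC, fun ξ hξ z hz => h ξ hξ z fun hz01 => ?_⟩
  rw [abs_of_nonneg hz01.1] at hz
  have hz0 : 0 < z := ha.trans_le hz
  rcases le_total 1 ξ with h1 | h1
  · exact (Real.rpow_le_one hz0.le hz01.2 (by linarith)).trans
      (le_add_of_nonneg_right (by positivity))
  · calc z ^ (ξ - 1) ≤ a ^ (ξ - 1) := Real.rpow_le_rpow_of_nonpos ha hz (by linarith)
      _ ≤ a ^ (L - 1) :=
          Real.rpow_le_rpow_of_exponent_ge ha (hz.trans hz01.2) (by linarith [hξ.1])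
      _ ≤ 1 + a ^ (L - 1) := le_add_of_nonneg_left zero_le_one

/-- At `ξ = 1` the formula uses the value `Real.Gamma 0 = 0`: the density of shape `0` is `0`. -/
theorem hasDerivAt_gammaPDFReal (ξ : ℝ) {r z : ℝ} (hr : 0 < r) (hz : z ≠ 0) :
    HasDerivAt (gammaPDFReal ξ r) (r * (gammaPDFReal (ξ - 1) r z - gammaPDFReal ξ r z)) z := by
  rcases hz.lt_or_gt with hz | hz
  · have hzero : gammaPDFReal ξ r =ᶠ[𝓝 z] fun _ => 0 := by
      filter_upwards [Iio_mem_nhds hz] with x hx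
      rw [gammaPDFReal, if_neg (not_le.2 hx)]
    simpa [gammaPDFReal, hz.not_ge] using
      (hasDerivAt_const z (0 : ℝ)).congr_of_eventuallyEq hzero
  have hGamma : (ξ - 1) / Real.Gamma ξ = 1 / Real.Gamma (ξ - 1) := by
    rcases eq_or_ne ξ 1 with rfl | hξ
    · simp
    · have := Real.Gamma_add_one (sub_ne_zero.2 hξ)
      rw [sub_add_cancel] at this
      rw [this, div_mul_cancel_left₀ (sub_ne_zero.2 hξ), one_div]
  have hformula : gammaPDFReal ξ r =ᶠ[𝓝 z]
      fun x => r ^ ξ / Real.Gamma ξ * (x ^ (ξ - 1) * Real.exp (-(r * x))) := by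
    filter_upwards [Ioi_mem_nhds hz] with x hx
    rw [gammaPDFReal, if_pos (Set.mem_Ioi.1 hx).le, mul_assoc]
  have hderiv := ((Real.hasDerivAt_rpow_const (p := ξ - 1) (Or.inl hz.ne')).mul
    ((hasDerivAt_id z).const_mul r).neg.exp).const_mul (r ^ ξ / Real.Gamma ξ)
  refine (hderiv.congr_of_eventuallyEq hformula).congr_deriv ?_
  have hr_rpow : r ^ ξ = r * r ^ (ξ - 1) := by
    rw [mul_comm, ← Real.rpow_add_one hr.ne', sub_add_cancel]
  simp only [gammaPDFReal, if_pos hz.le, id, mul_one]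
  linear_combination r ^ ξ * z ^ (ξ - 1 - 1) * Real.exp (-(r * z)) * hGamma +
    1 / Real.Gamma (ξ - 1) * z ^ (ξ - 1 - 1) * Real.exp (-(r * z)) * hr_rpow

theorem abs_sub_sub_mul_le_of_hasDerivAt {f f' f'' : ℝ → ℝ} {C y h : ℝ}
    (hf : ∀ z, |z - y| ≤ |h| → HasDerivAt f (f' z) z)
    (hf' : ∀ z, |z - y| ≤ |h| → HasDerivAt f' (f'' z) z)
    (hC : ∀ z, |z - y| ≤ |h| → |f'' z| ≤ C) :
    |f (y + h) - f y - f' y * h| ≤ C * h ^ 2 := by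
  have hconv : Convex ℝ (Metric.closedBall y |h|) := convex_closedBall y |h|
  have hy : y ∈ Metric.closedBall y |h| := by simp
  have hyh : y + h ∈ Metric.closedBall y |h| := by simp
  have hf'_sub : ∀ z ∈ Metric.closedBall y |h|, ‖f' z - f' y‖ ≤ C * |h| := by
    intro z hz
    have hC0 : 0 ≤ C := (abs_nonneg _).trans (hC y (by simp))
    have hzy : ‖z - y‖ ≤ |h| := by simpa [Real.dist_eq] using hz
    refine (hconv.norm_image_sub_le_of_norm_hasDerivWithin_le
      (fun x hx => (hf' x (by simpa [Real.dist_eq] using hx)).hasDerivWithinAt)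
      (fun x hx => hC x (by simpa [Real.dist_eq] using hx)) hy hz).trans ?_
    gcongr
  have hderiv : ∀ z ∈ Metric.closedBall y |h|, HasDerivWithinAt (fun z => f z - f' y * z)
      (f' z - f' y) (Metric.closedBall y |h|) z := fun z hz => by
    simpa using! ((hf z (by simpa [Real.dist_eq] using hz)).sub
      ((hasDerivAt_id z).const_mul (f' y))).hasDerivWithinAt
  calc |f (y + h) - f y - f' y * h| = ‖f (y + h) - f' y * (y + h) - (f y - f' y * y)‖ := by
        rw [Real.norm_eq_abs]; ring_nf
    _ ≤ C * |h| * ‖y + h - y‖ :=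
        hconv.norm_image_sub_le_of_norm_hasDerivWithin_le hderiv hf'_sub hy hyh
    _ = C * h ^ 2 := by
        rw [add_sub_cancel_left, Real.norm_eq_abs, mul_assoc, ← abs_mul, ← pow_two, abs_sq]

theorem abs_sub_sub_mul_le_of_forall_abs_le {f : ℝ → ℝ} {y d a B C : ℝ} (ha : 0 < a) (hC : 0 ≤ C)
    (hf : ∀ z, |f z| ≤ B) (hd : |d| ≤ B)
    (hlocal : ∀ h, |h| ≤ a → |f (y + h) - f y - d * h| ≤ C * h ^ 2) (h : ℝ) :
    |f (y + h) - f y - d * h| ≤ (C + 2 * B / a ^ 2 + B / a) * h ^ 2 := by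
  have hB : 0 ≤ B := (abs_nonneg _).trans hd
  rcases le_total |h| a with hh | hh
  · refine (hlocal h hh).trans ?_
    gcongr
    rw [add_assoc]
    exact le_add_of_nonneg_right (by positivity)
  have habs : |h| ≤ h ^ 2 / a := by
    rw [le_div_iff₀ ha, ← sq_abs, pow_two]; gcongr
  have hone : 1 ≤ h ^ 2 / a ^ 2 := by
    rw [le_div_iff₀ (by positivity), one_mul, ← sq_abs h]; gcongr
  calc |f (y + h) - f y - d * h| ≤ |f (y + h)| + |f y| + |d * h| :=
        (abs_sub _ _).trans (by gcongr; exact abs_sub _ _)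
    _ ≤ B + B + B * |h| := by rw [abs_mul]; gcongr <;> apply hf
    _ ≤ 2 * B * (h ^ 2 / a ^ 2) + B * (h ^ 2 / a) := by
        rw [← two_mul]
        exact add_le_add (le_mul_of_one_le_right (by positivity) hone) (by gcongr)
    _ = (2 * B / a ^ 2 + B / a) * h ^ 2 := by ring
    _ ≤ (C + 2 * B / a ^ 2 + B / a) * h ^ 2 := by
        gcongr; linarith

theorem exists_gammaPDFReal_taylor (M : ℝ) {ε : ℝ} (hε : 0 < ε) :
    ∃ C : ℝ, 0 < C ∧ ∀ ξ ∈ Set.Icc 1 M, ∀ y : ℝ, ε ≤ |y| → ∀ h : ℝ,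
      |gammaPDFReal ξ 1 (y + h) - gammaPDFReal ξ 1 y
        - (gammaPDFReal (ξ - 1) 1 y - gammaPDFReal ξ 1 y) * h| ≤ C * h ^ 2 := by
  obtain ⟨A, hA, hbound⟩ := exists_abs_gammaPDFReal_le M
  obtain ⟨B, hB, hbound_away⟩ := exists_abs_gammaPDFReal_le_of_le_abs (-1) M (half_pos hε)
  refine ⟨4 * B + 2 * (A + 2 * B) / (ε / 2) ^ 2 + (A + 2 * B) / (ε / 2), by positivity,
    fun ξ hξ y hy h => ?_⟩
  have hlow : ∀ j ∈ Set.Icc (0 : ℝ) 2, ∀ z, ε / 2 ≤ |z| → |gammaPDFReal (ξ - j) 1 z| ≤ B :=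
    fun j hj => hbound_away _ ⟨by linarith [hξ.1, hj.2], by linarith [hξ.2, hj.1]⟩
  have hg0 : ∀ z, ε / 2 ≤ |z| → |gammaPDFReal ξ 1 z| ≤ B := by simpa using hlow 0 (by simp)
  have hg1 : ∀ z, ε / 2 ≤ |z| → |gammaPDFReal (ξ - 1) 1 z| ≤ B := hlow 1 (by norm_num)
  have hg2 : ∀ z, ε / 2 ≤ |z| → |gammaPDFReal (ξ - 1 - 1) 1 z| ≤ B := by
    simpa only [sub_sub, one_add_one_eq_two] using hlow 2 (by norm_num)
  have hderiv : ∀ (η : ℝ) {z : ℝ}, ε / 2 ≤ |z| →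
      HasDerivAt (gammaPDFReal η 1) (gammaPDFReal (η - 1) 1 z - gammaPDFReal η 1 z) z :=
    fun η z hz => by
      simpa using hasDerivAt_gammaPDFReal η one_pos (abs_pos.1 ((half_pos hε).trans_le hz))
  have haway : ∀ {h z : ℝ}, |h| ≤ ε / 2 → |z - y| ≤ |h| → ε / 2 ≤ |z| := fun {h z} hh hz => by
    linarith [abs_sub_abs_le_abs_sub y z, abs_sub_comm y z, hz.trans hh]
  refine abs_sub_sub_mul_le_of_forall_abs_le (half_pos hε) (by positivity)
    (fun z => (hbound ξ hξ z).trans (by linarith)) ?_ (fun h hh => ?_) h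
  · exact (abs_sub _ _).trans (by linarith [hg0 y (by linarith), hg1 y (by linarith)])
  · refine abs_sub_sub_mul_le_of_hasDerivAt
      (f' := fun z => gammaPDFReal (ξ - 1) 1 z - gammaPDFReal ξ 1 z)
      (fun z hz => hderiv ξ (haway hh hz))
      (fun z hz => (hderiv (ξ - 1) (haway hh hz)).sub (hderiv ξ (haway hh hz))) fun z hz => ?_
    have b0 := abs_le.1 (hg0 z (haway hh hz))
    have b1 := abs_le.1 (hg1 z (haway hh hz))
    have b2 := abs_le.1 (hg2 z (haway hh hz))
    exact abs_le.2 ⟨by linarith, by linarith⟩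

/-! ### The characteristic function of the gamma distribution -/

theorem integral_gammaMeasure {E : Type*} [NormedAddCommGroup E] [NormedSpace ℝ E] {a r : ℝ}
    (ha : 0 < a) (hr : 0 < r) (f : ℝ → E) :
    ∫ z, f z ∂gammaMeasure a r = ∫ z, gammaPDFReal a r z • f z := by
  have hmeas : Measurable (gammaPDF a r) := (measurable_gammaPDFReal a r).ennreal_ofReal
  rw [gammaMeasure, integral_withDensity_eq_integral_toReal_smul hmeas
    (Eventually.of_forall fun x => ENNReal.ofReal_lt_top)]
  simp only [gammaPDF, ENNReal.toReal_ofReal (gammaPDFReal_nonneg ha hr _)]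

theorem mgf_id_gammaMeasure {a r t : ℝ} (ha : 0 < a) (hr : 0 < r) (ht : t < r) :
    mgf id (gammaMeasure a r) t = (1 - t / r) ^ (-a) := by
  have hrt : 0 < r - t := sub_pos.2 ht
  have hGamma : Real.Gamma a ≠ 0 := (Real.Gamma_pos_of_pos ha).ne'
  have hsupport : ∀ z ∉ Set.Ici (0 : ℝ), gammaPDFReal a r z • Real.exp (t * id z) = 0 := by
    intro z hz
    rw [gammaPDFReal, if_neg (by simpa using hz), zero_smul]
  calc mgf id (gammaMeasure a r) t
      = ∫ z in Set.Ioi 0, gammaPDFReal a r z • Real.exp (t * id z) := by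
        rw [mgf, integral_gammaMeasure ha hr, ← integral_Ici_eq_integral_Ioi,
          setIntegral_eq_integral_of_forall_compl_eq_zero hsupport]
    _ = ∫ z in Set.Ioi (0 : ℝ), r ^ a / Real.Gamma a *
          (z ^ (a - 1) * Real.exp (-((r - t) * z))) := by
        refine setIntegral_congr_fun measurableSet_Ioi fun z hz => ?_
        simp only [gammaPDFReal, if_pos (Set.mem_Ioi.1 hz).le, smul_eq_mul, id, mul_assoc,
          ← Real.exp_add]
        ring_nf
    _ = (r / (r - t)) ^ a := by
        rw [integral_const_mul, Real.integral_rpow_mul_exp_neg_mul_Ioi ha hrt,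
          Real.div_rpow hr.le hrt.le, Real.div_rpow zero_le_one hrt.le, Real.one_rpow]
        field_simp
    _ = (1 - t / r) ^ (-a) := by
        rw [Real.rpow_neg_eq_inv_rpow, one_sub_div hr.ne', inv_div]

theorem Iio_subset_integrableExpSet_gammaMeasure {a r : ℝ} (ha : 0 < a) (hr : 0 < r) :
    Set.Iio r ⊆ integrableExpSet id (gammaMeasure a r) := fun t ht => by
  have hpos : 0 < 1 - t / r := sub_pos.2 ((div_lt_one hr).2 ht)
  refine not_imp_comm.1 integral_undef (?_ : mgf id (gammaMeasure a r) t ≠ 0)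
  rw [mgf_id_gammaMeasure ha hr ht]
  positivity

theorem complexMGF_id_gammaMeasure {a r : ℝ} (ha : 0 < a) (hr : 0 < r) {z : ℂ} (hz : z.re < r) :
    complexMGF id (gammaMeasure a r) z = (1 - z / r) ^ (-(a : ℂ)) := by
  have hre : ∀ w : ℂ, (1 - w / r).re = 1 - w.re / r := fun w => by simp
  have hleft : AnalyticOnNhd ℂ (complexMGF id (gammaMeasure a r)) {z | z.re < r} :=
    analyticOnNhd_complexMGF.mono fun w hw => mem_interior.2
      ⟨Set.Iio r, Iio_subset_integrableExpSet_gammaMeasure ha hr, isOpen_Iio, hw⟩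
  have hright : AnalyticOnNhd ℂ (fun z : ℂ => (1 - z / r) ^ (-(a : ℂ))) {z | z.re < r} := by
    refine DifferentiableOn.analyticOnNhd (fun w hw => ?_)
      (isOpen_lt Complex.continuous_re continuous_const)
    have hslit : 1 - w / r ∈ Complex.slitPlane := Or.inl (by
      rw [hre]; exact sub_pos.2 ((div_lt_one hr).2 hw))
    have hlin : DifferentiableAt ℂ (fun z : ℂ => 1 - z / r) w := by fun_prop
    exact (hlin.cpow_const hslit).differentiableWithinAt
  have hreal : ∀ᶠ t : ℝ in 𝓝[≠] 0,
      complexMGF id (gammaMeasure a r) t = (1 - t / r) ^ (-(a : ℂ)) := by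
    filter_upwards [mem_nhdsWithin_of_mem_nhds (Iio_mem_nhds hr)] with t ht
    have hpos : 0 < 1 - t / r := sub_pos.2 ((div_lt_one hr).2 ht)
    rw [complexMGF_ofReal, mgf_id_gammaMeasure ha hr ht, Complex.ofReal_cpow hpos.le]
    push_cast
    rfl
  have hnhds : Tendsto ((↑) : ℝ → ℂ) (𝓝[≠] 0) (𝓝[≠] 0) := by
    simpa using! (Complex.ofRealCLM.hasDerivAt (x := 0)).tendsto_nhdsNE (by simp)
  exact hleft.eqOn_of_preconnected_of_frequently_eq hright
    (convex_halfSpace_re_lt r).isPreconnected (by simpa using hr)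
    (hnhds.frequently hreal.frequently) hz

/-- The characteristic function of the gamma law of shape `ξ` and rate `1`, for the principal power;
it is the limit of the characteristic functions of the queues in heavy traffic. -/
noncomputable def gammaChar (ξ t : ℝ) : ℂ :=
  (1 - Complex.I * t) ^ (-(ξ : ℂ))

theorem charFun_gammaMeasure {ξ : ℝ} (hξ : 0 < ξ) :
    charFun (gammaMeasure ξ 1) = gammaChar ξ := by
  ext t
  rw [← complexMGF_id_mul_I, complexMGF_id_gammaMeasure hξ one_pos (by simp), gammaChar,
    Complex.ofReal_one, div_one, mul_comm]

theorem one_sub_I_mul_mem_slitPlane (t : ℝ) : 1 - Complex.I * t ∈ Complex.slitPlane :=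
  Or.inl (by simp)

theorem continuous_gammaChar (ξ : ℝ) : Continuous (gammaChar ξ) :=
  Continuous.cpow (by fun_prop) continuous_const one_sub_I_mul_mem_slitPlane

theorem hasDerivAt_gammaChar (ξ t : ℝ) :
    HasDerivAt (gammaChar ξ) (gammaChar ξ t * (ξ * Complex.I / (1 - Complex.I * t))) t := by
  have hslit := one_sub_I_mul_mem_slitPlane t
  have hlin : HasDerivAt (fun z : ℂ => 1 - Complex.I * z) (-Complex.I) t := by
    simpa using ((hasDerivAt_id (t : ℂ)).const_mul Complex.I).const_sub 1
  refine (hlin.cpow_const (c := -(ξ : ℂ)) hslit).comp_ofReal.congr_deriv ?_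
  rw [gammaChar, Complex.cpow_sub _ _ (Complex.slitPlane_ne_zero hslit), Complex.cpow_one]
  ring

theorem norm_one_sub_I_mul (t : ℝ) : ‖1 - Complex.I * t‖ = √(1 + t ^ 2) := by
  rw [Complex.norm_eq_sqrt_sq_add_sq]
  simp

theorem abs_le_norm_one_sub_I_mul (t : ℝ) : |t| ≤ ‖1 - Complex.I * t‖ := by
  simpa using Complex.abs_im_le_norm (1 - Complex.I * t)

theorem norm_gammaChar (ξ t : ℝ) : ‖gammaChar ξ t‖ = (1 + t ^ 2) ^ (-ξ / 2) := by
  rw [gammaChar, ← Complex.ofReal_neg, Complex.norm_cpow_real, norm_one_sub_I_mul,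
    Real.sqrt_eq_rpow, ← Real.rpow_mul (by positivity), one_div_mul_eq_div]

theorem norm_gammaChar_le_one {ξ : ℝ} (hξ : 0 ≤ ξ) (t : ℝ) : ‖gammaChar ξ t‖ ≤ 1 := by
  rw [norm_gammaChar]
  exact Real.rpow_le_one_of_one_le_of_nonpos (le_add_of_nonneg_right (sq_nonneg t)) (by linarith)

theorem norm_gammaChar_le_rpow {ξ η : ℝ} (hη : 0 ≤ η) (hξ : η ≤ ξ) {t : ℝ} (ht : t ≠ 0) :
    ‖gammaChar ξ t‖ ≤ |t| ^ (-η) := by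
  have ht_pos : 0 < t ^ 2 := by positivity
  calc ‖gammaChar ξ t‖ = (1 + t ^ 2) ^ (-ξ / 2) := norm_gammaChar ξ t
    _ ≤ (1 + t ^ 2) ^ (-η / 2) :=
        Real.rpow_le_rpow_of_exponent_le (by linarith) (by linarith)
    _ ≤ (t ^ 2) ^ (-η / 2) :=
        Real.rpow_le_rpow_of_nonpos ht_pos (by linarith) (by linarith)
    _ = |t| ^ (-η) := by
        rw [← sq_abs, ← Real.rpow_natCast, ← Real.rpow_mul (abs_nonneg t)]
        congr 1
        push_cast
        ring

theorem norm_cexp_neg_I_mul_mul (y t : ℝ) : ‖Complex.exp (-(Complex.I * y * t))‖ = 1 := by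
  simp [Complex.norm_exp]

theorem hasDerivAt_neg_I_mul_mul (y t : ℝ) :
    HasDerivAt (fun t : ℝ => -(Complex.I * y * t)) (-(Complex.I * y)) t := by
  simpa using! ((Complex.ofRealCLM.hasDerivAt (x := t)).const_mul (Complex.I * y)).neg

theorem hasDerivAt_cexp_neg_I_mul_mul (y t : ℝ) :
    HasDerivAt (fun t : ℝ => Complex.exp (-(Complex.I * y * t)))
      (-(Complex.I * y) * Complex.exp (-(Complex.I * y * t))) t := by
  simpa only [mul_comm] using (hasDerivAt_neg_I_mul_mul y t).cexp

theorem integral_cexp_mul_gaussian {v : NNReal} (hv : v ≠ 0) (y z : ℝ) :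
    ∫ t : ℝ, Complex.exp (t * z * Complex.I) * (Real.exp (-(v * t ^ 2 / 2)) : ℂ) *
      Complex.exp (-(Complex.I * y * t)) = 2 * Real.pi * gaussianPDFReal y v z := by
  have hv_pos : (0 : ℝ) < v := by positivity
  have hsqrt : √(Real.pi / (v / 2)) = 2 * Real.pi * (√(2 * Real.pi * v))⁻¹ := by
    rw [Real.sqrt_eq_iff_mul_self_eq (by positivity) (by positivity)]
    field_simp
    rw [Real.sq_sqrt (by positivity)]
  have hcpow : ((Real.pi : ℂ) / (v / 2)) ^ (1 / 2 : ℂ) =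
      ((2 * Real.pi * (√(2 * Real.pi * v))⁻¹ : ℝ) : ℂ) := by
    have hnonneg : 0 ≤ Real.pi / ((v : ℝ) / 2) := by positivity
    rw [← hsqrt, Real.sqrt_eq_rpow, Complex.ofReal_cpow hnonneg]
    push_cast
    rfl
  calc _ = ∫ t : ℝ, Complex.exp (Complex.I * (z - y) * t) *
          Complex.exp (-(v / 2) * (t : ℂ) ^ 2) := by
        congr 1 with t
        rw [Complex.ofReal_exp, ← Complex.exp_add, ← Complex.exp_add, ← Complex.exp_add]
        congr 1
        push_cast
        ring
    _ = ((Real.pi : ℂ) / (v / 2)) ^ (1 / 2 : ℂ) * Complex.exp (-(z - y) ^ 2 / (4 * (v / 2))) :=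
        fourierIntegral_gaussian (by simpa using hv_pos) _
    _ = _ := by
        rw [hcpow, gaussianPDFReal]
        push_cast
        ring_nf

/-- Parseval's identity for `μ` and a Gaussian law. -/
theorem integral_charFun_mul_gaussian (μ : Measure ℝ) [IsFiniteMeasure μ] {v : NNReal} (hv : v ≠ 0)
    (y : ℝ) :
    ∫ t : ℝ, charFun μ t * (Real.exp (-(v * t ^ 2 / 2)) : ℂ) *
        Complex.exp (-(Complex.I * y * t)) =
      ((2 * Real.pi * ∫ z, gaussianPDFReal y v z ∂μ : ℝ) : ℂ) := by
  have hint : Integrable (Function.uncurry fun (t z : ℝ) => Complex.exp (t * z * Complex.I) *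
      (Real.exp (-(v * t ^ 2 / 2)) : ℂ) * Complex.exp (-(Complex.I * y * t)))
      (volume.prod μ) := by
    have hgauss : Integrable fun t : ℝ => Real.exp (-(v / 2) * t ^ 2) :=
      integrable_exp_neg_mul_sq (by positivity)
    refine (hgauss.mul_prod (integrable_const (1 : ℝ))).mono'
      (Continuous.aestronglyMeasurable (by fun_prop)) (Eventually.of_forall fun p => le_of_eq ?_)
    have hnorm : ‖Complex.exp (p.1 * p.2 * Complex.I)‖ = 1 := by simp [Complex.norm_exp]
    simp only [Function.uncurry, norm_mul, hnorm, norm_cexp_neg_I_mul_mul, Complex.norm_real,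
      Real.norm_eq_abs, Real.abs_exp, one_mul, mul_one]
    ring_nf
  calc _ = ∫ t : ℝ, ∫ z, Complex.exp (t * z * Complex.I) *
          (Real.exp (-(v * t ^ 2 / 2)) : ℂ) * Complex.exp (-(Complex.I * y * t)) ∂μ := by
        simp_rw [charFun_apply_real, integral_mul_const]
    _ = ∫ z, ((2 * Real.pi * gaussianPDFReal y v z : ℝ) : ℂ) ∂μ := by
        rw [integral_integral_swap hint]
        congr 1 with z
        rw [integral_cexp_mul_gaussian hv]
        push_cast
        rfl
    _ = _ := by rw [integral_complex_ofReal, integral_const_mul]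

theorem integral_gammaChar_mul_gaussian {ξ : ℝ} (hξ : 0 < ξ) {v : NNReal} (hv : v ≠ 0) (y : ℝ) :
    ∫ t : ℝ, gammaChar ξ t * (Real.exp (-(v * t ^ 2 / 2)) : ℂ) *
        Complex.exp (-(Complex.I * y * t)) =
      ((2 * Real.pi * ∫ z, gammaPDFReal ξ 1 z ∂gaussianReal y v : ℝ) : ℂ) := by
  have := isProbabilityMeasure_gammaMeasure hξ one_pos
  rw [← charFun_gammaMeasure hξ, integral_charFun_mul_gaussian _ hv,
    integral_gammaMeasure hξ one_pos, integral_gaussianReal_eq_integral_smul hv]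
  simp only [smul_eq_mul, mul_comm]

theorem abs_integral_gaussianReal_sub_le {f : ℝ → ℝ} {y d C : ℝ} (v : NNReal)
    (hf : Integrable f (gaussianReal y v))
    (htaylor : ∀ h, |f (y + h) - f y - d * h| ≤ C * h ^ 2) :
    |∫ z, f z ∂gaussianReal y v - f y| ≤ C * v := by
  have hid : Integrable (fun z : ℝ => z) (gaussianReal y v) :=
    (memLp_id_gaussianReal' 1 (by simp)).integrable le_rfl
  have hcenter : Integrable (fun z : ℝ => z - y) (gaussianReal y v) := hid.sub (integrable_const y)
  have hsq : Integrable (fun z : ℝ => (z - y) ^ 2) (gaussianReal y v) :=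
    ((memLp_id_gaussianReal' 2 (by simp)).sub (memLp_const y)).integrable_sq
  have hmean : ∫ z, (z - y) ∂gaussianReal y v = 0 := by
    rw [integral_sub hid (integrable_const y), integral_id_gaussianReal]
    simp
  have hvar : ∫ z, (z - y) ^ 2 ∂gaussianReal y v = v := by
    rw [← variance_fun_id_gaussianReal (μ := y), variance_eq_integral (by fun_prop),
      integral_id_gaussianReal]
  have hremainder : ∫ z, f z ∂gaussianReal y v - f y =
      ∫ z, (f z - f y - d * (z - y)) ∂gaussianReal y v := by
    have hsub : Integrable (fun z => f z - f y) (gaussianReal y v) :=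
      hf.sub (integrable_const (f y))
    rw [integral_sub hsub (hcenter.const_mul d), integral_sub hf (integrable_const _),
      integral_const_mul, hmean]
    simp
  calc |∫ z, f z ∂gaussianReal y v - f y|
      ≤ ∫ z, |f z - f y - d * (z - y)| ∂gaussianReal y v := by
        rw [hremainder]; exact abs_integral_le_integral_abs
    _ ≤ ∫ z, C * (z - y) ^ 2 ∂gaussianReal y v :=
        integral_mono ((hf.sub (integrable_const _)).sub (hcenter.const_mul d)).abs
          (hsq.const_mul C) fun z => by simpa using htaylor (z - y)
    _ = C * v := by rw [integral_const_mul, hvar]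

theorem exists_norm_integral_gammaChar_sub_le (M : ℝ) {ε : ℝ} (hε : 0 < ε) :
    ∃ C : ℝ, 0 < C ∧ ∀ ξ ∈ Set.Icc 1 M, ∀ v : NNReal, v ≠ 0 → ∀ y : ℝ, ε ≤ |y| →
      ‖(1 / (2 * Real.pi) : ℂ) * (∫ t : ℝ, gammaChar ξ t * (Real.exp (-(v * t ^ 2 / 2)) : ℂ) *
        Complex.exp (-(Complex.I * y * t))) - (gammaPDFReal ξ 1 y : ℂ)‖ ≤ C * v := by
  obtain ⟨C, hC, htaylor⟩ := exists_gammaPDFReal_taylor M hε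
  obtain ⟨B, -, hbound⟩ := exists_abs_gammaPDFReal_le M
  refine ⟨C, hC, fun ξ hξ v hv y hy => ?_⟩
  have hint : Integrable (gammaPDFReal ξ 1) (gaussianReal y v) :=
    (integrable_const B).mono' (measurable_gammaPDFReal ξ 1).aestronglyMeasurable
      (Eventually.of_forall (hbound ξ hξ))
  have hpi : (2 * Real.pi : ℂ) ≠ 0 := by simp
  rw [integral_gammaChar_mul_gaussian (by linarith [hξ.1]) hv, Complex.ofReal_mul,
    Complex.ofReal_mul, Complex.ofReal_ofNat, one_div, inv_mul_cancel_left₀ hpi,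
    ← Complex.ofReal_sub, Complex.norm_real, Real.norm_eq_abs]
  exact abs_integral_gaussianReal_sub_le v hint (htaylor ξ hξ y hy)

/-! ### Fourier integrals with a majorant -/

theorem integrable_comp_abs_of_integrableOn_Ioi {f : ℝ → ℝ} (hf : IntegrableOn f (Set.Ioi 0)) :
    Integrable fun x => f |x| := by
  have hpos : IntegrableOn (fun x => f |x|) (Set.Ioi 0) :=
    hf.congr_fun (fun x hx => by simp only [abs_of_pos (Set.mem_Ioi.1 hx)]) measurableSet_Ioi
  have hneg : IntegrableOn (fun x => f |x|) (Set.Iio 0) := by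
    rw [← neg_zero] at hpos
    simpa only [abs_neg] using hpos.comp_neg_Iio
  rw [← integrableOn_univ, ← Set.Iic_union_Ioi (a := (0 : ℝ))]
  exact ((integrableOn_Iic_iff_integrableOn_Iio (by simp)).2 hneg).union hpos

theorem norm_intervalIntegral_le_two_mul_integral_Ioi {F : ℝ → ℂ} {f : ℝ → ℝ} {δ : ℝ} (hδ : 0 ≤ δ)
    (hf : IntegrableOn f (Set.Ioi 0)) (hf0 : ∀ x, 0 < x → 0 ≤ f x)
    (hF : ∀ θ, θ ≠ 0 → |θ| ≤ δ → ‖F θ‖ ≤ f |θ|) :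
    ‖∫ θ in (-δ)..δ, F θ‖ ≤ 2 * ∫ x in Set.Ioi 0, f x := by
  have hint := integrable_comp_abs_of_integrableOn_Ioi hf
  have hne : ∀ᵐ z : ℝ, z ≠ 0 := by simp [ae_iff]
  have hnonneg : 0 ≤ᵐ[volume] fun x => f |x| := by
    filter_upwards [hne] with x hx using hf0 _ (abs_pos.2 hx)
  rw [← integral_comp_abs, intervalIntegral.integral_of_le (by linarith)]
  refine (norm_integral_le_of_norm_le hint.integrableOn ?_).trans
    (setIntegral_le_integral hint hnonneg)
  filter_upwards [ae_restrict_of_ae hne, ae_restrict_mem measurableSet_Ioc] with x hx hx'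
  exact hF x hx (abs_le.2 ⟨hx'.1.le, hx'.2⟩)

theorem norm_integral_sub_intervalIntegral_le {F : ℝ → ℂ} {f : ℝ → ℝ} {δ : ℝ} (hδ : 0 ≤ δ)
    (hFi : Integrable F) (hf : IntegrableOn f (Set.Ioi δ)) (hF : ∀ θ, δ < |θ| → ‖F θ‖ ≤ f |θ|) :
    ‖(∫ θ, F θ) - ∫ θ in (-δ)..δ, F θ‖ ≤ 2 * ∫ x in Set.Ioi δ, f x := by
  have hsplit : (∫ θ, F θ) - ∫ θ in (-δ)..δ, F θ =
      (∫ θ in Set.Ioi δ, F (-θ)) + ∫ θ in Set.Ioi δ, F θ := by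
    rw [integral_comp_neg_Ioi,
      ← intervalIntegral.integral_Iic_add_Ioi (b := δ) hFi.integrableOn hFi.integrableOn,
      ← intervalIntegral.integral_Iic_sub_Iic (a := -δ) (b := δ) hFi.integrableOn hFi.integrableOn]
    ring
  have htail : ∀ G : ℝ → ℂ, (∀ θ, δ < θ → ‖G θ‖ ≤ f θ) →
      ‖∫ θ in Set.Ioi δ, G θ‖ ≤ ∫ x in Set.Ioi δ, f x := fun G hG =>
    norm_integral_le_of_norm_le hf (by
      filter_upwards [ae_restrict_mem measurableSet_Ioi] with θ hθ using hG θ hθ)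
  have habs : ∀ {θ}, δ < θ → |θ| = θ := fun hθ => abs_of_pos (hδ.trans_lt hθ)
  rw [hsplit, two_mul]
  refine norm_add_le_of_le (htail _ fun θ hθ => ?_) (htail _ fun θ hθ => ?_)
  · simpa only [abs_neg, habs hθ] using hF (-θ) (by rwa [abs_neg, habs hθ])
  · simpa only [habs hθ] using hF θ (by rwa [habs hθ])

theorem norm_intervalIntegral_sub_intervalIntegral_le {Φ : ℝ → ℂ} {f : ℝ → ℝ} {δ b : ℝ}
    (hδ : 0 ≤ δ) (hδb : δ ≤ b) (hΦ : Continuous Φ) (hf : IntervalIntegrable f volume δ b)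
    (h : ∀ θ, δ < |θ| → |θ| ≤ b → ‖Φ θ‖ ≤ f |θ|) :
    ‖(∫ θ in (-b)..b, Φ θ) - ∫ θ in (-δ)..δ, Φ θ‖ ≤ 2 * ∫ x in δ..b, f x := by
  have hsplit : (∫ θ in (-b)..b, Φ θ) - ∫ θ in (-δ)..δ, Φ θ =
      (∫ θ in δ..b, Φ (-θ)) + ∫ θ in δ..b, Φ θ := by
    rw [intervalIntegral.integral_comp_neg, ← intervalIntegral.integral_add_adjacent_intervals
      (hΦ.intervalIntegrable (-b) (-δ)) (hΦ.intervalIntegrable (-δ) b),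
      ← intervalIntegral.integral_add_adjacent_intervals
      (hΦ.intervalIntegrable (-δ) δ) (hΦ.intervalIntegrable δ b)]
    ring
  have htail : ∀ G : ℝ → ℂ, (∀ θ, δ < θ → θ ≤ b → ‖G θ‖ ≤ f θ) →
      ‖∫ θ in δ..b, G θ‖ ≤ ∫ x in δ..b, f x := fun G hG =>
    intervalIntegral.norm_integral_le_of_norm_le hδb
      (Eventually.of_forall fun θ hθ => hG θ hθ.1 hθ.2) hf
  have habs : ∀ {θ}, δ < θ → |θ| = θ := fun hθ => abs_of_pos (hδ.trans_lt hθ)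
  rw [hsplit, two_mul]
  refine norm_add_le_of_le (htail _ fun θ hθ hθb => ?_) (htail _ fun θ hθ hθb => ?_)
  · simpa only [abs_neg, habs hθ] using
      h (-θ) (by rwa [abs_neg, habs hθ]) (by rwa [abs_neg, habs hθ])
  · simpa only [habs hθ] using h θ (by rwa [habs hθ]) (by rwa [habs hθ])

theorem integral_mul_exp_neg_mul_sq_le {a : ℝ} (ha : 0 < a) (δ b : ℝ) :
    ∫ θ in δ..b, θ * Real.exp (-(a * θ ^ 2)) ≤ Real.exp (-(a * δ ^ 2)) / (2 * a) := by
  have hderiv : ∀ θ : ℝ, HasDerivAt (fun θ => -(Real.exp (-(a * θ ^ 2)) / (2 * a)))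
      (θ * Real.exp (-(a * θ ^ 2))) θ := by
    intro θ
    have hsq : HasDerivAt (fun θ : ℝ => -(a * θ ^ 2)) (-(a * (2 * θ))) θ := by
      simpa using! ((hasDerivAt_pow 2 θ).const_mul a).neg
    refine (hsq.exp.div_const (2 * a)).neg.congr_deriv ?_
    field_simp
  rw [intervalIntegral.integral_eq_sub_of_hasDerivAt (fun θ _ => hderiv θ)
    (Continuous.intervalIntegrable (by fun_prop) _ _)]
  have : 0 ≤ Real.exp (-(a * b ^ 2)) / (2 * a) := by positivity
  linarith

theorem exists_integral_rpow_mul_exp_neg_sq_le {p₀ : ℝ} (p₁ : ℝ) {c : ℝ} (hp₀ : -1 < p₀)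
    (hc : 0 < c) :
    ∃ C : ℝ, 0 < C ∧ ∀ p ∈ Set.Icc p₀ p₁, ∀ σ : ℝ, 0 < σ →
      ∫ x in Set.Ioi (0 : ℝ), x ^ p * Real.exp (-(c * σ ^ 2 * x ^ 2)) ≤ C * σ ^ (-(p + 1)) := by
  have hcont : ContinuousOn (fun p : ℝ => c ^ (-(p + 1) / 2) * (1 / 2) * Real.Gamma ((p + 1) / 2))
      (Set.Icc p₀ p₁) := by
    intro p hp
    have hGamma : ContinuousAt Real.Gamma ((p + 1) / 2) :=
      (Real.differentiableAt_Gamma fun m => by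
        have := hp.1
        have : (0 : ℝ) ≤ m := m.cast_nonneg
        linarith).continuousAt
    have hpow : ContinuousAt (fun p : ℝ => c ^ (-(p + 1) / 2)) p :=
      ContinuousAt.rpow continuousAt_const (by fun_prop) (Or.inl hc.ne')
    exact ((hpow.mul continuousAt_const).mul
      (hGamma.comp (f := fun p : ℝ => (p + 1) / 2) (by fun_prop))).continuousWithinAt
  obtain ⟨C, hC⟩ := (isCompact_Icc.image_of_continuousOn hcont).bddAbove
  refine ⟨max C 1, by positivity, fun p hp σ hσ => ?_⟩
  have hbound : c ^ (-(p + 1) / 2) * (1 / 2) * Real.Gamma ((p + 1) / 2) ≤ max C 1 :=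
    (hC (Set.mem_image_of_mem _ hp)).trans (le_max_left _ _)
  have hvalue := integral_rpow_mul_exp_neg_mul_rpow (p := 2) (q := p) (b := c * σ ^ 2) two_pos
    (by linarith [hp.1]) (by positivity)
  simp only [Real.rpow_two, neg_mul] at hvalue
  have hσpow : (σ ^ 2) ^ (-(p + 1) / 2) = σ ^ (-(p + 1)) := by
    rw [← Real.rpow_natCast, ← Real.rpow_mul hσ.le]
    congr 1
    push_cast
    ring
  rw [hvalue, Real.mul_rpow hc.le (by positivity), hσpow]
  calc _ = c ^ (-(p + 1) / 2) * (1 / 2) * Real.Gamma ((p + 1) / 2) * σ ^ (-(p + 1)) := by ring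
    _ ≤ _ := by gcongr

theorem exists_mul_norm_integral_le_of_gaussian_bound {p₀ : ℝ} (p₁ : ℝ) {c : ℝ} (hp₀ : -1 < p₀)
    (hc : 0 < c) :
    ∃ C : ℝ, 0 < C ∧ ∀ (q η α σ δ A : ℝ) (F : ℝ → ℂ), q - η ∈ Set.Icc p₀ p₁ → 0 < α → 0 < σ →
      0 ≤ δ → 0 ≤ A →
      (∀ θ, θ ≠ 0 → |θ| ≤ δ →
        ‖F θ‖ ≤ A * ((α * |θ|) ^ (-η) * |θ| ^ q * Real.exp (-(c * σ ^ 2 * θ ^ 2)))) →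
      α * ‖∫ θ in (-δ)..δ, F θ‖ ≤ C * (A * σ ^ (-q) * (σ / α) ^ (η - 1)) := by
  obtain ⟨C, hC, hmoment⟩ := exists_integral_rpow_mul_exp_neg_sq_le p₁ hp₀ hc
  refine ⟨2 * C, by positivity, fun q η α σ δ A F hqη hα hσ hδ hA hF => ?_⟩
  have hint : IntegrableOn (fun x : ℝ => x ^ (q - η) * Real.exp (-(c * σ ^ 2 * x ^ 2)))
      (Set.Ioi 0) := by
    simpa only [neg_mul] using
      integrableOn_rpow_mul_exp_neg_mul_sq (b := c * σ ^ 2) (by positivity)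
        (hp₀.trans_le hqη.1)
  have hmajorant := norm_intervalIntegral_le_two_mul_integral_Ioi (F := F)
    (f := fun x => A * α ^ (-η) * (x ^ (q - η) * Real.exp (-(c * σ ^ 2 * x ^ 2)))) hδ
    (hint.const_mul _) (fun x hx => by positivity) fun θ hθ hθδ => by
      have hθ' : 0 < |θ| := abs_pos.2 hθ
      refine (hF θ hθ hθδ).trans_eq ?_
      rw [Real.mul_rpow hα.le hθ'.le, sq_abs, sub_eq_add_neg, Real.rpow_add hθ']
      ring
  rw [integral_const_mul] at hmajorant
  have hscale : α * (α ^ (-η) * σ ^ (-(q - η + 1))) = σ ^ (-q) * (σ / α) ^ (η - 1) := by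
    rw [Real.div_rpow hσ.le hα.le, show -(q - η + 1) = -q + (η - 1) by ring, Real.rpow_add hσ,
      show -η = -(η - 1) + -1 by ring, Real.rpow_add hα, Real.rpow_neg hα.le (η - 1),
      Real.rpow_neg_one]
    field_simp
  calc α * ‖∫ θ in (-δ)..δ, F θ‖
      ≤ α * (2 * (A * α ^ (-η) * (C * σ ^ (-(q - η + 1))))) := by
        gcongr
        exact hmajorant.trans (by gcongr; exact hmoment _ hqη σ hσ)
    _ = 2 * C * A * (α * (α ^ (-η) * σ ^ (-(q - η + 1)))) := by ring
    _ = _ := by rw [hscale]; ring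

/-! ### Fourier inversion in the gamma regime -/

/-- The range of parameters in which the gamma approximation is estimated: shape `ξ` and scale `α`
of the gamma factor, and `σ`, `β = β^{(2+r)}`, `γ` and `δ` of the other summands. The field
`delta_rpow` rewrites `δ^r = σ² / (2 β^{(2+r)})`. -/
structure GammaRegime (M r ξ α σ β γ δ : ℝ) : Prop where
  shape_mem : ξ ∈ Set.Icc 1 M
  sigma_pos : 0 < σ
  sigma_le : σ ≤ α
  moment_nonneg : 0 ≤ β
  gamma_pos : 0 < γ
  delta_pos : 0 < δ
  delta_le_two : δ ≤ 2
  one_le_sigma_mul_delta : 1 ≤ σ * δ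
  delta_rpow : (σ * δ) ^ (-r) = 2 * (β / σ ^ (2 + r))

namespace GammaRegime

variable {M r ξ α σ β γ δ : ℝ}

theorem scale_pos (h : GammaRegime M r ξ α σ β γ δ) : 0 < α := h.sigma_pos.trans_le h.sigma_le

theorem ratio_pos (h : GammaRegime M r ξ α σ β γ δ) : 0 < σ / α := div_pos h.sigma_pos h.scale_pos

theorem ratio_le_one (h : GammaRegime M r ξ α σ β γ δ) : σ / α ≤ 1 :=
  (div_le_one h.scale_pos).2 h.sigma_le

theorem moment_ratio_nonneg (h : GammaRegime M r ξ α σ β γ δ) : 0 ≤ β / σ ^ (2 + r) :=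
  div_nonneg h.moment_nonneg (Real.rpow_nonneg h.sigma_pos.le _)

theorem moment_ratio_le_one (h : GammaRegime M r ξ α σ β γ δ) (hr : 0 ≤ r) :
    β / σ ^ (2 + r) ≤ 1 := by
  have : (σ * δ) ^ (-r) ≤ 1 :=
    Real.rpow_le_one_of_one_le_of_nonpos h.one_le_sigma_mul_delta (by linarith)
  linarith [h.delta_rpow, h.moment_ratio_nonneg]

theorem le_gammaError (h : GammaRegime M r ξ α σ β γ δ) :
    (σ / α) ^ 2 ≤ gammaError α ξ r σ β γ δ ∧ 1 / α ≤ gammaError α ξ r σ β γ δ ∧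
      β / σ ^ (2 + r) * (σ / α) ^ (ξ - 1) ≤ gammaError α ξ r σ β γ δ ∧
      Real.exp (-(γ ^ 2 * δ ^ 2 / 5)) / (γ ^ 2 * δ ^ (ξ + 1) * α ^ (ξ - 1)) ≤
        gammaError α ξ r σ β γ δ := by
  have hα := h.scale_pos
  have hδ := h.delta_pos
  have hratio := h.ratio_pos
  have hmoment := h.moment_ratio_nonneg
  have h₁ : 0 ≤ (σ / α) ^ 2 := by positivity
  have h₂ : 0 ≤ 1 / α := by positivity
  have h₃ : 0 ≤ β / σ ^ (2 + r) * (σ / α) ^ (2 + r) := by positivity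
  have h₄ : 0 ≤ β / σ ^ (2 + r) * (σ / α) ^ (ξ - 1) := by positivity
  have h₅ : 0 ≤ Real.exp (-(γ ^ 2 * δ ^ 2 / 5)) / (γ ^ 2 * δ ^ (ξ + 1) * α ^ (ξ - 1)) := by
    positivity
  rw [gammaError]
  refine ⟨?_, ?_, ?_, ?_⟩ <;> linarith

theorem delta_rpow_mul_le_gammaError (h : GammaRegime M r ξ α σ β γ δ) :
    (σ * δ) ^ (-r) * (σ / α) ^ (ξ - 1) ≤ 2 * gammaError α ξ r σ β γ δ := by
  rw [h.delta_rpow, mul_assoc]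
  exact mul_le_mul_of_nonneg_left h.le_gammaError.2.2.1 zero_le_two

theorem gammaError_nonneg (h : GammaRegime M r ξ α σ β γ δ) : 0 ≤ gammaError α ξ r σ β γ δ :=
  (sq_nonneg _).trans h.le_gammaError.1

end GammaRegime

theorem norm_gammaChar_mul_le {ξ η α θ : ℝ} (hη : 0 ≤ η) (hξ : η ≤ ξ) (hα : 0 < α) (hθ : θ ≠ 0) :
    ‖gammaChar ξ (α * θ)‖ ≤ (α * |θ|) ^ (-η) := by
  simpa only [abs_mul, abs_of_pos hα] using
    norm_gammaChar_le_rpow hη hξ (t := α * θ) (mul_ne_zero hα.ne' hθ)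

theorem continuous_gammaChar_mul (ξ α : ℝ) : Continuous fun θ : ℝ => gammaChar ξ (α * θ) :=
  (continuous_gammaChar ξ).comp (continuous_const_mul α)

theorem GammaRegime.mul_norm_integral_sub_truncation_le {M r ξ α σ β γ δ L : ℝ} {Φ : ℝ → ℂ}
    (h : GammaRegime M r ξ α σ β γ δ) (hΦ : Continuous Φ) (hL : 0 ≤ L)
    (hΦ_le : ∀ θ, δ < |θ| → |θ| ≤ Real.pi →
      ‖Φ θ‖ ≤ L * ((α * |θ|) ^ (-ξ) * Real.exp (-(γ ^ 2 * θ ^ 2 / 5)))) :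
    α * ‖(∫ θ in (-Real.pi)..Real.pi, Φ θ) - ∫ θ in (-δ)..δ, Φ θ‖ ≤
      5 * L * gammaError α ξ r σ β γ δ := by
  have hα := h.scale_pos
  have hγ := h.gamma_pos
  have hδ := h.delta_pos
  have hpow : ∀ x, δ < x → (α * x) ^ (-ξ) ≤ α ^ (-ξ) * δ ^ (-ξ - 1) * x := by
    intro x hx
    have hx0 : 0 < x := hδ.trans hx
    have hanti : x ^ (-ξ - 1) ≤ δ ^ (-ξ - 1) :=
      Real.rpow_le_rpow_of_nonpos hδ hx.le (by linarith [h.shape_mem.1])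
    calc (α * x) ^ (-ξ) = α ^ (-ξ) * x ^ (-ξ - 1) * x := by
          rw [Real.mul_rpow hα.le hx0.le, mul_assoc, ← Real.rpow_add_one hx0.ne', sub_add_cancel]
      _ ≤ _ := by gcongr
  set Q : ℝ := L * (α ^ (-ξ) * δ ^ (-ξ - 1)) with hQ
  have hmajorant := norm_intervalIntegral_sub_intervalIntegral_le
    (f := fun x => Q * (x * Real.exp (-(γ ^ 2 / 5 * x ^ 2)))) hδ.le
    (h.delta_le_two.trans Real.two_le_pi) hΦ (Continuous.intervalIntegrable (by fun_prop) _ _)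
    fun θ hδθ hθπ => by
      calc ‖Φ θ‖ ≤ L * (α ^ (-ξ) * δ ^ (-ξ - 1) * |θ| * Real.exp (-(γ ^ 2 * θ ^ 2 / 5))) :=
            (hΦ_le θ hδθ hθπ).trans (by gcongr; exact hpow _ hδθ)
        _ = _ := by rw [sq_abs, div_mul_eq_mul_div]; ring
  rw [intervalIntegral.integral_const_mul] at hmajorant
  calc α * ‖(∫ θ in (-Real.pi)..Real.pi, Φ θ) - ∫ θ in (-δ)..δ, Φ θ‖
      ≤ α * (2 * (Q * (Real.exp (-(γ ^ 2 / 5 * δ ^ 2)) / (2 * (γ ^ 2 / 5))))) := by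
        gcongr
        refine hmajorant.trans ?_
        gcongr
        exact integral_mul_exp_neg_mul_sq_le (by positivity) _ _
    _ = 5 * L * (Real.exp (-(γ ^ 2 * δ ^ 2 / 5)) / (γ ^ 2 * δ ^ (ξ + 1) * α ^ (ξ - 1))) := by
        rw [hQ, show -ξ - 1 = -(ξ + 1) by ring, Real.rpow_neg hδ.le, Real.rpow_sub_one hα.ne',
          Real.rpow_neg hα.le, div_mul_eq_mul_div]
        field_simp
    _ ≤ _ := by gcongr; exact h.le_gammaError.2.2.2

theorem mul_rpow_min_sub_one_le {T s ξ κ : ℝ} (hT0 : 0 ≤ T) (hT1 : T ≤ 1) (hs0 : 0 < s)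
    (hs1 : s ≤ 1) (hκ : 3 ≤ κ) : T * s ^ (min ξ κ - 1) ≤ T * s ^ (ξ - 1) + s ^ 2 := by
  rcases le_total ξ κ with hle | hle
  · rw [min_eq_left hle]
    exact le_add_of_nonneg_right (by positivity)
  · have hexp : s ^ (κ - 1) ≤ s ^ 2 := by
      rw [← Real.rpow_two]
      exact Real.rpow_le_rpow_of_exponent_ge hs0 hs1 (by linarith)
    rw [min_eq_right hle]
    calc T * s ^ (κ - 1) ≤ 1 * s ^ 2 := by gcongr
      _ ≤ _ := by linarith [show 0 ≤ T * s ^ (ξ - 1) by positivity]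

theorem GammaRegime.exists_mul_norm_integral_gammaChar_mul_le {r c : ℝ} (hr : 0 < r)
    (hc : 0 < c) :
    ∃ C : ℝ, 0 < C ∧ ∀ (M ξ α σ β γ δ A L : ℝ) (H D : ℝ → ℂ), GammaRegime M r ξ α σ β γ δ →
      0 ≤ A → 0 ≤ L → (∀ θ, |θ| ≤ δ → ‖H θ‖ ≤ A) →
      (∀ θ, |θ| ≤ δ → ‖D θ‖ ≤ L * β * |θ| ^ (2 + r) * Real.exp (-(c * σ ^ 2 * θ ^ 2))) →
      α * ‖∫ θ in (-δ)..δ, gammaChar ξ (α * θ) * H θ * D θ‖ ≤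
        C * (A * L) * gammaError α ξ r σ β γ δ := by
  obtain ⟨C, hC, hgauss⟩ := exists_mul_norm_integral_le_of_gaussian_bound (p₀ := -1 + r / 2) (1 + r)
    (c := c) (by linarith) hc
  refine ⟨2 * C, by positivity, fun M ξ α σ β γ δ A L H D h hA hL hH hD => ?_⟩
  have hα := h.scale_pos
  have hσ := h.sigma_pos
  have hβ := h.moment_nonneg
  -- Capping the decay exponent at `3 + r / 2` keeps the moment integral convergent at the origin.
  set η := min ξ (3 + r / 2)
  have hη1 : 1 ≤ η := le_min h.shape_mem.1 (by linarith)
  have hη2 : η ≤ 3 + r / 2 := min_le_right _ _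
  have hbound := hgauss (2 + r) η α σ δ (A * L * β) (fun θ => gammaChar ξ (α * θ) * H θ * D θ)
    ⟨by linarith, by linarith⟩ hα hσ h.delta_pos.le (by positivity) fun θ hθ hθδ => by
      have hdecay := norm_gammaChar_mul_le (η := η) (by linarith) (min_le_left _ _) hα hθ
      rw [norm_mul, norm_mul]
      calc ‖gammaChar ξ (α * θ)‖ * ‖H θ‖ * ‖D θ‖ ≤ (α * |θ|) ^ (-η) * A *
          (L * β * |θ| ^ (2 + r) * Real.exp (-(c * σ ^ 2 * θ ^ 2))) := by
            gcongr
            · exact hH θ hθδ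
            · exact hD θ hθδ
        _ = _ := by ring
  calc _ ≤ C * (A * L) * (β / σ ^ (2 + r) * (σ / α) ^ (η - 1)) := by
        refine hbound.trans_eq ?_
        rw [Real.rpow_neg hσ.le]
        ring
    _ ≤ C * (A * L) * (2 * gammaError α ξ r σ β γ δ) := by
        refine mul_le_mul_of_nonneg_left ?_ (by positivity)
        have hcap := mul_rpow_min_sub_one_le (ξ := ξ) h.moment_ratio_nonneg
          (h.moment_ratio_le_one hr.le) h.ratio_pos h.ratio_le_one
          (show 3 ≤ 3 + r / 2 by linarith)
        linarith [h.le_gammaError.1, h.le_gammaError.2.2.1]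
    _ = _ := by ring

/-- The characteristic function of the centred normal law with standard deviation `σ`. -/
noncomputable def gaussianChar (σ θ : ℝ) : ℂ := Real.exp (-(σ ^ 2 * θ ^ 2 / 2))

theorem norm_gaussianChar (σ θ : ℝ) : ‖gaussianChar σ θ‖ = Real.exp (-(σ ^ 2 * θ ^ 2 / 2)) := by
  rw [gaussianChar, Complex.norm_real, Real.norm_eq_abs, Real.abs_exp]

theorem norm_gaussianChar_le_one (σ θ : ℝ) : ‖gaussianChar σ θ‖ ≤ 1 := by
  rw [norm_gaussianChar, Real.exp_le_one_iff, neg_nonpos]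
  positivity

@[fun_prop]
theorem continuous_gaussianChar (σ : ℝ) : Continuous (gaussianChar σ) := by
  unfold gaussianChar
  fun_prop

theorem hasDerivAt_gaussianChar (σ θ : ℝ) :
    HasDerivAt (gaussianChar σ) (-(σ ^ 2 * θ : ℝ) * gaussianChar σ θ) θ := by
  have hexponent : HasDerivAt (fun θ : ℝ => -(σ ^ 2 * θ ^ 2 / 2)) (-(σ ^ 2 * θ)) θ := by
    refine ((((hasDerivAt_pow 2 θ).const_mul (σ ^ 2)).div_const 2).neg).congr_deriv ?_
    norm_num
    ring
  refine hexponent.exp.ofReal_comp.congr_deriv ?_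
  simp only [gaussianChar]
  push_cast
  ring

theorem integrable_gammaChar_mul_gaussianChar {ξ σ : ℝ} (α a : ℝ) (hξ : 0 ≤ ξ) (hσ : 0 < σ) :
    Integrable fun θ : ℝ =>
      gammaChar ξ (α * θ) * gaussianChar σ θ * Complex.exp (-(Complex.I * a * θ)) := by
  have hgauss : Integrable fun θ : ℝ => Real.exp (-(σ ^ 2 / 2) * θ ^ 2) :=
    integrable_exp_neg_mul_sq (by positivity)
  have hcont := continuous_gammaChar_mul ξ α
  refine hgauss.mono' (Continuous.aestronglyMeasurable (by fun_prop))
    (Eventually.of_forall fun θ => ?_)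
  rw [norm_mul, norm_mul, norm_cexp_neg_I_mul_mul, mul_one, norm_gaussianChar]
  calc _ ≤ 1 * Real.exp (-(σ ^ 2 * θ ^ 2 / 2)) := by gcongr; exact norm_gammaChar_le_one hξ _
    _ = _ := by rw [one_mul]; ring_nf

theorem norm_gaussianChar_le_rpow_neg_two {σ θ : ℝ} (hσ : 0 < σ) (hθ : θ ≠ 0) :
    ‖gaussianChar σ θ‖ ≤ 2 / σ ^ 2 * |θ| ^ (-2 : ℝ) := by
  have hθ' : 0 < |θ| := abs_pos.2 hθ
  rw [norm_gaussianChar, ← sq_abs θ, Real.rpow_neg hθ'.le, Real.rpow_two, Real.exp_neg]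
  have := Real.add_one_le_exp (σ ^ 2 * |θ| ^ 2 / 2)
  calc (Real.exp (σ ^ 2 * |θ| ^ 2 / 2))⁻¹ ≤ (σ ^ 2 * |θ| ^ 2 / 2)⁻¹ := by gcongr; linarith
    _ = _ := by field_simp

theorem GammaRegime.mul_norm_integral_gaussian_sub_truncation_le {M r ξ α σ β γ δ : ℝ}
    (h : GammaRegime M r ξ α σ β γ δ) (hr : r ≤ 1) (a : ℝ) :
    α * ‖(∫ θ, gammaChar ξ (α * θ) * gaussianChar σ θ * Complex.exp (-(Complex.I * a * θ))) -
        ∫ θ in (-δ)..δ, gammaChar ξ (α * θ) * gaussianChar σ θ *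
          Complex.exp (-(Complex.I * a * θ))‖ ≤ 8 * gammaError α ξ r σ β γ δ := by
  have hα := h.scale_pos
  have hσ := h.sigma_pos
  have hδ := h.delta_pos
  have hξ : 0 ≤ ξ := zero_le_one.trans h.shape_mem.1
  have hmajorant := norm_integral_sub_intervalIntegral_le
    (f := fun x => (α * δ) ^ (-ξ) * (2 / σ ^ 2) * x ^ (-2 : ℝ)) hδ.le
    (integrable_gammaChar_mul_gaussianChar α a hξ hσ)
    ((integrableOn_Ioi_rpow_of_lt (by norm_num) hδ).const_mul _) fun θ hθ => by
      have hθ0 : θ ≠ 0 := abs_pos.1 (hδ.trans hθ)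
      rw [norm_mul, norm_mul, norm_cexp_neg_I_mul_mul, mul_one, mul_assoc]
      have hdecay : ‖gammaChar ξ (α * θ)‖ ≤ (α * δ) ^ (-ξ) :=
        (norm_gammaChar_mul_le hξ le_rfl hα hθ0).trans
          (Real.rpow_le_rpow_of_nonpos (by positivity) (by gcongr) (by linarith))
      gcongr
      exact norm_gaussianChar_le_rpow_neg_two hσ hθ0
  have htail : ∫ x in Set.Ioi δ, (α * δ) ^ (-ξ) * (2 / σ ^ 2) * x ^ (-2 : ℝ) =
      (α * δ) ^ (-ξ) * (2 / σ ^ 2) * δ⁻¹ := by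
    rw [integral_const_mul, integral_Ioi_rpow_of_lt (by norm_num) hδ]
    norm_num [Real.rpow_neg_one]
  rw [htail] at hmajorant
  calc _ ≤ α * (2 * ((α * δ) ^ (-ξ) * (2 / σ ^ 2) * δ⁻¹)) := by gcongr
    _ = 4 * ((σ * δ) ^ (-(ξ + 1)) * (σ / α) ^ (ξ - 1)) := by
        rw [Real.div_rpow hσ.le hα.le, Real.mul_rpow hσ.le hδ.le, Real.mul_rpow hα.le hδ.le,
          Real.rpow_neg hα.le, Real.rpow_neg hδ.le, Real.rpow_neg hδ.le, Real.rpow_neg hσ.le,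
          Real.rpow_sub_one hσ.ne', Real.rpow_sub_one hα.ne', Real.rpow_add_one hσ.ne',
          Real.rpow_add_one hδ.ne']
        field_simp
        norm_num
    _ ≤ 4 * ((σ * δ) ^ (-r) * (σ / α) ^ (ξ - 1)) := by
        have := h.ratio_pos
        gcongr
        · exact h.one_le_sigma_mul_delta
        · linarith
    _ ≤ _ := by linarith [h.delta_rpow_mul_le_gammaError]

theorem mul_integral_comp_mul_left_gammaChar (ξ σ y : ℝ) {α : ℝ} (hα : 0 < α) :
    (α : ℂ) * ∫ θ : ℝ, gammaChar ξ (α * θ) * gaussianChar σ θ *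
        Complex.exp (-(Complex.I * ((α * y : ℝ) : ℂ) * θ)) =
      ∫ t : ℝ, gammaChar ξ t * gaussianChar (σ / α) t * Complex.exp (-(Complex.I * y * t)) := by
  have hscale : ∀ θ : ℝ, gaussianChar (σ / α) (α * θ) = gaussianChar σ θ := fun θ => by
    rw [gaussianChar, gaussianChar]
    congr 4
    field_simp
  have hsubst := Measure.integral_comp_mul_left (fun t : ℝ => gammaChar ξ t *
    gaussianChar (σ / α) t * Complex.exp (-(Complex.I * y * t))) α
  rw [abs_of_pos (inv_pos.2 hα), Complex.real_smul] at hsubst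
  have hα' : (α : ℂ) ≠ 0 := by exact_mod_cast hα.ne'
  rw [Complex.ofReal_inv, eq_inv_mul_iff_mul_eq₀ hα'] at hsubst
  rw [← hsubst]
  congr 2 with θ
  rw [hscale]
  push_cast
  ring_nf

theorem integrable_one_add_sq_rpow :
    Integrable fun t : ℝ => (1 + t ^ 2) ^ (-(3 / 2 : ℝ) / 2) := by
  simpa only [Real.norm_eq_abs, sq_abs] using
    integrable_rpow_neg_one_add_norm_sq (E := ℝ) (r := 3 / 2) (μ := volume) (by norm_num)

theorem exists_norm_integral_le_of_gammaChar_bound_of_le :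
    ∃ C : ℝ, 0 < C ∧ ∀ (ξ α σ δ L : ℝ) (F : ℝ → ℂ), ξ ∈ Set.Icc 1 (3 / 2) → 0 < σ → σ ≤ α →
      0 ≤ δ → 0 ≤ L →
      (∀ θ, |θ| ≤ δ → ‖F θ‖ ≤ L * (‖gammaChar ξ (α * θ)‖ * Real.exp (-(1 / 4 * σ ^ 2 * θ ^ 2)))) →
      ‖∫ θ in (-δ)..δ, F θ‖ ≤ C * L * (1 / σ * (σ / α) ^ (ξ - 1)) := by
  obtain ⟨C, hC, hgauss⟩ := exists_mul_norm_integral_le_of_gaussian_bound (p₀ := -1 / 2) 0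
    (c := 1 / 4) (by norm_num) (by norm_num)
  refine ⟨C, hC, fun ξ α σ δ L F hξ hσ hσα hδ hL hF => ?_⟩
  have hα : 0 < α := hσ.trans_le hσα
  have hratio : 0 < σ / α := by positivity
  have hbound := hgauss 0 (1 / 2) α σ δ L F (by norm_num) hα hσ hδ hL fun θ hθ hθδ => by
    have hdecay := norm_gammaChar_mul_le (ξ := ξ) (η := 1 / 2) (by norm_num)
      (by linarith [hξ.1]) hα hθ
    refine (hF θ hθδ).trans ?_
    rw [Real.rpow_zero, mul_one]
    gcongr
  have hexponent : (σ / α) ^ (1 / 2 : ℝ) ≤ (σ / α) ^ (ξ - 1) :=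
    Real.rpow_le_rpow_of_exponent_ge hratio ((div_le_one hα).2 hσα) (by linarith [hξ.2])
  refine le_of_mul_le_mul_left (hbound.trans ?_) hα
  calc C * (L * σ ^ (-0 : ℝ) * (σ / α) ^ (1 / 2 - 1 : ℝ))
      = α * (C * L * (1 / σ * (σ / α) ^ (1 / 2 : ℝ))) := by
        rw [Real.rpow_sub_one hratio.ne', neg_zero, Real.rpow_zero]
        field_simp
    _ ≤ _ := by gcongr

theorem exists_norm_integral_le_of_gammaChar_bound_of_ge :
    ∃ C : ℝ, 0 < C ∧ ∀ (ξ α δ L : ℝ) (F : ℝ → ℂ), 3 / 2 ≤ ξ → 0 < α → 0 ≤ δ → 0 ≤ L →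
      (∀ θ, |θ| ≤ δ → ‖F θ‖ ≤ L * ‖gammaChar ξ (α * θ)‖) →
      ‖∫ θ in (-δ)..δ, F θ‖ ≤ C * L * (1 / α) := by
  set J : ℝ := ∫ t in Set.Ioi (0 : ℝ), (1 + t ^ 2) ^ (-(3 / 2 : ℝ) / 2) with hJ
  have : 0 ≤ J := setIntegral_nonneg measurableSet_Ioi fun t _ => by positivity
  refine ⟨2 * J + 1, by positivity, fun ξ α δ L F hξ hα hδ hL hF => ?_⟩
  have hdecay : ∀ θ, ‖gammaChar ξ (α * θ)‖ ≤ (1 + (α * |θ|) ^ 2) ^ (-(3 / 2 : ℝ) / 2) := by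
    intro θ
    rw [norm_gammaChar, mul_pow, mul_pow, sq_abs]
    refine Real.rpow_le_rpow_of_exponent_le ?_ (by linarith)
    have : 0 ≤ α ^ 2 * θ ^ 2 := by positivity
    linarith
  have hmajorant := norm_intervalIntegral_le_two_mul_integral_Ioi (F := F)
    (f := fun x => L * (1 + (α * x) ^ 2) ^ (-(3 / 2 : ℝ) / 2)) hδ
    ((integrable_one_add_sq_rpow.comp_mul_left' hα.ne').const_mul L).integrableOn
    (fun x _ => by positivity) fun θ _ hθδ => (hF θ hθδ).trans (by gcongr; exact hdecay θ)
  have hsubst := integral_comp_mul_left_Ioi (fun t : ℝ => (1 + t ^ 2) ^ (-(3 / 2 : ℝ) / 2)) 0 hα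
  rw [mul_zero, ← hJ, smul_eq_mul] at hsubst
  rw [integral_const_mul, hsubst] at hmajorant
  calc _ ≤ 2 * J * L * (1 / α) := hmajorant.trans_eq (by rw [one_div]; ring)
    _ ≤ _ := by gcongr; linarith

theorem exists_norm_integral_le_of_gammaChar_bound :
    ∃ C : ℝ, 0 < C ∧ ∀ (ξ α σ δ L : ℝ) (F : ℝ → ℂ), 1 ≤ ξ → 0 < σ → σ ≤ α → 0 ≤ δ → 0 ≤ L →
      (∀ θ, |θ| ≤ δ → ‖F θ‖ ≤ L * (‖gammaChar ξ (α * θ)‖ * Real.exp (-(1 / 4 * σ ^ 2 * θ ^ 2)))) →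
      ‖∫ θ in (-δ)..δ, F θ‖ ≤ C * L * (1 / α + 1 / σ * (σ / α) ^ (ξ - 1)) := by
  obtain ⟨C₁, hC₁, hsmall⟩ := exists_norm_integral_le_of_gammaChar_bound_of_le
  obtain ⟨C₂, hC₂, hlarge⟩ := exists_norm_integral_le_of_gammaChar_bound_of_ge
  refine ⟨C₁ + C₂, by positivity, fun ξ α σ δ L F hξ hσ hσα hδ hL hF => ?_⟩
  have hα : 0 < α := hσ.trans_le hσα
  have hnonneg₁ : 0 ≤ 1 / α := by positivity
  have hnonneg₂ : 0 ≤ 1 / σ * (σ / α) ^ (ξ - 1) := by positivity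
  rcases le_total ξ (3 / 2) with hle | hle
  · refine (hsmall ξ α σ δ L F ⟨hξ, hle⟩ hσ hσα hδ hL hF).trans ?_
    gcongr <;> linarith
  · refine (hlarge ξ α δ L F hle hα hδ hL fun θ hθ => (hF θ hθ).trans ?_).trans ?_
    · gcongr
      refine mul_le_of_le_one_right (norm_nonneg _) (Real.exp_le_one_iff.2 ?_)
      rw [neg_nonpos]
      positivity
    · gcongr <;> linarith

theorem hasDerivAt_gammaChar_mul (ξ α θ : ℝ) :
    HasDerivAt (fun θ : ℝ => gammaChar ξ (α * θ))
      (gammaChar ξ (α * θ) * (ξ * Complex.I * α / (1 - Complex.I * (α * θ : ℝ)))) θ := by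
  refine ((hasDerivAt_gammaChar ξ (α * θ)).scomp θ
    (by simpa using (hasDerivAt_id θ).const_mul α)).congr_deriv ?_
  rw [Complex.real_smul]
  ring

theorem norm_deriv_gammaChar_mul_le {ξ α : ℝ} (hξ : 0 ≤ ξ) (hα : 0 ≤ α) (θ : ℝ) :
    |θ| * ‖deriv (fun θ : ℝ => gammaChar ξ (α * θ)) θ‖ ≤ ξ * ‖gammaChar ξ (α * θ)‖ := by
  have hden : α * |θ| ≤ ‖1 - Complex.I * ((α * θ : ℝ) : ℂ)‖ := by
    simpa [abs_mul, abs_of_nonneg hα] using abs_le_norm_one_sub_I_mul (α * θ)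
  have hquot : α * |θ| / ‖1 - Complex.I * ((α * θ : ℝ) : ℂ)‖ ≤ 1 :=
    div_le_one_of_le₀ hden (norm_nonneg _)
  rw [(hasDerivAt_gammaChar_mul ξ α θ).deriv, norm_mul, norm_div, norm_mul, norm_mul,
    Complex.norm_I, mul_one, Complex.norm_of_nonneg hξ, Complex.norm_of_nonneg hα]
  calc _ = ξ * ‖gammaChar ξ (α * θ)‖ * (α * |θ| / ‖1 - Complex.I * ((α * θ : ℝ) : ℂ)‖) := by ring
    _ ≤ _ := mul_le_of_le_one_right (by positivity) hquot

theorem norm_integral_mul_cexp_le {h : ℝ → ℂ} {a δ : ℝ} (hd : Differentiable ℝ h)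
    (hi : IntervalIntegrable (deriv h) volume (-δ) δ) :
    |a| * ‖∫ θ in (-δ)..δ, h θ * Complex.exp (-(Complex.I * a * θ))‖ ≤
      ‖h δ‖ + ‖h (-δ)‖ + ‖∫ θ in (-δ)..δ, deriv h θ * Complex.exp (-(Complex.I * a * θ))‖ := by
  have hparts := intervalIntegral.integral_mul_deriv_eq_deriv_mul (a := -δ) (b := δ)
    (fun θ _ => (hd θ).hasDerivAt) (fun θ _ => hasDerivAt_cexp_neg_I_mul_mul a θ) hi
    (Continuous.intervalIntegrable (by fun_prop) _ _)
  simp only [mul_left_comm _ (-(Complex.I * (a : ℂ))), intervalIntegral.integral_const_mul]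
    at hparts
  calc _ = ‖-(Complex.I * a) * ∫ θ in (-δ)..δ, h θ * Complex.exp (-(Complex.I * a * θ))‖ := by
        rw [norm_mul, norm_neg, norm_mul, Complex.norm_I, one_mul, Complex.norm_real,
          Real.norm_eq_abs]
    _ ≤ _ := by
        rw [hparts]
        refine norm_sub_le_of_le (norm_sub_le_of_le ?_ ?_) le_rfl <;>
          rw [norm_mul, norm_cexp_neg_I_mul_mul, mul_one]

theorem norm_sub_one_le_of_norm_deriv_le {Ψ : ℝ → ℂ} {A δ : ℝ} (hΨ : Differentiable ℝ Ψ)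
    (hΨ' : ∀ θ, |θ| ≤ δ → ‖deriv Ψ θ‖ ≤ A) (hΨ0 : Ψ 0 = 1) {θ : ℝ} (hθ : |θ| ≤ δ) :
    ‖Ψ θ - 1‖ ≤ A * |θ| := by
  have hδ : 0 ≤ δ := (abs_nonneg _).trans hθ
  have := (convex_closedBall (0 : ℝ) δ).norm_image_sub_le_of_norm_deriv_le (f := Ψ)
    (fun x _ => hΨ x) (fun x hx => hΨ' x (by simpa using hx)) (x := 0) (y := θ)
    (by simpa using hδ) (by simpa using hθ)
  simpa [hΨ0] using this

theorem one_add_mul_exp_neg_le (u : ℝ) :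
    (1 + u) * Real.exp (-(u / 2)) ≤ 4 * Real.exp (-(u / 4)) := by
  have hlinear : 1 + u ≤ 4 * Real.exp (u / 4) := by linarith [Real.add_one_le_exp (u / 4)]
  calc _ ≤ 4 * Real.exp (u / 4) * Real.exp (-(u / 2)) := by gcongr
    _ = _ := by rw [mul_assoc, ← Real.exp_add]; ring_nf

/-- The difference that replacing a correction factor `Ψ`, with `Ψ 0 = 1`, by `1` makes in the
characteristic function of a gamma variable of scale `α` perturbed by Gaussian noise. -/
noncomputable def correctionKernel (ξ α σ : ℝ) (Ψ : ℝ → ℂ) (θ : ℝ) : ℂ :=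
  gammaChar ξ (α * θ) * (Ψ θ - 1) * gaussianChar σ θ

section CorrectionKernel

variable {M r ξ α σ β γ δ A : ℝ} {Ψ : ℝ → ℂ}

theorem hasDerivAt_correctionKernel (ξ α σ : ℝ) (hΨ : Differentiable ℝ Ψ) (θ : ℝ) :
    HasDerivAt (correctionKernel ξ α σ Ψ)
      ((deriv (fun θ : ℝ => gammaChar ξ (α * θ)) θ * (Ψ θ - 1) + gammaChar ξ (α * θ) * deriv Ψ θ) *
          gaussianChar σ θ +
        gammaChar ξ (α * θ) * (Ψ θ - 1) * (-(σ ^ 2 * θ : ℝ) * gaussianChar σ θ)) θ :=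
  ((hasDerivAt_gammaChar_mul ξ α θ).differentiableAt.hasDerivAt.mul
    ((hΨ θ).hasDerivAt.sub_const 1)).mul (hasDerivAt_gaussianChar σ θ)

theorem norm_deriv_correctionKernel_le (hξ : 0 ≤ ξ) (hα : 0 ≤ α) (hA : 0 ≤ A)
    (hΨ : Differentiable ℝ Ψ) (hΨ' : ∀ θ, |θ| ≤ δ → ‖deriv Ψ θ‖ ≤ A) (hΨ0 : Ψ 0 = 1) {θ : ℝ}
    (hθ : |θ| ≤ δ) :
    ‖deriv (correctionKernel ξ α σ Ψ) θ‖ ≤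
      4 * A * (ξ + 1) * (‖gammaChar ξ (α * θ)‖ * Real.exp (-(1 / 4 * σ ^ 2 * θ ^ 2))) := by
  set b := ‖gammaChar ξ (α * θ)‖
  have hΨ1 := norm_sub_one_le_of_norm_deriv_le hΨ hΨ' hΨ0 hθ
  have hgamma : ‖deriv (fun θ : ℝ => gammaChar ξ (α * θ)) θ * (Ψ θ - 1)‖ ≤ A * ξ * b := by
    rw [norm_mul]
    calc _ ≤ ‖deriv (fun θ : ℝ => gammaChar ξ (α * θ)) θ‖ * (A * |θ|) := by gcongr
      _ = A * (|θ| * ‖deriv (fun θ : ℝ => gammaChar ξ (α * θ)) θ‖) := by ring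
      _ ≤ A * (ξ * b) :=
          mul_le_mul_of_nonneg_left (norm_deriv_gammaChar_mul_le hξ hα θ) hA
      _ = _ := by ring
  have hcorrection : ‖gammaChar ξ (α * θ) * deriv Ψ θ‖ ≤ A * b := by
    rw [norm_mul, mul_comm]
    gcongr
    exact hΨ' θ hθ
  have hgaussian : ‖gammaChar ξ (α * θ) * (Ψ θ - 1) * (-(σ ^ 2 * θ : ℝ) * gaussianChar σ θ)‖ ≤
      A * b * (σ ^ 2 * θ ^ 2) * ‖gaussianChar σ θ‖ := by
    rw [norm_mul, norm_mul, norm_mul, norm_neg, Complex.norm_real, Real.norm_eq_abs, abs_mul,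
      abs_of_nonneg (sq_nonneg σ)]
    calc _ ≤ b * (A * |θ|) * (σ ^ 2 * |θ| * ‖gaussianChar σ θ‖) := by gcongr
      _ = A * b * (σ ^ 2 * |θ| ^ 2) * ‖gaussianChar σ θ‖ := by ring
      _ = _ := by rw [sq_abs]
  rw [(hasDerivAt_correctionKernel ξ α σ hΨ θ).deriv]
  calc _ ≤ (A * ξ * b + A * b) * ‖gaussianChar σ θ‖ +
        A * b * (σ ^ 2 * θ ^ 2) * ‖gaussianChar σ θ‖ := by
        refine norm_add_le_of_le ?_ hgaussian
        rw [norm_mul]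
        gcongr
        exact norm_add_le_of_le hgamma hcorrection
    _ ≤ A * (ξ + 1) * b * ((1 + σ ^ 2 * θ ^ 2) * ‖gaussianChar σ θ‖) := by
        have : 0 ≤ A * ξ * b * (σ ^ 2 * θ ^ 2) * ‖gaussianChar σ θ‖ := by positivity
        linarith
    _ ≤ A * (ξ + 1) * b * (4 * Real.exp (-(σ ^ 2 * θ ^ 2 / 4))) := by
        rw [norm_gaussianChar]
        gcongr A * (ξ + 1) * b * ?_
        exact one_add_mul_exp_neg_le _
    _ = _ := by
        rw [show -(1 / 4 * σ ^ 2 * θ ^ 2) = -(σ ^ 2 * θ ^ 2 / 4) by ring]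
        ring

theorem intervalIntegrable_deriv_correctionKernel (hξ : 0 ≤ ξ) (hα : 0 ≤ α) (hA : 0 ≤ A)
    (hδ : 0 ≤ δ) (hΨ : Differentiable ℝ Ψ) (hΨ' : ∀ θ, |θ| ≤ δ → ‖deriv Ψ θ‖ ≤ A)
    (hΨ0 : Ψ 0 = 1) :
    IntervalIntegrable (deriv (correctionKernel ξ α σ Ψ)) volume (-δ) δ := by
  refine (intervalIntegrable_const (c := 4 * A * (ξ + 1))).mono_fun'
    (measurable_deriv _).aestronglyMeasurable ?_
  filter_upwards [ae_restrict_mem measurableSet_uIoc] with θ hθ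
  rw [Set.uIoc_of_le (by linarith)] at hθ
  refine (norm_deriv_correctionKernel_le hξ hα hA hΨ hΨ' hΨ0 (abs_le.2 ⟨hθ.1.le, hθ.2⟩)).trans ?_
  refine mul_le_of_le_one_right (by positivity) (mul_le_one₀ (norm_gammaChar_le_one hξ _)
    (Real.exp_pos _).le (Real.exp_le_one_iff.2 ?_))
  rw [neg_nonpos]
  positivity

theorem GammaRegime.norm_correctionKernel_le (h : GammaRegime M r ξ α σ β γ δ) (hr : r ≤ 1)
    (hA : 0 ≤ A) (hΨ : Differentiable ℝ Ψ) (hΨ' : ∀ θ, |θ| ≤ δ → ‖deriv Ψ θ‖ ≤ A)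
    (hΨ0 : Ψ 0 = 1) {θ : ℝ} (hθ : |θ| = δ) :
    ‖correctionKernel ξ α σ Ψ θ‖ ≤ 4 * A * gammaError α ξ r σ β γ δ := by
  have hα := h.scale_pos
  have hratio := h.ratio_pos
  have hθ0 : θ ≠ 0 := abs_pos.1 (hθ ▸ h.delta_pos)
  have hΨ1 : ‖Ψ θ - 1‖ ≤ A * 2 := by
    refine (norm_sub_one_le_of_norm_deriv_le hΨ hΨ' hΨ0 hθ.le).trans ?_
    rw [hθ]
    gcongr
    exact h.delta_le_two
  have hdecay : ‖gammaChar ξ (α * θ)‖ ≤ 2 * gammaError α ξ r σ β γ δ := by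
    have hξ := h.shape_mem.1
    have hbase : α * |θ| = σ * δ * (σ / α)⁻¹ := by
      have := h.sigma_pos.ne'
      rw [hθ]
      field_simp
    calc ‖gammaChar ξ (α * θ)‖ ≤ (α * |θ|) ^ (-ξ) :=
          norm_gammaChar_mul_le (by linarith) le_rfl hα hθ0
      _ = (σ * δ) ^ (-ξ) * (σ / α) ^ ξ := by
          rw [hbase, Real.mul_rpow (zero_le_one.trans h.one_le_sigma_mul_delta) (by positivity),
            Real.inv_rpow hratio.le, ← Real.rpow_neg hratio.le, neg_neg]
      _ ≤ (σ * δ) ^ (-r) * (σ / α) ^ (ξ - 1) := by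
          have := h.one_le_sigma_mul_delta
          exact mul_le_mul (Real.rpow_le_rpow_of_exponent_le this (by linarith))
            (Real.rpow_le_rpow_of_exponent_ge hratio h.ratio_le_one (by linarith))
            (by positivity) (by positivity)
      _ ≤ _ := h.delta_rpow_mul_le_gammaError
  rw [correctionKernel, norm_mul, norm_mul]
  have := h.gammaError_nonneg
  calc _ ≤ 2 * gammaError α ξ r σ β γ δ * (A * 2) * 1 := by
        gcongr
        exact norm_gaussianChar_le_one σ θ
    _ = _ := by ring

theorem GammaRegime.one_div_sigma_mul_le_gammaError (h : GammaRegime M r ξ α σ β γ δ)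
    (hr : r ≤ 1) : 1 / σ * (σ / α) ^ (ξ - 1) ≤ 4 * gammaError α ξ r σ β γ δ := by
  have hσ := h.sigma_pos
  have hδ := h.delta_pos
  have hratio := h.ratio_pos
  have hσδ := h.one_le_sigma_mul_delta
  calc 1 / σ * (σ / α) ^ (ξ - 1) = δ * (σ * δ) ^ (-1 : ℝ) * (σ / α) ^ (ξ - 1) := by
        rw [Real.rpow_neg_one]
        field_simp
    _ ≤ 2 * (σ * δ) ^ (-r) * (σ / α) ^ (ξ - 1) := by
        gcongr
        exact h.delta_le_two
    _ ≤ _ := by linarith [h.delta_rpow_mul_le_gammaError]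

theorem GammaRegime.exists_mul_norm_integral_correctionKernel_le (M : ℝ) {A ε : ℝ} (hA : 0 ≤ A)
    (hε : 0 < ε) :
    ∃ C : ℝ, 0 ≤ C ∧ ∀ (r ξ α σ β γ δ a : ℝ) (Ψ : ℝ → ℂ), GammaRegime M r ξ α σ β γ δ → r ≤ 1 →
      ε * α ≤ |a| → Differentiable ℝ Ψ → (∀ θ, |θ| ≤ δ → ‖deriv Ψ θ‖ ≤ A) → Ψ 0 = 1 →
      α * ‖∫ θ in (-δ)..δ, correctionKernel ξ α σ Ψ θ * Complex.exp (-(Complex.I * a * θ))‖ ≤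
        C * gammaError α ξ r σ β γ δ := by
  obtain ⟨C, hC, hkernel⟩ := exists_norm_integral_le_of_gammaChar_bound
  refine ⟨(8 * A + 20 * C * A * (|M| + 1)) / ε, by positivity, ?_⟩
  intro r ξ α σ β γ δ a Ψ h hr ha hΨ hΨ' hΨ0
  have hξ : 0 ≤ ξ := zero_le_one.trans h.shape_mem.1
  have hα := h.scale_pos
  have hδ := h.delta_pos
  set E := gammaError α ξ r σ β γ δ
  have hboundary : ∀ θ, |θ| = δ → ‖correctionKernel ξ α σ Ψ θ‖ ≤ 4 * A * E :=
    fun θ hθ => h.norm_correctionKernel_le hr hA hΨ hΨ' hΨ0 hθ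
  have hderiv : ‖∫ θ in (-δ)..δ, deriv (correctionKernel ξ α σ Ψ) θ *
      Complex.exp (-(Complex.I * a * θ))‖ ≤ C * (4 * A * (|M| + 1)) * (E + 4 * E) := by
    refine (hkernel ξ α σ δ (4 * A * (ξ + 1)) _ h.shape_mem.1 h.sigma_pos h.sigma_le hδ.le
      (by positivity) fun θ hθ => ?_).trans ?_
    · rw [norm_mul, norm_cexp_neg_I_mul_mul, mul_one]
      exact norm_deriv_correctionKernel_le hξ hα.le hA hΨ hΨ' hΨ0 hθ
    · have := h.ratio_pos
      have := h.sigma_pos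
      exact mul_le_mul (by gcongr; exact h.shape_mem.2.trans (le_abs_self M))
        (add_le_add h.le_gammaError.2.1 (h.one_div_sigma_mul_le_gammaError hr))
        (by positivity) (by positivity)
  have hparts := norm_integral_mul_cexp_le (a := a)
    (fun θ => (hasDerivAt_correctionKernel ξ α σ hΨ θ).differentiableAt)
    (intervalIntegrable_deriv_correctionKernel hξ hα.le hA hδ.le hΨ hΨ' hΨ0)
  rw [div_mul_eq_mul_div, le_div_iff₀ hε]
  calc _ = ε * α * ‖∫ θ in (-δ)..δ, correctionKernel ξ α σ Ψ θ *
        Complex.exp (-(Complex.I * a * θ))‖ := by ring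
    _ ≤ |a| * _ := mul_le_mul_of_nonneg_right ha (norm_nonneg _)
    _ ≤ 4 * A * E + 4 * A * E + C * (4 * A * (|M| + 1)) * (E + 4 * E) :=
        hparts.trans (add_le_add (add_le_add (hboundary δ (abs_of_pos hδ))
          (hboundary (-δ) (by rw [abs_neg, abs_of_pos hδ]))) hderiv)
    _ = _ := by ring

end CorrectionKernel

section GammaApproximation

variable {M r c A L ε : ℝ}

theorem GammaRegime.exists_mul_norm_integral_sub_gaussianChar_le (hr : 0 < r) (hc : 0 < c)
    (hA : 0 ≤ A) (hL : 0 ≤ L) :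
    ∃ C : ℝ, 0 ≤ C ∧ ∀ (M ξ α σ β γ δ a : ℝ) (Ψ φ : ℝ → ℂ), GammaRegime M r ξ α σ β γ δ →
      Differentiable ℝ Ψ → (∀ θ, |θ| ≤ δ → ‖deriv Ψ θ‖ ≤ A) → Ψ 0 = 1 → Continuous φ →
      (∀ θ, |θ| ≤ δ → ‖φ θ - gaussianChar σ θ‖ ≤
        L * β * |θ| ^ (2 + r) * Real.exp (-(c * σ ^ 2 * θ ^ 2))) →
      α * ‖(∫ θ in (-δ)..δ, gammaChar ξ (α * θ) * Ψ θ * φ θ * Complex.exp (-(Complex.I * a * θ))) -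
          ∫ θ in (-δ)..δ, gammaChar ξ (α * θ) * Ψ θ * gaussianChar σ θ *
            Complex.exp (-(Complex.I * a * θ))‖ ≤ C * gammaError α ξ r σ β γ δ := by
  obtain ⟨C, hC, hbound⟩ := GammaRegime.exists_mul_norm_integral_gammaChar_mul_le hr hc
  refine ⟨C * ((1 + A * 2) * L), by positivity, ?_⟩
  intro M ξ α σ β γ δ a Ψ φ h hΨ hΨ' hΨ0 hφ hφ_sub
  have hΨ_le : ∀ θ, |θ| ≤ δ → ‖Ψ θ * Complex.exp (-(Complex.I * a * θ))‖ ≤ 1 + A * 2 := by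
    intro θ hθ
    rw [norm_mul, norm_cexp_neg_I_mul_mul, mul_one, ← add_sub_cancel 1 (Ψ θ)]
    refine norm_add_le_of_le norm_one.le
      ((norm_sub_one_le_of_norm_deriv_le hΨ hΨ' hΨ0 hθ).trans ?_)
    gcongr
    exact hθ.trans h.delta_le_two
  have hΨc := hΨ.continuous
  have hgamma := continuous_gammaChar_mul ξ α
  rw [← intervalIntegral.integral_sub (Continuous.intervalIntegrable (by fun_prop) _ _)
    (Continuous.intervalIntegrable (by fun_prop) _ _)]
  refine Eq.trans_le ?_ (hbound M ξ α σ β γ δ (1 + A * 2) L _ _ h (by positivity) hL hΨ_le hφ_sub)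
  congr 3 with θ
  ring

theorem GammaRegime.exists_mul_norm_integral_sub_integral_gammaChar_le (M : ℝ) (hA : 0 ≤ A)
    (hε : 0 < ε) :
    ∃ C : ℝ, 0 ≤ C ∧ ∀ (r ξ α σ β γ δ a : ℝ) (Ψ : ℝ → ℂ), GammaRegime M r ξ α σ β γ δ → r ≤ 1 →
      ε * α ≤ |a| → Differentiable ℝ Ψ → (∀ θ, |θ| ≤ δ → ‖deriv Ψ θ‖ ≤ A) → Ψ 0 = 1 →
      α * ‖(∫ θ in (-δ)..δ, gammaChar ξ (α * θ) * Ψ θ * gaussianChar σ θ *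
            Complex.exp (-(Complex.I * a * θ))) -
          ∫ θ, gammaChar ξ (α * θ) * gaussianChar σ θ * Complex.exp (-(Complex.I * a * θ))‖ ≤
        C * gammaError α ξ r σ β γ δ := by
  obtain ⟨C, hC, hcorrection⟩ := GammaRegime.exists_mul_norm_integral_correctionKernel_le M hA hε
  refine ⟨C + 8, by positivity, fun r ξ α σ β γ δ a Ψ h hr ha hΨ hΨ' hΨ0 => ?_⟩
  have hΨc := hΨ.continuous
  have hgamma := continuous_gammaChar_mul ξ α
  have hcut := hcorrection r ξ α σ β γ δ a Ψ h hr ha hΨ hΨ' hΨ0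
  have htail := h.mul_norm_integral_gaussian_sub_truncation_le hr a
  have hkernel : ∫ θ in (-δ)..δ, correctionKernel ξ α σ Ψ θ * Complex.exp (-(Complex.I * a * θ)) =
      (∫ θ in (-δ)..δ, gammaChar ξ (α * θ) * Ψ θ * gaussianChar σ θ *
        Complex.exp (-(Complex.I * a * θ))) -
      ∫ θ in (-δ)..δ, gammaChar ξ (α * θ) * gaussianChar σ θ *
        Complex.exp (-(Complex.I * a * θ)) := by
    rw [← intervalIntegral.integral_sub (Continuous.intervalIntegrable (by fun_prop) _ _)
      (Continuous.intervalIntegrable (by fun_prop) _ _)]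
    congr 1 with θ
    rw [correctionKernel]
    ring
  rw [hkernel] at hcut
  rw [norm_sub_rev] at htail
  calc _ ≤ α * (‖_‖ + ‖_‖) :=
        mul_le_mul_of_nonneg_left (norm_sub_le_norm_sub_add_norm_sub _ _ _) h.scale_pos.le
    _ ≤ _ := by
        rw [mul_add, add_mul]
        exact add_le_add hcut htail

theorem GammaRegime.exists_norm_integral_sub_gammaPDFReal_le (M : ℝ) (hε : 0 < ε) :
    ∃ C : ℝ, 0 ≤ C ∧ ∀ r ξ α σ β γ δ y : ℝ, GammaRegime M r ξ α σ β γ δ → ε ≤ |y| →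
      ‖(1 / (2 * Real.pi) : ℂ) * (α * ∫ θ, gammaChar ξ (α * θ) * gaussianChar σ θ *
          Complex.exp (-(Complex.I * (α * y : ℝ) * θ))) - gammaPDFReal ξ 1 y‖ ≤
        C * gammaError α ξ r σ β γ δ := by
  obtain ⟨C, hC, hsmooth⟩ := exists_norm_integral_gammaChar_sub_le M hε
  refine ⟨C, hC.le, fun r ξ α σ β γ δ y h hy => ?_⟩
  have hratio : 0 < (σ / α) ^ 2 := pow_pos h.ratio_pos 2
  rw [mul_integral_comp_mul_left_gammaChar ξ σ y h.scale_pos]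
  exact (hsmooth ξ h.shape_mem ⟨_, hratio.le⟩ (NNReal.coe_ne_zero.1 hratio.ne') y hy).trans
    (mul_le_mul_of_nonneg_left h.le_gammaError.1 hC.le)

theorem GammaRegime.exists_norm_fourier_sub_gammaPDFReal_le (M : ℝ) (hA : 0 ≤ A) (hL : 0 ≤ L)
    (hc : 0 < c) (hr : 0 < r) (hr1 : r ≤ 1) (hε : 0 < ε) :
    ∃ K : ℝ, ∀ (ξ α σ β γ δ y : ℝ) (Ψ φ Φ : ℝ → ℂ), GammaRegime M r ξ α σ β γ δ → ε ≤ |y| →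
      Differentiable ℝ Ψ → (∀ θ, |θ| ≤ δ → ‖deriv Ψ θ‖ ≤ A) → Ψ 0 = 1 → Continuous φ →
      (∀ θ, |θ| ≤ δ → ‖φ θ - gaussianChar σ θ‖ ≤
        L * β * |θ| ^ (2 + r) * Real.exp (-(c * σ ^ 2 * θ ^ 2))) →
      Continuous Φ →
      (∀ θ, |θ| ≤ δ → Φ θ = gammaChar ξ (α * θ) * Ψ θ * φ θ *
        Complex.exp (-(Complex.I * (α * y : ℝ) * θ))) →
      (∀ θ, δ < |θ| → |θ| ≤ Real.pi →
        ‖Φ θ‖ ≤ L * ((α * |θ|) ^ (-ξ) * Real.exp (-(γ ^ 2 * θ ^ 2 / 5)))) →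
      ‖(α : ℂ) * ((1 / (2 * Real.pi) : ℂ) * ∫ θ in (-Real.pi)..Real.pi, Φ θ) -
          gammaPDFReal ξ 1 y‖ ≤ K * gammaError α ξ r σ β γ δ := by
  obtain ⟨C₁, -, hgaussian⟩ :=
    GammaRegime.exists_mul_norm_integral_sub_gaussianChar_le hr hc hA hL
  obtain ⟨C₂, -, hcorrection⟩ :=
    GammaRegime.exists_mul_norm_integral_sub_integral_gammaChar_le M hA hε
  obtain ⟨C₃, -, hdensity⟩ := GammaRegime.exists_norm_integral_sub_gammaPDFReal_le M hε
  refine ⟨5 * L + C₁ + C₂ + C₃, ?_⟩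
  intro ξ α σ β γ δ y Ψ φ Φ h hy hΨ hΨ' hΨ0 hφ hφ_sub hΦ hΦ_eq hΦ_le
  have hα := h.scale_pos
  have htruncate := h.mul_norm_integral_sub_truncation_le hΦ hL hΦ_le
  have hδ := h.delta_pos
  rw [intervalIntegral.integral_congr (a := -δ) (b := δ) fun θ hθ => hΦ_eq θ (abs_le.2
    (by rwa [Set.uIcc_of_le (by linarith)] at hθ))] at htruncate
  have hreplace := hgaussian M ξ α σ β γ δ (α * y) Ψ φ h hΨ hΨ' hΨ0 hφ hφ_sub
  have hcorrect := hcorrection r ξ α σ β γ δ (α * y) Ψ h hr1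
    (by rw [abs_mul, abs_of_pos hα, mul_comm]; gcongr) hΨ hΨ' hΨ0
  set I₁ := ∫ θ in (-Real.pi)..Real.pi, Φ θ
  set I₂ := ∫ θ in (-δ)..δ, gammaChar ξ (α * θ) * Ψ θ * φ θ *
    Complex.exp (-(Complex.I * (α * y : ℝ) * θ))
  set I₃ := ∫ θ in (-δ)..δ, gammaChar ξ (α * θ) * Ψ θ * gaussianChar σ θ *
    Complex.exp (-(Complex.I * (α * y : ℝ) * θ))
  set I₄ := ∫ θ, gammaChar ξ (α * θ) * gaussianChar σ θ *
    Complex.exp (-(Complex.I * (α * y : ℝ) * θ))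
  have hintegrals : α * ‖I₁ - I₄‖ ≤ (5 * L + C₁ + C₂) * gammaError α ξ r σ β γ δ := by
    calc α * ‖I₁ - I₄‖ ≤ α * (‖I₁ - I₂‖ + (‖I₂ - I₃‖ + ‖I₃ - I₄‖)) := by
          gcongr
          exact (norm_sub_le_norm_sub_add_norm_sub _ _ _).trans
            (add_le_add le_rfl (norm_sub_le_norm_sub_add_norm_sub _ _ _))
      _ ≤ _ := by
          rw [mul_add, mul_add, add_mul, add_mul, add_assoc]
          exact add_le_add htruncate (add_le_add hreplace hcorrect)
  have hpi : ‖(1 / (2 * Real.pi) : ℂ)‖ ≤ 1 := by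
    rw [norm_div, norm_one, norm_mul, Complex.norm_two, Complex.norm_of_nonneg Real.pi_pos.le]
    exact div_le_one_of_le₀ (by linarith [Real.two_le_pi]) (by positivity)
  calc _ = ‖(1 / (2 * Real.pi) : ℂ) * (α * (I₁ - I₄)) +
        ((1 / (2 * Real.pi) : ℂ) * (α * I₄) - gammaPDFReal ξ 1 y)‖ := by congr 1; ring
    _ ≤ 1 * (α * ‖I₁ - I₄‖) + C₃ * gammaError α ξ r σ β γ δ := by
        refine norm_add_le_of_le ?_ (hdensity r ξ α σ β γ δ y h hy)
        rw [norm_mul, norm_mul, Complex.norm_of_nonneg hα.le]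
        gcongr
    _ ≤ _ := by linarith

end GammaApproximation

/-! ### Characteristic functions of centred variables -/

theorem norm_le_mul_abs_pow_of_norm_deriv_le {E : Type*} [NormedAddCommGroup E] [NormedSpace ℝ E]
    {f f' : ℝ → E} {C : ℝ} {n : ℕ} (hf : ∀ x, HasDerivAt f (f' x) x) (hf0 : f 0 = 0)
    (hf' : ∀ x, ‖f' x‖ ≤ C * |x| ^ n) (x : ℝ) : ‖f x‖ ≤ C * |x| ^ (n + 1) / (n + 1) := by
  have hright : ∀ {g g' : ℝ → E}, (∀ x, HasDerivAt g (g' x) x) → g 0 = 0 →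
      (∀ x, ‖g' x‖ ≤ C * |x| ^ n) → ∀ {x : ℝ}, 0 ≤ x → ‖g x‖ ≤ C * x ^ (n + 1) / (n + 1) := by
    intro g g' hg hg0 hg' x hx
    refine image_norm_le_of_norm_deriv_right_le_deriv_boundary (a := 0) (b := x)
      (B := fun x => C * x ^ (n + 1) / (n + 1)) (B' := fun x => C * x ^ n)
      (fun y _ => (hg y).continuousAt.continuousWithinAt) (fun y _ => (hg y).hasDerivWithinAt)
      (by simp [hg0]) (fun y => ?_) (fun y hy => by simpa [abs_of_nonneg hy.1] using hg' y)
      ⟨hx, le_rfl⟩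
    refine (((hasDerivAt_pow (n + 1) y).const_mul C).div_const (n + 1)).congr_deriv ?_
    push_cast
    field_simp
  rcases le_total 0 x with hx | hx
  · rw [abs_of_nonneg hx]
    exact hright hf hf0 hf' hx
  · have hreflect := hright (g := fun y => f (-y)) (g' := fun y => -f' (-y))
      (fun y => by simpa [Function.comp_def] using (hf (-y)).scomp y (hasDerivAt_neg y))
      (by simpa using hf0)
      (fun y => by simpa using hf' (-y)) (neg_nonneg.2 hx)
    rwa [neg_neg, ← abs_of_nonpos hx] at hreflect

theorem hasDerivAt_I_mul_ofReal (x : ℝ) :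
    HasDerivAt (fun x : ℝ => Complex.I * (x : ℂ)) Complex.I x := by
  simpa using! (Complex.ofRealCLM.hasDerivAt (x := x)).const_mul Complex.I

theorem hasDerivAt_cexp_I_mul (x : ℝ) :
    HasDerivAt (fun x : ℝ => Complex.exp (Complex.I * x))
      (Complex.I * Complex.exp (Complex.I * x)) x := by
  simpa [mul_comm] using (hasDerivAt_I_mul_ofReal x).cexp

theorem norm_cexp_I_mul_sub_one_sub_le (x : ℝ) :
    ‖Complex.exp (Complex.I * x) - 1 - Complex.I * x‖ ≤ |x| ^ 2 / 2 := by
  refine (norm_le_mul_abs_pow_of_norm_deriv_le (C := 1) (n := 1)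
    (fun y => ((hasDerivAt_cexp_I_mul y).sub_const 1).sub (hasDerivAt_I_mul_ofReal y))
    (by simp) (fun y => ?_) x).trans_eq (by norm_num)
  rw [← mul_sub_one, norm_mul, Complex.norm_I, one_mul, one_mul, pow_one]
  exact Real.norm_exp_I_mul_ofReal_sub_one_le

theorem norm_cexp_I_mul_taylor_two_le (x : ℝ) :
    ‖Complex.exp (Complex.I * x) - 1 - Complex.I * x + (x : ℂ) ^ 2 / 2‖ ≤ |x| ^ 3 / 6 := by
  have hsq : ∀ y : ℝ, HasDerivAt (fun y : ℝ => (y : ℂ) ^ 2 / 2) (y : ℂ) y := fun y =>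
    (((Complex.ofRealCLM.hasDerivAt (x := y)).pow 2).div_const 2).congr_deriv (by simp)
  refine (norm_le_mul_abs_pow_of_norm_deriv_le (C := 1 / 2) (n := 2)
    (fun y => (((hasDerivAt_cexp_I_mul y).sub_const 1).sub (hasDerivAt_I_mul_ofReal y)).add (hsq y))
    (by simp) (fun y => ?_) x).trans_eq (by norm_num; ring)
  rw [show Complex.I * Complex.exp (Complex.I * y) - Complex.I + y =
      Complex.I * (Complex.exp (Complex.I * y) - 1 - Complex.I * y) by
        linear_combination (y : ℂ) * Complex.I_mul_I, norm_mul, Complex.norm_I, one_mul]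
  exact (norm_cexp_I_mul_sub_one_sub_le y).trans_eq (by ring)

theorem norm_cexp_I_mul_taylor_two_le_rpow (x : ℝ) {r : ℝ} (hr : 0 ≤ r) (hr1 : r ≤ 1) :
    ‖Complex.exp (Complex.I * x) - 1 - Complex.I * x + (x : ℂ) ^ 2 / 2‖ ≤
      2 ^ (-r) * |x| ^ (2 + r) := by
  rcases eq_or_ne x 0 with rfl | hx
  · simpa using by positivity
  have hx0 : 0 < |x| := abs_pos.2 hx
  have hsplit : 2 ^ (-r) * |x| ^ (2 + r) = |x| ^ 2 * (|x| / 2) ^ r := by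
    rw [Real.div_rpow hx0.le two_pos.le, Real.rpow_add hx0, Real.rpow_neg two_pos.le, Real.rpow_two]
    ring
  rw [hsplit]
  rcases le_total 1 (|x| / 2) with hlarge | hsmall
  · calc _ ≤ |x| ^ 2 / 2 + |x| ^ 2 / 2 := by
          refine norm_add_le_of_le (norm_cexp_I_mul_sub_one_sub_le x) (le_of_eq ?_)
          rw [norm_div, norm_pow, Complex.norm_real, Real.norm_eq_abs, Complex.norm_two]
      _ = |x| ^ 2 * 1 := by ring
      _ ≤ _ := by gcongr; exact Real.one_le_rpow hlarge hr
  · calc _ ≤ |x| ^ 3 / 6 := norm_cexp_I_mul_taylor_two_le x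
      _ ≤ |x| ^ 3 / 2 := by gcongr; norm_num
      _ = |x| ^ 2 * (|x| / 2) ^ (1 : ℝ) := by rw [Real.rpow_one]; ring
      _ ≤ _ := by
        gcongr |x| ^ 2 * ?_
        exact Real.rpow_le_rpow_of_exponent_ge (by positivity) hsmall hr1

section CentredMeasure

variable {μ : Measure ℝ} {r : ℝ}

theorem integrable_abs_rpow_of_memLp (hr : 0 ≤ r) (hmom : MemLp id (ENNReal.ofReal (2 + r)) μ) :
    Integrable (fun x => |x| ^ (2 + r)) μ := by
  have := hmom.integrable_norm_rpow (by simpa using by linarith) ENNReal.ofReal_ne_top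
  rwa [ENNReal.toReal_ofReal (by linarith)] at this

variable [IsProbabilityMeasure μ]

theorem integrable_id_of_memLp (hr : 0 ≤ r) (hmom : MemLp id (ENNReal.ofReal (2 + r)) μ) :
    Integrable (fun x => x) μ :=
  hmom.integrable (by rw [← ENNReal.ofReal_one]; exact ENNReal.ofReal_le_ofReal (by linarith))

theorem integrable_sq_of_memLp (hr : 0 ≤ r) (hmom : MemLp id (ENNReal.ofReal (2 + r)) μ) :
    Integrable (fun x => x ^ 2) μ := by
  refine (hmom.mono_exponent ?_).integrable_sq
  rw [← ENNReal.ofReal_ofNat]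
  exact ENNReal.ofReal_le_ofReal (by linarith)

theorem norm_charFun_sub_taylor_le (hr : 0 ≤ r) (hr1 : r ≤ 1)
    (hmom : MemLp id (ENNReal.ofReal (2 + r)) μ) (hmean : ∫ x, x ∂μ = 0) (θ : ℝ) :
    ‖charFun μ θ - (1 - (∫ x, x ^ 2 ∂μ) * θ ^ 2 / 2 : ℝ)‖ ≤
      2 ^ (-r) * ((∫ x, |x| ^ (2 + r) ∂μ) * |θ| ^ (2 + r)) := by
  have hexp : Integrable (fun x : ℝ => Complex.exp (θ * x * Complex.I)) μ := by
    refine Integrable.mono' (integrable_const (1 : ℝ))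
      (Measurable.aestronglyMeasurable (by fun_prop)) (Eventually.of_forall fun x => ?_)
    rw [← Complex.ofReal_mul, Complex.norm_exp_ofReal_mul_I]
  have hlin : Integrable (fun x : ℝ => Complex.I * θ * (x : ℂ)) μ :=
    (integrable_id_of_memLp hr hmom).ofReal.const_mul _
  have hquad : Integrable (fun x : ℝ => (θ : ℂ) ^ 2 / 2 * ((x ^ 2 : ℝ) : ℂ)) μ :=
    (integrable_sq_of_memLp hr hmom).ofReal.const_mul _
  have hexp_sub : Integrable (fun x : ℝ => Complex.exp (θ * x * Complex.I) - 1) μ :=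
    hexp.sub (integrable_const 1)
  have hexp_sub_sub : Integrable
      (fun x : ℝ => Complex.exp (θ * x * Complex.I) - 1 - Complex.I * θ * x) μ :=
    hexp_sub.sub hlin
  have hremainder : charFun μ θ - (1 - (∫ x, x ^ 2 ∂μ) * θ ^ 2 / 2 : ℝ) =
      ∫ x : ℝ, (Complex.exp (θ * x * Complex.I) - 1 - Complex.I * θ * x +
        (θ : ℂ) ^ 2 / 2 * ((x ^ 2 : ℝ) : ℂ)) ∂μ := by
    rw [integral_add hexp_sub_sub hquad,
      integral_sub hexp_sub hlin, integral_sub hexp (integrable_const 1),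
      integral_const_mul, integral_const_mul, integral_complex_ofReal, integral_complex_ofReal,
      hmean, ← charFun_apply_real]
    simp only [integral_const, probReal_univ, one_smul]
    push_cast
    ring
  rw [hremainder, ← integral_mul_const, ← integral_const_mul]
  refine norm_integral_le_of_norm_le
    (((integrable_abs_rpow_of_memLp hr hmom).mul_const _).const_mul _)
    (Eventually.of_forall fun x => ?_)
  rw [← Real.mul_rpow (abs_nonneg _) (abs_nonneg _), ← abs_mul]
  refine Eq.trans_le ?_ (norm_cexp_I_mul_taylor_two_le_rpow (x * θ) hr hr1)
  push_cast
  ring_nf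

theorem sqrt_integral_sq_rpow_le (hr : 0 ≤ r) (hmom : MemLp id (ENNReal.ofReal (2 + r)) μ) :
    √(∫ x, x ^ 2 ∂μ) ^ (2 + r) ≤ ∫ x, |x| ^ (2 + r) ∂μ := by
  have hpow : ∀ x : ℝ, (x ^ 2) ^ ((2 + r) / 2) = |x| ^ (2 + r) := by
    intro x
    rw [← sq_abs, ← Real.rpow_natCast, ← Real.rpow_mul (abs_nonneg x)]
    congr 1
    push_cast
    ring
  have hjensen := (convexOn_rpow (p := (2 + r) / 2) (by linarith)).map_integral_le (μ := μ)
    (f := fun x => x ^ 2) (Real.continuous_rpow_const (by linarith)).continuousOn isClosed_Ici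
    (Eventually.of_forall fun x => Set.mem_Ici.2 (sq_nonneg x)) (integrable_sq_of_memLp hr hmom)
    (by simpa only [Function.comp_def, hpow] using integrable_abs_rpow_of_memLp hr hmom)
  simp only [hpow] at hjensen
  refine Eq.trans_le ?_ hjensen
  rw [Real.sqrt_eq_rpow, ← Real.rpow_mul (integral_nonneg fun x => sq_nonneg x)]
  congr 1
  ring

theorem hasDerivAt_charFun_zero (hint : Integrable (fun x => x) μ) (hmean : ∫ x, x ∂μ = 0) :
    HasDerivAt (charFun μ) 0 0 := by
  have hmem : MemLp id ((1 : ℕ) : ENNReal) μ := by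
    simpa using! memLp_one_iff_integrable.2 hint
  have hderiv := iteratedDeriv_charFun_zero hmem
  rw [iteratedDeriv_one] at hderiv
  have hdiff : DifferentiableAt ℝ (charFun μ) 0 :=
    (contDiff_charFun hmem).differentiable (by simp) 0
  simpa [hderiv, hmean] using hdiff.hasDerivAt

end CentredMeasure

section ExponentialBounds

variable {r u B : ℝ}

theorem sq_div_two_le_of_rpow_le (hr : 0 ≤ r) (hr1 : r ≤ 1) (hu : 1 ≤ u) (huB : u ^ (2 + r) ≤ B) :
    u ^ 2 / 2 ≤ 2 ^ (-r) * B := by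
  calc u ^ 2 / 2 = 2 ^ (-1 : ℝ) * u ^ (2 : ℝ) := by
        rw [Real.rpow_neg_one, Real.rpow_two]
        ring
    _ ≤ 2 ^ (-r) * u ^ (2 + r) := by
        gcongr
        · exact one_le_two
        · linarith
    _ ≤ _ := by gcongr

theorem neg_one_le_exponent (hr : 0 ≤ r) (hr1 : r ≤ 1) (hu : 0 ≤ u) (huB : u ^ (2 + r) ≤ B) :
    -1 ≤ -(u ^ 2 / 2) + 2 ^ (-r) * B := by
  rcases le_total 1 u with h | h
  · linarith [sq_div_two_le_of_rpow_le hr hr1 h huB]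
  · have : 0 ≤ B := (Real.rpow_nonneg hu _).trans huB
    have : 0 ≤ 2 ^ (-r) * B := by positivity
    linarith [pow_le_one₀ (n := 2) hu h]

theorem norm_le_exp_of_norm_sub_taylor_le {z : ℂ} (hr : 0 ≤ r) (hr1 : r ≤ 1) (hu : 0 ≤ u)
    (huB : u ^ (2 + r) ≤ B) (hz : ‖z‖ ≤ 1) (htaylor : ‖z - (1 - u ^ 2 / 2 : ℝ)‖ ≤ 2 ^ (-r) * B) :
    ‖z‖ ≤ Real.exp (-(u ^ 2 / 2) + 2 ^ (-r) * B) := by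
  rcases le_total 1 u with h | h
  · exact hz.trans (Real.one_le_exp (by linarith [sq_div_two_le_of_rpow_le hr hr1 h huB]))
  · have hbase : ‖((1 - u ^ 2 / 2 : ℝ) : ℂ)‖ = 1 - u ^ 2 / 2 :=
      Complex.norm_of_nonneg (by linarith [pow_le_one₀ (n := 2) hu h])
    have htriangle := norm_sub_norm_le z ((1 - u ^ 2 / 2 : ℝ) : ℂ)
    linarith [Real.add_one_le_exp (-(u ^ 2 / 2) + 2 ^ (-r) * B)]

theorem abs_one_sub_sq_div_two_sub_exp_le (hr : 0 ≤ r) (hr1 : r ≤ 1) (hu : 0 ≤ u) :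
    |1 - u ^ 2 / 2 - Real.exp (-(u ^ 2 / 2))| ≤ u ^ (2 + r) := by
  rcases hu.eq_or_lt with rfl | hu0
  · simpa using by positivity
  rcases le_total u 1 with h | h
  · have hsq : u ^ 2 ≤ 1 := pow_le_one₀ hu h
    have hexp := Real.abs_exp_sub_one_sub_id_le (x := -(u ^ 2 / 2))
      (by rw [abs_neg, abs_of_nonneg (by positivity)]; linarith)
    calc _ = |Real.exp (-(u ^ 2 / 2)) - 1 - -(u ^ 2 / 2)| := by rw [abs_sub_comm]; congr 1; ring
      _ ≤ u ^ 4 / 4 := hexp.trans_eq (by ring)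
      _ ≤ u ^ (4 : ℝ) := by
        rw [show (4 : ℝ) = (4 : ℕ) by norm_num, Real.rpow_natCast]
        push_cast
        linarith [pow_pos hu0 4]
      _ ≤ _ := Real.rpow_le_rpow_of_exponent_ge hu0 h (by linarith)
  · have hexp := Real.add_one_le_exp (-(u ^ 2 / 2))
    have hexp1 : Real.exp (-(u ^ 2 / 2)) ≤ 1 := Real.exp_le_one_iff.2 (by linarith [sq_nonneg u])
    calc _ ≤ u ^ 2 := by
          rw [abs_of_nonpos (by linarith)]
          linarith [sq_nonneg u]
      _ = u ^ (2 : ℝ) := (Real.rpow_two u).symm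
      _ ≤ _ := Real.rpow_le_rpow_of_exponent_le h (by linarith)

end ExponentialBounds

section IntegerVariable

variable {Ω : Type*} [MeasurableSpace Ω] {P : Measure Ω} {Y : Ω → ℕ} {r θ : ℝ}

/-- The law of the centred variable `Y - E Y`, whose characteristic function is `qCharFun P Y`. -/
noncomputable def centredLaw (P : Measure Ω) (Y : Ω → ℕ) : Measure ℝ :=
  P.map fun ω => (Y ω : ℝ) - qMean P Y

theorem measurable_natCast_comp (hY : Measurable Y) : Measurable fun ω => (Y ω : ℝ) :=
  measurable_from_nat.comp hY

theorem measurable_sub_qMean (hY : Measurable Y) : Measurable fun ω => (Y ω : ℝ) - qMean P Y :=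
  (measurable_natCast_comp hY).sub_const _

theorem isProbabilityMeasure_centredLaw [IsProbabilityMeasure P] (hY : Measurable Y) :
    IsProbabilityMeasure (centredLaw P Y) :=
  Measure.isProbabilityMeasure_map (measurable_sub_qMean hY).aemeasurable

theorem integral_centredLaw {E : Type*} [NormedAddCommGroup E] [NormedSpace ℝ E] {f : ℝ → E}
    (hY : Measurable Y) (hf : StronglyMeasurable f) :
    ∫ x, f x ∂centredLaw P Y = ∫ ω, f ((Y ω : ℝ) - qMean P Y) ∂P :=
  integral_map (measurable_sub_qMean hY).aemeasurable hf.aestronglyMeasurable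

theorem qCharFun_eq_charFun (hY : Measurable Y) (θ : ℝ) :
    qCharFun P Y θ = charFun (centredLaw P Y) θ := by
  rw [charFun_apply_real, integral_centredLaw hY (Measurable.stronglyMeasurable (by fun_prop)),
    qCharFun]
  congr 1 with ω
  ring_nf

theorem qVar_eq_integral (hY : Measurable Y) : qVar P Y = ∫ x, x ^ 2 ∂centredLaw P Y := by
  rw [integral_centredLaw hY (Measurable.stronglyMeasurable (by fun_prop)), qVar,
    variance_eq_integral (measurable_natCast_comp hY).aemeasurable]
  rfl

theorem qAbsMoment_eq_integral (hY : Measurable Y) (s : ℝ) :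
    qAbsMoment P Y s = ∫ x, |x| ^ s ∂centredLaw P Y :=
  (integral_centredLaw (f := fun x => |x| ^ s) hY
    (Measurable.stronglyMeasurable (by fun_prop))).symm

theorem qVar_nonneg (P : Measure Ω) (Y : Ω → ℕ) : 0 ≤ qVar P Y := variance_nonneg _ _

theorem qAbsMoment_nonneg (P : Measure Ω) (Y : Ω → ℕ) (s : ℝ) : 0 ≤ qAbsMoment P Y s :=
  integral_nonneg fun ω => by positivity

variable [IsProbabilityMeasure P]

theorem qCharFun_zero (P : Measure Ω) [IsProbabilityMeasure P] (Y : Ω → ℕ) :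
    qCharFun P Y 0 = 1 := by
  simp [qCharFun]

theorem norm_qCharFun_le_one (hY : Measurable Y) (θ : ℝ) : ‖qCharFun P Y θ‖ ≤ 1 := by
  have := isProbabilityMeasure_centredLaw (P := P) hY
  rw [qCharFun_eq_charFun hY]
  exact norm_charFun_le_one θ

theorem continuous_qCharFun (hY : Measurable Y) : Continuous (qCharFun P Y) := by
  have := isProbabilityMeasure_centredLaw (P := P) hY
  rw [funext (qCharFun_eq_charFun hY)]
  exact continuous_charFun

theorem integral_id_centredLaw (hY : Measurable Y) (hint : Integrable (fun ω => (Y ω : ℝ)) P) :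
    ∫ x, x ∂centredLaw P Y = 0 := by
  rw [integral_centredLaw (f := fun x => x) hY stronglyMeasurable_id,
    integral_sub hint (integrable_const _)]
  simp [qMean]

theorem hasDerivAt_qCharFun_zero (hY : Measurable Y) (hint : Integrable (fun ω => (Y ω : ℝ)) P) :
    HasDerivAt (qCharFun P Y) 0 0 := by
  have := isProbabilityMeasure_centredLaw (P := P) hY
  rw [funext (qCharFun_eq_charFun hY)]
  refine hasDerivAt_charFun_zero ?_ (integral_id_centredLaw hY hint)
  exact (integrable_map_measure aestronglyMeasurable_id
    (measurable_sub_qMean hY).aemeasurable).2 (hint.sub (integrable_const _))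

theorem integrable_of_memLp_two_add (hr : 0 ≤ r)
    (hmom : MemLp (fun ω => (Y ω : ℝ)) (ENNReal.ofReal (2 + r)) P) :
    Integrable (fun ω => (Y ω : ℝ)) P :=
  hmom.integrable (by rw [← ENNReal.ofReal_one]; exact ENNReal.ofReal_le_ofReal (by linarith))

theorem memLp_centredLaw {p : ENNReal} (hY : Measurable Y)
    (hmom : MemLp (fun ω => (Y ω : ℝ)) p P) : MemLp id p (centredLaw P Y) :=
  (memLp_map_measure_iff aestronglyMeasurable_id (measurable_sub_qMean hY).aemeasurable).2
    (hmom.sub (memLp_const _))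

theorem norm_qCharFun_sub_taylor_le (hY : Measurable Y) (hr : 0 ≤ r) (hr1 : r ≤ 1)
    (hmom : MemLp (fun ω => (Y ω : ℝ)) (ENNReal.ofReal (2 + r)) P) (θ : ℝ) :
    ‖qCharFun P Y θ - (1 - qVar P Y * θ ^ 2 / 2 : ℝ)‖ ≤
      2 ^ (-r) * (qAbsMoment P Y (2 + r) * |θ| ^ (2 + r)) := by
  have := isProbabilityMeasure_centredLaw (P := P) hY
  rw [qCharFun_eq_charFun hY, qVar_eq_integral hY, qAbsMoment_eq_integral hY]
  exact norm_charFun_sub_taylor_le hr hr1 (memLp_centredLaw hY hmom)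
    (integral_id_centredLaw hY (integrable_of_memLp_two_add hr hmom)) θ

theorem sqrt_qVar_mul_abs_rpow_le (hY : Measurable Y) (hr : 0 ≤ r)
    (hmom : MemLp (fun ω => (Y ω : ℝ)) (ENNReal.ofReal (2 + r)) P) (θ : ℝ) :
    (√(qVar P Y) * |θ|) ^ (2 + r) ≤ qAbsMoment P Y (2 + r) * |θ| ^ (2 + r) := by
  have := isProbabilityMeasure_centredLaw (P := P) hY
  rw [Real.mul_rpow (Real.sqrt_nonneg _) (abs_nonneg _), qVar_eq_integral hY,
    qAbsMoment_eq_integral hY]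
  gcongr
  exact sqrt_integral_sq_rpow_le hr (memLp_centredLaw hY hmom)

theorem qVar_mul_sq (P : Measure Ω) (Y : Ω → ℕ) (θ : ℝ) :
    qVar P Y * θ ^ 2 = (√(qVar P Y) * |θ|) ^ 2 := by
  rw [mul_pow, Real.sq_sqrt (qVar_nonneg P Y), sq_abs]

theorem neg_one_le_qCharFun_exponent (hY : Measurable Y) (hr : 0 ≤ r) (hr1 : r ≤ 1)
    (hmom : MemLp (fun ω => (Y ω : ℝ)) (ENNReal.ofReal (2 + r)) P) (θ : ℝ) :
    -1 ≤ -(qVar P Y * θ ^ 2 / 2) + 2 ^ (-r) * (qAbsMoment P Y (2 + r) * |θ| ^ (2 + r)) := by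
  rw [qVar_mul_sq]
  exact neg_one_le_exponent hr hr1 (by positivity) (sqrt_qVar_mul_abs_rpow_le hY hr hmom θ)

theorem norm_qCharFun_le_exp (hY : Measurable Y) (hr : 0 ≤ r) (hr1 : r ≤ 1)
    (hmom : MemLp (fun ω => (Y ω : ℝ)) (ENNReal.ofReal (2 + r)) P) (θ : ℝ) :
    ‖qCharFun P Y θ‖ ≤ Real.exp (-(qVar P Y * θ ^ 2 / 2) +
      2 ^ (-r) * (qAbsMoment P Y (2 + r) * |θ| ^ (2 + r))) := by
  have htaylor := norm_qCharFun_sub_taylor_le hY hr hr1 hmom θ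
  rw [qVar_mul_sq] at htaylor ⊢
  exact norm_le_exp_of_norm_sub_taylor_le hr hr1 (by positivity)
    (sqrt_qVar_mul_abs_rpow_le hY hr hmom θ) (norm_qCharFun_le_one hY θ) htaylor

theorem norm_qCharFun_sub_gaussianChar_le (hY : Measurable Y) (hr : 0 ≤ r) (hr1 : r ≤ 1)
    (hmom : MemLp (fun ω => (Y ω : ℝ)) (ENNReal.ofReal (2 + r)) P) (θ : ℝ) :
    ‖qCharFun P Y θ - gaussianChar √(qVar P Y) θ‖ ≤
      2 * (qAbsMoment P Y (2 + r) * |θ| ^ (2 + r)) := by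
  set B := qAbsMoment P Y (2 + r) * |θ| ^ (2 + r)
  have hB : 0 ≤ B := mul_nonneg (qAbsMoment_nonneg _ _ _) (by positivity)
  have htaylor := norm_qCharFun_sub_taylor_le hY hr hr1 hmom θ
  have hgauss : ‖((1 - qVar P Y * θ ^ 2 / 2 : ℝ) : ℂ) - gaussianChar √(qVar P Y) θ‖ ≤ B := by
    rw [gaussianChar, Real.sq_sqrt (qVar_nonneg P Y), qVar_mul_sq, ← Complex.ofReal_sub,
      Complex.norm_real, Real.norm_eq_abs]
    exact (abs_one_sub_sq_div_two_sub_exp_le hr hr1 (by positivity)).trans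
      (sqrt_qVar_mul_abs_rpow_le hY hr hmom θ)
  have htwo : (2 : ℝ) ^ (-r) ≤ 1 := Real.rpow_le_one_of_one_le_of_nonpos one_le_two (by linarith)
  calc _ ≤ 2 ^ (-r) * B + B := (norm_sub_le_norm_sub_add_norm_sub _ _ _).trans
          (add_le_add htaylor hgauss)
    _ ≤ 1 * B + B := by gcongr
    _ = _ := by ring

end IntegerVariable

/-! ### Pairing consecutive values -/

theorem hasSum_two_mul_add_two_mul_add_one {E : Type*} [AddCommMonoid E] [TopologicalSpace E]
    [ContinuousAdd E] [RegularSpace E] {f : ℕ → E} {a : E} (hf : HasSum f a) :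
    HasSum (fun j => f (2 * j) + f (2 * j + 1)) a := by
  have hpairs : HasSum (fun p : ℕ × Fin 2 => f (p.1 * 2 + p.2)) a :=
    ((Nat.divModEquiv 2).symm.hasSum_iff (f := f)).2 hf
  refine hpairs.prod_fiberwise fun j => ?_
  have := hasSum_fintype fun i : Fin 2 => f (j * 2 + i)
  simpa [Fin.sum_univ_two, mul_comm] using this

theorem hasSum_measureReal_smul_integral {Ω ι E : Type*} [MeasurableSpace Ω] [Countable ι]
    [MeasurableSpace ι] [MeasurableSingletonClass ι] [NormedAddCommGroup E] [NormedSpace ℝ E]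
    [CompleteSpace E] {P : Measure Ω} {Y : Ω → ι} (hY : Measurable Y) {f : ι → E}
    (hf : Integrable (fun ω => f (Y ω)) P) :
    HasSum (fun j => P.real {ω | Y ω = j} • f j) (∫ ω, f (Y ω) ∂P) := by
  have hmeas : ∀ j, MeasurableSet {ω | Y ω = j} := fun j => hY (measurableSet_singleton j)
  have hcover : ⋃ j, {ω | Y ω = j} = Set.univ := Set.iUnion_eq_univ_iff.2 fun ω => ⟨Y ω, rfl⟩
  have hdisj : Pairwise (Function.onFun Disjoint fun j => {ω | Y ω = j}) := fun i j hij =>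
    Set.disjoint_left.2 fun ω hi hj => hij (hi.symm.trans hj)
  have hsum := hasSum_integral_iUnion (μ := P) (f := fun ω => f (Y ω)) hmeas hdisj
    (by rw [hcover]; exact hf.integrableOn)
  rw [hcover, setIntegral_univ] at hsum
  refine hsum.congr_fun fun j => ?_
  rw [setIntegral_congr_fun (g := fun _ => f j) (hmeas j) fun ω hω => congrArg f hω,
    setIntegral_const]

/-- The summand `p q / (p + q)` of `γ²`, with the value `0` when `p = q = 0`. -/
noncomputable def pairGamma (p q : ℝ) : ℝ := p * q / (p + q)

section PairGamma

variable {p q : ℝ}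

theorem pairGamma_nonneg (hp : 0 ≤ p) (hq : 0 ≤ q) : 0 ≤ pairGamma p q := by
  unfold pairGamma
  positivity

theorem pairGamma_mul_add (hp : 0 ≤ p) (hq : 0 ≤ q) : pairGamma p q * (p + q) = p * q := by
  refine div_mul_cancel_of_imp fun h => ?_
  rw [((add_eq_zero_iff_of_nonneg hp hq).1 h).1, zero_mul]

theorem two_mul_pairGamma_le_add (hp : 0 ≤ p) (hq : 0 ≤ q) : 2 * pairGamma p q ≤ p + q := by
  rcases (add_nonneg hp hq).eq_or_lt with h | h
  · rw [pairGamma, ← h, div_zero, mul_zero]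
  · rw [pairGamma, ← mul_div_assoc, div_le_iff₀ h]
    nlinarith [sq_nonneg p, sq_nonneg q]

theorem pairGamma_le_sq (hp : 0 ≤ p) (hq : 0 ≤ q) (a : ℝ) :
    pairGamma p q ≤ p * a ^ 2 + q * (a + 1) ^ 2 := by
  rcases (add_nonneg hp hq).eq_or_lt with h | h
  · rw [pairGamma, ← h, div_zero]
    positivity
  · rw [pairGamma, div_le_iff₀ h]
    nlinarith [sq_nonneg (p * a + q * (a + 1))]

theorem norm_add_mul_cexp_sq (p q θ : ℝ) :
    ‖(p : ℂ) + q * Complex.exp (Complex.I * θ)‖ ^ 2 =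
      (p + q) ^ 2 - 2 * (p * q) * (1 - Real.cos θ) := by
  rw [← Complex.normSq_eq_norm_sq, Complex.normSq_apply, mul_comm Complex.I]
  simp only [Complex.add_re, Complex.ofReal_re, Complex.mul_re, Complex.exp_ofReal_mul_I_re,
    Complex.ofReal_im, Complex.exp_ofReal_mul_I_im, zero_mul, sub_zero, Complex.add_im,
    Complex.mul_im, add_zero, zero_add]
  linear_combination q ^ 2 * Real.sin_sq_add_cos_sq θ

theorem norm_add_mul_cexp_le (hp : 0 ≤ p) (hq : 0 ≤ q) (θ : ℝ) :
    ‖(p : ℂ) + q * Complex.exp (Complex.I * θ)‖ ≤ p + q - pairGamma p q * (1 - Real.cos θ) := by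
  have hgamma := pairGamma_nonneg hp hq
  have hgamma_le := two_mul_pairGamma_le_add hp hq
  refine abs_le_of_sq_le_sq' ?_ ?_ |>.2
  · rw [norm_add_mul_cexp_sq, ← pairGamma_mul_add hp hq]
    nlinarith [sq_nonneg (pairGamma p q * (1 - Real.cos θ))]
  · nlinarith [Real.neg_one_le_cos θ]

end PairGamma

section IntegerVariable

variable {Ω : Type*} [MeasurableSpace Ω] {P : Measure Ω} [IsProbabilityMeasure P] {Y : Ω → ℕ}

theorem hasSum_pointProb_pairs (P : Measure Ω) [IsProbabilityMeasure P] (hY : Measurable Y) :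
    HasSum (fun j => P.real {ω | Y ω = 2 * j} + P.real {ω | Y ω = 2 * j + 1}) 1 := by
  have hsum := hasSum_measureReal_smul_integral (P := P) hY (f := fun _ => (1 : ℝ))
    (integrable_const _)
  simp only [smul_eq_mul, mul_one, integral_const, probReal_univ] at hsum
  exact hasSum_two_mul_add_two_mul_add_one (f := fun j => P.real {ω | Y ω = j}) hsum

theorem hasSum_qGammaSq (P : Measure Ω) [IsProbabilityMeasure P] (hY : Measurable Y) :
    HasSum (fun j : ℕ => pairGamma (P.real {ω | Y ω = 2 * j}) (P.real {ω | Y ω = 2 * j + 1}))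
      (qGammaSq P Y) := by
  refine (Summable.of_nonneg_of_le (fun _ => pairGamma_nonneg measureReal_nonneg measureReal_nonneg)
    (fun j => ?_) (hasSum_pointProb_pairs P hY).summable).hasSum
  have hgamma := pairGamma_nonneg (p := P.real {ω | Y ω = 2 * j})
    (q := P.real {ω | Y ω = 2 * j + 1}) measureReal_nonneg measureReal_nonneg
  linarith [two_mul_pairGamma_le_add (p := P.real {ω | Y ω = 2 * j})
    (q := P.real {ω | Y ω = 2 * j + 1}) measureReal_nonneg measureReal_nonneg]

theorem qGammaSq_nonneg (P : Measure Ω) (Y : Ω → ℕ) : 0 ≤ qGammaSq P Y :=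
  tsum_nonneg fun j => by positivity

theorem hasSum_qCharFun_pairs (hY : Measurable Y) (θ : ℝ) :
    HasSum (fun j : ℕ => Complex.exp (((2 * j - qMean P Y) * θ : ℝ) * Complex.I) *
      (P.real {ω | Y ω = 2 * j} + P.real {ω | Y ω = 2 * j + 1} * Complex.exp (Complex.I * θ)))
      (qCharFun P Y θ) := by
  have hsum := hasSum_measureReal_smul_integral (P := P) hY
    (f := fun j => Complex.exp (Complex.I * ((j : ℝ) - qMean P Y : ℝ) * θ)) <| by
      have := measurable_natCast_comp hY
      refine Integrable.mono' (integrable_const (1 : ℝ)) (Measurable.aestronglyMeasurable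
        (by fun_prop)) (Eventually.of_forall fun ω => ?_)
      rw [Complex.norm_exp]
      simp
  refine (hasSum_two_mul_add_two_mul_add_one hsum).congr_fun fun j => ?_
  rw [mul_add, mul_left_comm, ← Complex.exp_add, Complex.real_smul, Complex.real_smul,
    mul_comm (Complex.exp _)]
  congr 3 <;> push_cast <;> ring

theorem norm_qCharFun_le_exp_gamma (hY : Measurable Y) (θ : ℝ) :
    ‖qCharFun P Y θ‖ ≤ Real.exp (-(qGammaSq P Y * (1 - Real.cos θ))) := by
  have hmajorant := (hasSum_pointProb_pairs P hY).sub
    ((hasSum_qGammaSq P hY).mul_right (1 - Real.cos θ))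
  have hsum : ‖qCharFun P Y θ‖ ≤ 1 - qGammaSq P Y * (1 - Real.cos θ) := by
    rw [← (hasSum_qCharFun_pairs hY θ).tsum_eq]
    refine tsum_of_norm_bounded hmajorant fun j => ?_
    rw [norm_mul, Complex.norm_exp_ofReal_mul_I, one_mul]
    exact norm_add_mul_cexp_le measureReal_nonneg measureReal_nonneg θ
  linarith [Real.add_one_le_exp (-(qGammaSq P Y * (1 - Real.cos θ)))]

theorem qGammaSq_le_qVar (hY : Measurable Y) (hmem : MemLp (fun ω => (Y ω : ℝ)) 2 P) :
    qGammaSq P Y ≤ qVar P Y := by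
  have hsum := hasSum_measureReal_smul_integral (P := P) hY
    (f := fun j => ((j : ℝ) - qMean P Y) ^ 2) (hmem.sub (memLp_const _)).integrable_sq
  have hvar : ∫ ω, ((Y ω : ℝ) - qMean P Y) ^ 2 ∂P = qVar P Y :=
    (variance_eq_integral (measurable_natCast_comp hY).aemeasurable).symm
  rw [hvar] at hsum
  refine hasSum_le (fun j => ?_) (hasSum_qGammaSq P hY) (hasSum_two_mul_add_two_mul_add_one hsum)
  refine (pairGamma_le_sq measureReal_nonneg measureReal_nonneg (2 * j - qMean P Y)).trans_eq ?_
  push_cast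
  rw [smul_eq_mul, smul_eq_mul]
  ring

/-- This is where integrality enters: an integer other than `round m` is at distance at least
`1 / 2` from `m`. -/
theorem int_sub_mul_sub_round_le (m : ℝ) (k : ℤ) {r : ℝ} (hr : 0 ≤ r) :
    (k - m) * (k - round m) ≤ 2 * 2 ^ r * |k - m| ^ (2 + r) := by
  rcases eq_or_ne k (round m) with hk | hk
  · rw [hk, sub_self, mul_zero]
    positivity
  have hround := abs_sub_round m
  have hone : (1 : ℝ) ≤ |(k : ℝ) - round m| := by
    exact_mod_cast Int.one_le_abs (sub_ne_zero.2 hk)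
  have htriangle : |(k : ℝ) - round m| ≤ |k - m| + |m - round m| := abs_sub_le _ _ _
  have hpos : 0 < |(k : ℝ) - m| := by linarith
  calc (k - m) * (k - round m) ≤ |(k : ℝ) - m| * |(k : ℝ) - round m| := by
        rw [← abs_mul]
        exact le_abs_self _
    _ ≤ |(k : ℝ) - m| * (2 * |(k : ℝ) - m|) := by gcongr; linarith
    _ = 2 * |(k : ℝ) - m| ^ 2 * 1 := by ring
    _ ≤ 2 * |(k : ℝ) - m| ^ 2 * (2 * |(k : ℝ) - m|) ^ r := by
        gcongr
        exact Real.one_le_rpow (by linarith) hr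
    _ = _ := by
        rw [Real.mul_rpow two_pos.le hpos.le, Real.rpow_add hpos, Real.rpow_two]
        ring

theorem qVar_le_qAbsMoment (hY : Measurable Y) {r : ℝ} (hr : 0 ≤ r)
    (hmom : MemLp (fun ω => (Y ω : ℝ)) (ENNReal.ofReal (2 + r)) P) :
    qVar P Y ≤ 2 * 2 ^ r * qAbsMoment P Y (2 + r) := by
  have := isProbabilityMeasure_centredLaw (P := P) hY
  have hmem := memLp_centredLaw hY hmom
  set d : ℝ := qMean P Y - round (qMean P Y)
  have hsq := integrable_sq_of_memLp hr hmem
  have hlin := (integrable_id_of_memLp hr hmem).const_mul d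
  have hvar : qVar P Y = ∫ x, (x ^ 2 + d * x) ∂centredLaw P Y := by
    rw [integral_add hsq hlin, integral_const_mul,
      integral_id_centredLaw hY (integrable_of_memLp_two_add hr hmom), mul_zero, add_zero,
      qVar_eq_integral hY]
  rw [hvar, qAbsMoment_eq_integral hY, ← integral_const_mul]
  refine integral_mono_ae (hsq.add hlin)
    ((integrable_abs_rpow_of_memLp hr hmem).const_mul _) ?_
  refine (ae_map_iff (measurable_sub_qMean hY).aemeasurable
    (measurableSet_le (by fun_prop) (by fun_prop))).2 (Eventually.of_forall fun ω => ?_)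
  refine Eq.trans_le ?_ (int_sub_mul_sub_round_le (qMean P Y) (Y ω) hr)
  push_cast
  ring

end IntegerVariable

/-! ### Sums of independent variables -/

theorem integral_cexp_int_mul (k : ℤ) :
    ∫ θ in (-Real.pi)..Real.pi, Complex.exp (Complex.I * k * θ) =
      if k = 0 then 2 * (Real.pi : ℂ) else 0 := by
  split_ifs with hk
  · simp only [hk, Int.cast_zero, mul_zero, zero_mul, Complex.exp_zero,
      intervalIntegral.integral_const, sub_neg_eq_add, Complex.real_smul, Complex.ofReal_add]
    ring
  · have hperiod : Complex.exp (Complex.I * k * Real.pi) =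
        Complex.exp (Complex.I * k * (-Real.pi : ℝ)) :=
      Complex.exp_eq_exp_iff_exists_int.2 ⟨k, by push_cast; ring⟩
    rw [integral_exp_mul_complex (mul_ne_zero Complex.I_ne_zero (Int.cast_ne_zero.2 hk)), hperiod,
      sub_self, zero_div]

section FourierInversion

variable {Ω : Type*} [MeasurableSpace Ω] {P : Measure Ω} [IsFiniteMeasure P] {Z : Ω → ℤ}

theorem integral_integral_cexp_int_mul (hZ : Measurable Z) :
    ∫ θ in (-Real.pi)..Real.pi, ∫ ω, Complex.exp (Complex.I * Z ω * θ) ∂P =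
      2 * Real.pi * P.real {ω | Z ω = 0} := by
  have hpi : -Real.pi ≤ Real.pi := by linarith [Real.pi_pos]
  have : Measurable fun ω => (Z ω : ℂ) :=
    (measurable_from_top (f := fun z : ℤ => (z : ℂ))).comp hZ
  have hindicator : ∀ ω, ∫ θ in Set.Ioc (-Real.pi) Real.pi, Complex.exp (Complex.I * Z ω * θ) =
      Set.indicator {ω | Z ω = 0} (fun _ => 2 * (Real.pi : ℂ)) ω := fun ω => by
    rw [← intervalIntegral.integral_of_le hpi, integral_cexp_int_mul]
    simp only [Set.indicator, Set.mem_ofPred_eq]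
  rw [intervalIntegral.integral_of_le hpi, integral_integral_swap]
  · simp_rw [hindicator]
    have hzero : MeasurableSet {ω | Z ω = 0} := hZ (measurableSet_singleton 0)
    rw [integral_indicator hzero, setIntegral_const, Complex.real_smul,
      mul_comm]
  · refine Integrable.mono' (integrable_const (1 : ℝ)) (Measurable.aestronglyMeasurable ?_)
      (Eventually.of_forall fun p => ?_)
    · simp only [Function.uncurry_def]
      fun_prop
    · rw [Function.uncurry_def, Complex.norm_exp]
      simp

theorem fourier_inversion_int (hZ : Measurable Z) (x : ℤ) :
    (1 / (2 * Real.pi) : ℂ) * ∫ θ in (-Real.pi)..Real.pi,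
      (∫ ω, Complex.exp (Complex.I * Z ω * θ) ∂P) * Complex.exp (-(Complex.I * x * θ)) =
    P.real {ω | Z ω = x} := by
  have hshift : ∀ θ : ℝ, (∫ ω, Complex.exp (Complex.I * Z ω * θ) ∂P) *
      Complex.exp (-(Complex.I * x * θ)) =
      ∫ ω, Complex.exp (Complex.I * (Z ω - x : ℤ) * θ) ∂P := fun θ => by
    rw [← integral_mul_const]
    congr 1 with ω
    rw [← Complex.exp_add]
    push_cast
    ring_nf
  simp_rw [hshift]
  rw [integral_integral_cexp_int_mul (hZ.sub_const x), ← mul_assoc,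
    one_div_mul_cancel (by simp [Real.pi_ne_zero]), one_mul]
  simp only [sub_eq_zero]

end FourierInversion

theorem prod_qCharFun_eq_integral {ι Ω : Type*} [Fintype ι] [MeasurableSpace Ω] {P : Measure Ω}
    {X : ι → Ω → ℕ}
    (hX : ∀ k, Measurable (X k)) (hind : iIndepFun X P) {m : ℕ}
    (hmean : ∑ k, qMean P (X k) = m) (θ : ℝ) :
    ∏ k, qCharFun P (X k) θ =
      ∫ ω, Complex.exp (Complex.I * (((∑ k, X k ω : ℕ) : ℤ) - (m : ℤ) : ℤ) * θ) ∂P := by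
  simp only [qCharFun]
  rw [← hind.integral_fun_prod_comp (μ := P) (f := fun k (j : ℕ) =>
    Complex.exp (Complex.I * (((j : ℝ) - qMean P (X k) : ℝ) : ℂ) * (θ : ℂ)))
    (fun k => (hX k).aemeasurable) fun k => measurable_from_nat.aestronglyMeasurable]
  congr 1 with ω
  rw [← Complex.exp_sum, ← Finset.sum_mul, ← Finset.mul_sum, ← Complex.ofReal_sum,
    Finset.sum_sub_distrib, hmean]
  push_cast
  rfl

theorem norm_prod_sub_prod_le {ι R : Type*} [NormedCommRing R] [NormOneClass R] (s : Finset ι)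
    {a b : ι → R} {E D : ι → ℝ} (ha : ∀ k ∈ s, ‖a k‖ ≤ E k) (hb : ∀ k ∈ s, ‖b k‖ ≤ E k)
    (hD : ∀ k ∈ s, ‖a k - b k‖ ≤ D k * E k) :
    ‖∏ k ∈ s, a k - ∏ k ∈ s, b k‖ ≤ (∑ k ∈ s, D k) * ∏ k ∈ s, E k := by
  classical
  induction s using Finset.induction_on with
  | empty => simp
  | insert i s hi ih =>
    simp only [Finset.forall_mem_insert] at ha hb hD
    have hprod : ‖∏ k ∈ s, a k‖ ≤ ∏ k ∈ s, E k :=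
      (Finset.norm_prod_le _ _).trans (Finset.prod_le_prod (fun _ _ => norm_nonneg _) ha.2)
    rw [Finset.prod_insert hi, Finset.prod_insert hi, Finset.prod_insert hi, Finset.sum_insert hi]
    calc ‖a i * ∏ k ∈ s, a k - b i * ∏ k ∈ s, b k‖
        = ‖(a i - b i) * ∏ k ∈ s, a k + b i * (∏ k ∈ s, a k - ∏ k ∈ s, b k)‖ := by ring_nf
      _ ≤ ‖a i - b i‖ * ‖∏ k ∈ s, a k‖ + ‖b i‖ * ‖∏ k ∈ s, a k - ∏ k ∈ s, b k‖ :=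
        norm_add_le_of_le (norm_mul_le _ _) (norm_mul_le _ _)
      _ ≤ (D i * E i) * ∏ k ∈ s, E k + E i * ((∑ k ∈ s, D k) * ∏ k ∈ s, E k) :=
        add_le_add
          (mul_le_mul hD.1 hprod (norm_nonneg _) ((norm_nonneg _).trans hD.1))
          (mul_le_mul hb.1 (ih ha.2 hb.2 hD.2) (norm_nonneg _) ((norm_nonneg _).trans hb.1))
      _ = _ := by ring

theorem sq_div_five_le_one_sub_cos {θ : ℝ} (hθ : |θ| ≤ Real.pi) : θ ^ 2 / 5 ≤ 1 - Real.cos θ := by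
  have hcos := Real.cos_le_one_sub_mul_cos_sq hθ
  have hpi : 1 / 5 ≤ 2 / Real.pi ^ 2 := by
    rw [div_le_div_iff₀ (by norm_num) (by positivity)]
    nlinarith [Real.pi_lt_d2, Real.pi_pos]
  nlinarith [sq_nonneg θ]

section Family

variable {ι Ω : Type*} [MeasurableSpace Ω] {P : Measure Ω} {X : ι → Ω → ℕ} {A : Finset ι} {r θ : ℝ}

theorem totSigma_sq (P : Measure Ω) (X : ι → Ω → ℕ) (A : Finset ι) :
    totSigma P X A ^ 2 = ∑ k ∈ A, qVar P (X k) :=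
  Real.sq_sqrt (Finset.sum_nonneg fun k _ => qVar_nonneg P (X k))

theorem totGamma_sq (P : Measure Ω) (X : ι → Ω → ℕ) (A : Finset ι) :
    totGamma P X A ^ 2 = ∑ k ∈ A, qGammaSq P (X k) :=
  Real.sq_sqrt (Finset.sum_nonneg fun k _ => qGammaSq_nonneg P (X k))

theorem totMoment_nonneg (P : Measure Ω) (X : ι → Ω → ℕ) (A : Finset ι) (s : ℝ) :
    0 ≤ totMoment P X A s := Finset.sum_nonneg fun k _ => qAbsMoment_nonneg P (X k) s

theorem gaussianChar_totSigma (P : Measure Ω) (X : ι → Ω → ℕ) (A : Finset ι) (θ : ℝ) :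
    gaussianChar (totSigma P X A) θ = ∏ k ∈ A, gaussianChar √(qVar P (X k)) θ := by
  simp only [gaussianChar, totSigma_sq, Real.sq_sqrt (qVar_nonneg P _)]
  rw [← Complex.ofReal_prod, ← Real.exp_sum, Finset.sum_neg_distrib, Finset.sum_mul,
    Finset.sum_div]

theorem sum_qCharFun_exponent_le
    (hθ : 2 * (totMoment P X A (2 + r) * |θ| ^ (2 + r)) ≤ totSigma P X A ^ 2 * θ ^ 2) :
    ∑ k ∈ A, (-(qVar P (X k) * θ ^ 2 / 2) +
        2 ^ (-r) * (qAbsMoment P (X k) (2 + r) * |θ| ^ (2 + r))) ≤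
      -((1 - 2 ^ (-r)) / 2 * totSigma P X A ^ 2 * θ ^ 2) := by
  have hscaled : (2 : ℝ) ^ (-r) * (2 * (totMoment P X A (2 + r) * |θ| ^ (2 + r))) ≤
      2 ^ (-r) * (totSigma P X A ^ 2 * θ ^ 2) := by gcongr
  rw [Finset.sum_add_distrib, Finset.sum_neg_distrib, ← Finset.mul_sum, ← Finset.sum_mul,
    ← Finset.sum_div, ← Finset.sum_mul, ← totSigma_sq, ← totMoment]
  linarith

variable [IsProbabilityMeasure P]

theorem norm_prod_qCharFun_sub_gaussianChar_le (hX : ∀ k, Measurable (X k)) (hr : 0 ≤ r)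
    (hr1 : r ≤ 1) (hmom : ∀ k ∈ A, MemLp (fun ω => (X k ω : ℝ)) (ENNReal.ofReal (2 + r)) P)
    (hθ : 2 * (totMoment P X A (2 + r) * |θ| ^ (2 + r)) ≤ totSigma P X A ^ 2 * θ ^ 2) :
    ‖∏ k ∈ A, qCharFun P (X k) θ - gaussianChar (totSigma P X A) θ‖ ≤
      2 * Real.exp 1 * totMoment P X A (2 + r) * |θ| ^ (2 + r) *
        Real.exp (-((1 - 2 ^ (-r)) / 2 * totSigma P X A ^ 2 * θ ^ 2)) := by
  set B : ι → ℝ := fun k => qAbsMoment P (X k) (2 + r) * |θ| ^ (2 + r)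
  have hB0 : ∀ k, 0 ≤ B k := fun k => mul_nonneg (qAbsMoment_nonneg _ _ _) (by positivity)
  set w : ι → ℝ := fun k => -(qVar P (X k) * θ ^ 2 / 2) + 2 ^ (-r) * B k
  have hBsum : ∑ k ∈ A, B k = totMoment P X A (2 + r) * |θ| ^ (2 + r) := by
    rw [totMoment, Finset.sum_mul]
  have hwsum : ∑ k ∈ A, w k ≤ _ := sum_qCharFun_exponent_le hθ
  have hdiff : ∀ k ∈ A, ‖qCharFun P (X k) θ - gaussianChar √(qVar P (X k)) θ‖ ≤
      2 * Real.exp 1 * B k * Real.exp (w k) := fun k hk => by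
    refine (norm_qCharFun_sub_gaussianChar_le (hX k) hr hr1 (hmom k hk) θ).trans ?_
    have hone : 1 ≤ Real.exp 1 * Real.exp (w k) := by
      rw [← Real.exp_add]
      have hexponent : -1 ≤ w k := neg_one_le_qCharFun_exponent (hX k) hr hr1 (hmom k hk) θ
      exact Real.one_le_exp (by linarith)
    nlinarith [hB0 k]
  have hgauss : ∀ k, ‖gaussianChar √(qVar P (X k)) θ‖ ≤ Real.exp (w k) := fun k => by
    rw [norm_gaussianChar, Real.sq_sqrt (qVar_nonneg P _)]
    exact Real.exp_le_exp.2 (le_add_of_nonneg_right (mul_nonneg (by positivity) (hB0 k)))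
  rw [gaussianChar_totSigma]
  refine (norm_prod_sub_prod_le A (fun k hk => norm_qCharFun_le_exp (hX k) hr hr1 (hmom k hk) θ)
    (fun k _ => hgauss k) hdiff).trans ?_
  rw [← Real.exp_sum, ← Finset.mul_sum, hBsum, ← mul_assoc]
  have := totMoment_nonneg P X A (2 + r)
  gcongr

theorem norm_prod_qCharFun_le_exp_totGamma (hX : ∀ k, Measurable (X k)) (A : Finset ι)
    (hθ : |θ| ≤ Real.pi) :
    ‖∏ k ∈ A, qCharFun P (X k) θ‖ ≤ Real.exp (-(totGamma P X A ^ 2 * θ ^ 2 / 5)) := by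
  calc ‖∏ k ∈ A, qCharFun P (X k) θ‖
      ≤ ∏ k ∈ A, Real.exp (-(qGammaSq P (X k) * (1 - Real.cos θ))) := by
        rw [norm_prod]
        exact Finset.prod_le_prod (fun k _ => norm_nonneg _) fun k _ =>
          norm_qCharFun_le_exp_gamma (hX k) θ
    _ = Real.exp (-(totGamma P X A ^ 2 * (1 - Real.cos θ))) := by
        rw [← Real.exp_sum, Finset.sum_neg_distrib, ← Finset.sum_mul, totGamma_sq]
    _ ≤ _ := by
        rw [mul_div_assoc]
        gcongr
        exact sq_div_five_le_one_sub_cos hθ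

theorem totGamma_le_totSigma (hX : ∀ k, Measurable (X k))
    (hmem : ∀ k ∈ A, MemLp (fun ω => (X k ω : ℝ)) 2 P) : totGamma P X A ≤ totSigma P X A :=
  Real.sqrt_le_sqrt (Finset.sum_le_sum fun k hk => qGammaSq_le_qVar (hX k) (hmem k hk))

theorem totSigma_sq_le_totMoment (hX : ∀ k, Measurable (X k)) (hr : 0 ≤ r)
    (hmom : ∀ k ∈ A, MemLp (fun ω => (X k ω : ℝ)) (ENNReal.ofReal (2 + r)) P) :
    totSigma P X A ^ 2 ≤ 2 * 2 ^ r * totMoment P X A (2 + r) := by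
  rw [totSigma_sq, totMoment, Finset.mul_sum]
  exact Finset.sum_le_sum fun k hk => qVar_le_qAbsMoment (hX k) hr (hmom k hk)

end Family

/-! ### Factors with value one at the origin -/

/-- A factor of a characteristic function on `[-π, π]` that differs from `1` by `O(|θ|)`. The two
bounds are shaped so that the control `A` adds up when factors are multiplied. -/
structure CorrectionFactor (A : ℝ) (Ψ : ℝ → ℂ) : Prop where
  differentiable : Differentiable ℝ Ψ
  map_zero : Ψ 0 = 1
  norm_le : ∀ θ, |θ| ≤ Real.pi → ‖Ψ θ‖ ≤ Real.exp A
  norm_deriv_le : ∀ θ, |θ| ≤ Real.pi → ‖deriv Ψ θ‖ ≤ A * Real.exp A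

namespace CorrectionFactor

variable {A B : ℝ} {Ψ χ : ℝ → ℂ}

theorem of_norm_deriv_le (hΨ : Differentiable ℝ Ψ) (hΨ0 : Ψ 0 = 1)
    (hΨ' : ∀ θ, |θ| ≤ Real.pi → ‖deriv Ψ θ‖ ≤ B) : CorrectionFactor (B * Real.pi) Ψ := by
  have hB : 0 ≤ B := (norm_nonneg _).trans (hΨ' 0 (by simpa using Real.pi_pos.le))
  refine ⟨hΨ, hΨ0, fun θ hθ => ?_, fun θ hθ => ?_⟩
  · calc ‖Ψ θ‖ ≤ ‖Ψ θ - 1‖ + ‖(1 : ℂ)‖ := norm_le_norm_sub_add _ _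
      _ ≤ B * Real.pi + 1 := by
          rw [norm_one]
          gcongr
          exact (norm_sub_one_le_of_norm_deriv_le hΨ hΨ' hΨ0 hθ).trans (by gcongr)
      _ ≤ Real.exp (B * Real.pi) := Real.add_one_le_exp _
  · calc ‖deriv Ψ θ‖ ≤ B * 1 * 1 := by simpa using hΨ' θ hθ
      _ ≤ B * Real.pi * Real.exp (B * Real.pi) := by
          gcongr
          · linarith [Real.two_le_pi]
          · exact Real.one_le_exp (by positivity)

theorem cexp {w w' : ℝ → ℂ} (hw : ∀ θ, HasDerivAt w (w' θ) θ) (hw0 : w 0 = 0)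
    (hw' : ∀ θ, |θ| ≤ Real.pi → ‖w' θ‖ ≤ B) :
    CorrectionFactor (B * Real.pi) fun θ => Complex.exp (w θ) := by
  have hB : 0 ≤ B := (norm_nonneg _).trans (hw' 0 (by simpa using Real.pi_pos.le))
  have hnorm : ∀ θ, |θ| ≤ Real.pi → ‖Complex.exp (w θ)‖ ≤ Real.exp (B * Real.pi) := fun θ hθ => by
    have hw_le : ‖w θ‖ ≤ B * |θ| := by
      have hball := convex_closedBall (0 : ℝ) Real.pi
      simpa [hw0] using hball.norm_image_sub_le_of_norm_hasDerivWithin_le (x := 0) (y := θ)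
        (fun x _ => (hw x).hasDerivWithinAt) (fun x hx => hw' x (by simpa using hx))
        (by simpa using Real.pi_pos.le) (by simpa using hθ)
    rw [Complex.norm_exp]
    exact Real.exp_le_exp.2 ((Complex.re_le_norm _).trans (hw_le.trans (by gcongr)))
  refine ⟨fun θ => (hw θ).cexp.differentiableAt, by simp [hw0], hnorm, fun θ hθ => ?_⟩
  rw [(hw θ).cexp.deriv, norm_mul, mul_comm]
  have hpi : B ≤ B * Real.pi := le_mul_of_one_le_right hB (by linarith [Real.two_le_pi])
  exact mul_le_mul ((hw' θ hθ).trans hpi) (hnorm θ hθ) (norm_nonneg _) (by positivity)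

theorem mul (hΨ : CorrectionFactor A Ψ) (hχ : CorrectionFactor B χ) :
    CorrectionFactor (A + B) fun θ => Ψ θ * χ θ := by
  refine ⟨hΨ.differentiable.mul hχ.differentiable, by simp [hΨ.map_zero, hχ.map_zero],
    fun θ hθ => ?_, fun θ hθ => ?_⟩
  · rw [norm_mul, Real.exp_add]
    exact mul_le_mul (hΨ.norm_le θ hθ) (hχ.norm_le θ hθ) (norm_nonneg _) (Real.exp_pos _).le
  · rw [deriv_fun_mul (hΨ.differentiable θ) (hχ.differentiable θ)]
    calc _ ≤ ‖deriv Ψ θ‖ * ‖χ θ‖ + ‖Ψ θ‖ * ‖deriv χ θ‖ :=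
          norm_add_le_of_le (norm_mul _ _).le (norm_mul _ _).le
      _ ≤ A * Real.exp A * Real.exp B + Real.exp A * (B * Real.exp B) :=
          add_le_add
            (mul_le_mul (hΨ.norm_deriv_le θ hθ) (hχ.norm_le θ hθ) (norm_nonneg _)
              ((norm_nonneg _).trans (hΨ.norm_deriv_le θ hθ)))
            (mul_le_mul (hΨ.norm_le θ hθ) (hχ.norm_deriv_le θ hθ) (norm_nonneg _)
              (Real.exp_pos _).le)
      _ = (A + B) * Real.exp (A + B) := by rw [Real.exp_add]; ring

theorem prod {ι : Type*} {s : Finset ι} {A : ι → ℝ} {Ψ : ι → ℝ → ℂ}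
    (hΨ : ∀ k ∈ s, CorrectionFactor (A k) (Ψ k)) :
    CorrectionFactor (∑ k ∈ s, A k) fun θ => ∏ k ∈ s, Ψ k θ := by
  induction s using Finset.cons_induction with
  | empty => simpa using of_norm_deriv_le (B := 0) (differentiable_const (1 : ℂ)) rfl (by simp)
  | cons k s hk ih =>
    simp only [Finset.prod_cons, Finset.sum_cons]
    exact (hΨ k (Finset.mem_cons_self k s)).mul (ih fun l hl => hΨ l (Finset.mem_cons_of_mem hl))

theorem mono (hΨ : CorrectionFactor A Ψ) (hAB : A ≤ B) : CorrectionFactor B Ψ where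
  differentiable := hΨ.differentiable
  map_zero := hΨ.map_zero
  norm_le θ hθ := (hΨ.norm_le θ hθ).trans (Real.exp_le_exp.2 hAB)
  norm_deriv_le θ hθ := (hΨ.norm_deriv_le θ hθ).trans <| by
    have hA : 0 ≤ A :=
      nonneg_of_mul_nonneg_left ((norm_nonneg _).trans (hΨ.norm_deriv_le θ hθ)) (Real.exp_pos A)
    have := hA.trans hAB
    gcongr

end CorrectionFactor

/-! ### The algebraic singularity -/

/-- The reciprocal of the pole factor, in terms of the scale `α`. -/
noncomputable def poleDenom (α θ : ℝ) : ℂ := 1 - α * (Complex.exp (Complex.I * θ) - 1)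

theorem poleFactor_eq_inv {ρ : ℝ} (hρ : ρ < 1) (θ : ℝ) :
    poleFactor ρ θ = (poleDenom (poleScale ρ) θ)⁻¹ := by
  have hne : (1 - (ρ : ℂ)) ≠ 0 := sub_ne_zero.2 (by exact_mod_cast hρ.ne')
  have hdenom : poleDenom (poleScale ρ) θ =
      (1 - (ρ : ℂ) * Complex.exp (Complex.I * θ)) / (1 - ρ) := by
    rw [poleDenom, poleScale]
    push_cast
    field_simp
    ring
  rw [hdenom, inv_div, poleFactor]

theorem poleDenom_re (α θ : ℝ) : (poleDenom α θ).re = 1 + α * (1 - Real.cos θ) := by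
  rw [poleDenom, mul_comm Complex.I]
  simp only [Complex.sub_re, Complex.one_re, Complex.re_ofReal_mul, Complex.exp_ofReal_mul_I_re]
  ring

theorem poleDenom_im (α θ : ℝ) : (poleDenom α θ).im = -(α * Real.sin θ) := by
  rw [poleDenom, mul_comm Complex.I]
  simp [Complex.exp_ofReal_mul_I_im]

theorem hasDerivAt_poleDenom (α θ : ℝ) :
    HasDerivAt (poleDenom α) (-(α * (Complex.I * Complex.exp (Complex.I * θ)))) θ :=
  (((hasDerivAt_cexp_I_mul θ).sub_const 1).const_mul (α : ℂ)).const_sub 1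

/-- The logarithm of the ratio of `1 - iαθ` and `1 - α (e^{iθ} - 1)`, which compares a power of the
pole factor with the characteristic function of a gamma variable of scale `α`. -/
noncomputable def poleLogRatio (α θ : ℝ) : ℂ :=
  Complex.log (1 - Complex.I * (α * θ : ℝ)) - Complex.log (poleDenom α θ)

theorem poleLogRatio_zero (α : ℝ) : poleLogRatio α 0 = 0 := by simp [poleLogRatio, poleDenom]

section PoleDenom

variable {α : ℝ}

theorem one_le_poleDenom_re (hα : 0 ≤ α) (θ : ℝ) : 1 ≤ (poleDenom α θ).re := by
  rw [poleDenom_re]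
  exact le_add_of_nonneg_right (mul_nonneg hα (sub_nonneg.2 (Real.cos_le_one θ)))

theorem poleDenom_mem_slitPlane (hα : 0 ≤ α) (θ : ℝ) : poleDenom α θ ∈ Complex.slitPlane :=
  Or.inl (one_pos.trans_le (one_le_poleDenom_re hα θ))

theorem one_le_norm_poleDenom (hα : 0 ≤ α) (θ : ℝ) : 1 ≤ ‖poleDenom α θ‖ :=
  (one_le_poleDenom_re hα θ).trans (Complex.re_le_norm _)

theorem mul_abs_le_two_mul_norm_poleDenom (hα : 0 ≤ α) {θ : ℝ} (hθ : |θ| ≤ Real.pi) :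
    α * |θ| ≤ 2 * ‖poleDenom α θ‖ := by
  have hcos : θ ^ 2 / 4 ≤ 2 * (1 - Real.cos θ) := by
    linarith [sq_div_five_le_one_sub_cos hθ, sq_nonneg θ]
  have hnonneg : 0 ≤ α * (1 - Real.cos θ) := mul_nonneg hα (sub_nonneg.2 (Real.cos_le_one θ))
  refine le_of_sq_le_sq ?_ (by positivity)
  calc (α * |θ|) ^ 2 = 2 ^ 2 * (α ^ 2 * (θ ^ 2 / 4)) := by rw [mul_pow, sq_abs]; ring
    _ ≤ 2 ^ 2 * (1 + 2 * (α * (1 - Real.cos θ)) + α ^ 2 * (2 * (1 - Real.cos θ))) := by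
        gcongr
        exact le_add_of_nonneg_of_le (by linarith) (by gcongr)
    _ = (2 * ‖poleDenom α θ‖) ^ 2 := by
        rw [mul_pow, ← Complex.normSq_eq_norm_sq, Complex.normSq_apply, poleDenom_re, poleDenom_im]
        linear_combination (-4 * α ^ 2) * Real.sin_sq_add_cos_sq θ

theorem hasDerivAt_poleLogRatio (hα : 0 ≤ α) (θ : ℝ) :
    HasDerivAt (poleLogRatio α) (-(Complex.I * α) / (1 - Complex.I * (α * θ : ℝ)) -
      -(α * (Complex.I * Complex.exp (Complex.I * θ))) / poleDenom α θ) θ := by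
  have hlinear :
      HasDerivAt (fun θ : ℝ => 1 - Complex.I * ((α * θ : ℝ) : ℂ)) (-(Complex.I * α)) θ := by
    simpa [mul_assoc, sub_eq_add_neg] using! (hasDerivAt_neg_I_mul_mul α θ).const_add 1
  exact (hlinear.clog_real (one_sub_I_mul_mem_slitPlane _)).sub
    ((hasDerivAt_poleDenom α θ).clog_real (poleDenom_mem_slitPlane hα θ))

theorem norm_cexp_sub_one_sub_I_mul_mul_cexp_le (x : ℝ) :
    ‖Complex.exp (Complex.I * x) - 1 - Complex.I * x * Complex.exp (Complex.I * x)‖ ≤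
      |x| ^ 2 / 2 := by
  have hinv : Complex.exp (Complex.I * x) * Complex.exp (Complex.I * (-x : ℝ)) = 1 := by
    rw [← Complex.exp_add]
    simp
  have hnorm : ‖Complex.exp (Complex.I * x)‖ = 1 := by simp [Complex.norm_exp]
  calc _ = ‖-(Complex.exp (Complex.I * x) *
        (Complex.exp (Complex.I * (-x : ℝ)) - 1 - Complex.I * (-x : ℝ)))‖ := by
        congr 1
        push_cast at hinv ⊢
        linear_combination hinv
    _ ≤ |x| ^ 2 / 2 := by
        rw [norm_neg, norm_mul, hnorm, one_mul, ← abs_neg x]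
        exact norm_cexp_I_mul_sub_one_sub_le (-x)

theorem norm_deriv_poleLogRatio_le (hα : 0 ≤ α) {θ : ℝ} (hθ : |θ| ≤ Real.pi) :
    ‖deriv (poleLogRatio α) θ‖ ≤ 2 := by
  set D : ℂ := 1 - Complex.I * (α * θ : ℝ) with hD
  set e : ℂ := Complex.exp (Complex.I * θ)
  have hD0 : D ≠ 0 := Complex.slitPlane_ne_zero (one_sub_I_mul_mem_slitPlane _)
  have hN0 := Complex.slitPlane_ne_zero (poleDenom_mem_slitPlane hα θ)
  have hD_le : α * |θ| ≤ ‖D‖ := by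
    simpa [hD, abs_mul, abs_of_nonneg hα] using abs_le_norm_one_sub_I_mul (α * θ)
  -- The terms of order `α² θ` of the numerator cancel, so that the bound is uniform in `α`.
  have hcombined : deriv (poleLogRatio α) θ =
      Complex.I * α * ((e - 1) + α * (e - 1 - Complex.I * θ * e)) / (D * poleDenom α θ) := by
    rw [(hasDerivAt_poleLogRatio hα θ).deriv, div_sub_div _ _ hD0 hN0]
    congr 1
    rw [hD, poleDenom]
    push_cast
    ring
  have hnum : ‖(e - 1) + α * (e - 1 - Complex.I * θ * e)‖ ≤ |θ| + α * (|θ| ^ 2 / 2) := by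
    refine norm_add_le_of_le Real.norm_exp_I_mul_ofReal_sub_one_le ?_
    rw [norm_mul, Complex.norm_of_nonneg hα]
    gcongr
    exact norm_cexp_sub_one_sub_I_mul_mul_cexp_le θ
  rw [hcombined, norm_div, norm_mul, norm_mul, Complex.norm_I, one_mul, Complex.norm_of_nonneg hα,
    norm_mul]
  refine div_le_of_le_mul₀ (by positivity) two_pos.le ?_
  calc _ ≤ α * (|θ| + α * (|θ| ^ 2 / 2)) := by gcongr
    _ = α * |θ| * (1 + α * |θ| / 2) := by ring
    _ ≤ ‖D‖ * (2 * ‖poleDenom α θ‖) := by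
        gcongr
        linarith [one_le_norm_poleDenom hα θ, mul_abs_le_two_mul_norm_poleDenom hα hθ]
    _ = _ := by ring

end PoleDenom

theorem gammaChar_sum {ι : Type*} (s : Finset ι) (ξ : ι → ℝ) (t : ℝ) :
    gammaChar (∑ k ∈ s, ξ k) t = ∏ k ∈ s, gammaChar (ξ k) t := by
  have hne := Complex.slitPlane_ne_zero (one_sub_I_mul_mem_slitPlane t)
  simp only [gammaChar, Complex.cpow_def_of_ne_zero hne]
  rw [← Complex.exp_sum, Complex.ofReal_sum, ← Finset.mul_sum, Finset.sum_neg_distrib]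

section SaturableQueue

variable {ρ : ℝ}

theorem poleScale_nonneg (hρ0 : 0 ≤ ρ) (hρ : ρ < 1) : 0 ≤ poleScale ρ :=
  div_nonneg hρ0 (sub_nonneg.2 hρ.le)

theorem poleFactor_cpow_eq (hρ0 : 0 ≤ ρ) (hρ : ρ < 1) (ξ θ : ℝ) :
    poleFactor ρ θ ^ (ξ : ℂ) = gammaChar ξ (poleScale ρ * θ) *
      Complex.exp (ξ * poleLogRatio (poleScale ρ) θ) := by
  have hmem := poleDenom_mem_slitPlane (poleScale_nonneg hρ0 hρ) θ
  rw [poleFactor_eq_inv hρ, gammaChar,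
    Complex.cpow_def_of_ne_zero (inv_ne_zero (Complex.slitPlane_ne_zero hmem)),
    Complex.cpow_def_of_ne_zero (Complex.slitPlane_ne_zero (one_sub_I_mul_mem_slitPlane _)),
    Complex.log_inv _ (Complex.slitPlane_arg_ne_pi hmem), ← Complex.exp_add, poleLogRatio]
  ring_nf

theorem poleFactor_zero_cpow (hρ0 : 0 ≤ ρ) (hρ : ρ < 1) (ξ : ℝ) :
    poleFactor ρ 0 ^ (ξ : ℂ) = 1 := by
  simp [poleFactor_cpow_eq hρ0 hρ, poleLogRatio_zero, gammaChar]

theorem hasDerivAt_poleFactor_cpow_zero (hρ0 : 0 ≤ ρ) (hρ : ρ < 1) (ξ : ℝ) :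
    HasDerivAt (fun θ => poleFactor ρ θ ^ (ξ : ℂ)) (Complex.I * (poleScale ρ * ξ : ℝ)) 0 := by
  have hratio := (hasDerivAt_poleLogRatio (poleScale_nonneg hρ0 hρ) 0).const_mul (ξ : ℂ)
  simp only [poleFactor_cpow_eq hρ0 hρ]
  refine ((hasDerivAt_gammaChar_mul ξ (poleScale ρ) 0).mul hratio.cexp).congr_deriv ?_
  simp only [gammaChar, poleLogRatio_zero, poleDenom, mul_zero, Complex.ofReal_zero, sub_zero,
    Complex.one_cpow, div_one, one_mul, Complex.exp_zero, mul_one, sub_self, sub_neg_eq_add,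
    Complex.ofReal_mul]
  ring

/-- The part of the law of a saturable queue that is not gamma: besides `ψ`, the error made by
replacing the pole factor by a gamma characteristic function, and the shift of the mean `m` from
that of the gamma variable. -/
noncomputable def queueCorrection (α m ξ : ℝ) (ψ : ℝ → ℂ) (θ : ℝ) : ℂ :=
  Complex.exp (-(Complex.I * (m - α * ξ : ℝ) * θ) + ξ * poleLogRatio α θ) * ψ θ

theorem mul_queueCorrection_eq (hρ0 : 0 ≤ ρ) (hρ : ρ < 1) (m ξ : ℝ) (ψ : ℝ → ℂ) (θ : ℝ) :
    Complex.exp (-(Complex.I * m * θ)) * poleFactor ρ θ ^ (ξ : ℂ) * ψ θ =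
      gammaChar ξ (poleScale ρ * θ) * queueCorrection (poleScale ρ) m ξ ψ θ *
        Complex.exp (-(Complex.I * (poleScale ρ * ξ : ℝ) * θ)) := by
  have hmean : Complex.exp (-(Complex.I * m * θ)) =
      Complex.exp (-(Complex.I * (m - poleScale ρ * ξ : ℝ) * θ)) *
        Complex.exp (-(Complex.I * (poleScale ρ * ξ : ℝ) * θ)) := by
    rw [← Complex.exp_add]
    push_cast
    ring_nf
  rw [poleFactor_cpow_eq hρ0 hρ, queueCorrection, Complex.exp_add, hmean]
  ring

variable {φ ψ : ℝ → ℂ} {m ξ B : ℝ}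

theorem abs_mean_sub_le (hρ0 : 0 ≤ ρ) (hρ : ρ < 1)
    (hφ : ∀ θ : ℝ, φ θ = Complex.exp (-(Complex.I * m * θ)) * poleFactor ρ θ ^ (ξ : ℂ) * ψ θ)
    (hφ' : HasDerivAt φ 0 0) (hψ : DifferentiableAt ℝ ψ 0) (hψ0 : ψ 0 = 1)
    (hψ' : ‖deriv ψ 0‖ ≤ B) : |m - poleScale ρ * ξ| ≤ B := by
  have hderiv := ((hasDerivAt_cexp_neg_I_mul_mul m 0).mul
    (hasDerivAt_poleFactor_cpow_zero hρ0 hρ ξ)).mul hψ.hasDerivAt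
  have hzero := (hderiv.congr_of_eventuallyEq (Eventually.of_forall hφ)).unique hφ'
  simp only [Pi.mul_apply, hψ0, poleFactor_zero_cpow hρ0 hρ, Complex.ofReal_zero, mul_zero,
    neg_zero, Complex.exp_zero, mul_one, one_mul] at hzero
  have hψ'_eq : deriv ψ 0 = Complex.I * (m - poleScale ρ * ξ : ℝ) := by
    push_cast at hzero ⊢
    linear_combination hzero
  rwa [hψ'_eq, norm_mul, Complex.norm_I, one_mul, Complex.norm_real] at hψ'

theorem correctionFactor_queueCorrection {α : ℝ} (hα : 0 ≤ α) (hξ : 0 ≤ ξ)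
    (hmean : |m - α * ξ| ≤ B) (hψ : Differentiable ℝ ψ) (hψ0 : ψ 0 = 1)
    (hψ' : ∀ θ, ‖deriv ψ θ‖ ≤ B) :
    CorrectionFactor (2 * (B + ξ) * Real.pi) (queueCorrection α m ξ ψ) := by
  have hexponent := fun θ => (hasDerivAt_neg_I_mul_mul (m - α * ξ) θ).add
    ((hasDerivAt_poleLogRatio hα θ).differentiableAt.hasDerivAt.const_mul (ξ : ℂ))
  have hcexp := CorrectionFactor.cexp (B := B + ξ * 2) hexponent (by simp [poleLogRatio_zero])
    fun θ hθ => by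
      refine norm_add_le_of_le ?_ ?_
      · rwa [norm_neg, norm_mul, Complex.norm_I, one_mul, Complex.norm_real]
      · rw [norm_mul, Complex.norm_of_nonneg hξ]
        gcongr
        exact norm_deriv_poleLogRatio_le hα hθ
  exact (hcexp.mul (CorrectionFactor.of_norm_deriv_le hψ hψ0 fun θ _ => hψ' θ)).mono
    (by linarith)

end SaturableQueue

theorem exists_correctionFactor_prod_eq {ι : Type*} {F : Finset ι} {φ ψ : ι → ℝ → ℂ}
    {m ξ : ι → ℝ} {ρ M B : ℝ} (hρ0 : 0 ≤ ρ) (hρ : ρ < 1) (hB : 0 ≤ B)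
    (hφ : ∀ k ∈ F, ∀ θ : ℝ, φ k θ =
      Complex.exp (-(Complex.I * m k * θ)) * poleFactor ρ θ ^ (ξ k : ℂ) * ψ k θ)
    (hφ0 : ∀ k ∈ F, φ k 0 = 1) (hφ' : ∀ k ∈ F, HasDerivAt (φ k) 0 0)
    (hψ : ∀ k ∈ F, Differentiable ℝ (ψ k)) (hψ' : ∀ k ∈ F, ∀ θ, ‖deriv (ψ k) θ‖ ≤ B)
    (hξ : ∀ k ∈ F, 1 ≤ ξ k) (hξM : ∑ k ∈ F, ξ k ≤ M) :
    ∃ Ψ, CorrectionFactor (2 * (B + 1) * M * Real.pi) Ψ ∧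
      ∀ θ : ℝ, ∏ k ∈ F, φ k θ = gammaChar (∑ k ∈ F, ξ k) (poleScale ρ * θ) * Ψ θ *
        Complex.exp (-(Complex.I * (poleScale ρ * ∑ k ∈ F, ξ k : ℝ) * θ)) := by
  have hψ0 : ∀ k ∈ F, ψ k 0 = 1 := fun k hk => by
    simpa [hφ0 k hk, poleFactor_zero_cpow hρ0 hρ] using (hφ k hk 0).symm
  refine ⟨_, (CorrectionFactor.prod fun k hk => correctionFactor_queueCorrection
    (poleScale_nonneg hρ0 hρ) (zero_le_one.trans (hξ k hk))
    (abs_mean_sub_le hρ0 hρ (hφ k hk) (hφ' k hk) (hψ k hk 0) (hψ0 k hk) (hψ' k hk 0))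
    (hψ k hk) (hψ0 k hk) (hψ' k hk)).mono ?_, fun θ => ?_⟩
  · calc ∑ k ∈ F, 2 * (B + ξ k) * Real.pi ≤ ∑ k ∈ F, 2 * (B + 1) * Real.pi * ξ k :=
          Finset.sum_le_sum fun k hk => by
            have := le_mul_of_one_le_right hB (hξ k hk)
            nlinarith [Real.pi_pos]
      _ = 2 * (B + 1) * (∑ k ∈ F, ξ k) * Real.pi := by rw [← Finset.mul_sum]; ring
      _ ≤ _ := by gcongr
  · rw [Finset.prod_congr rfl fun k hk => (hφ k hk θ).trans (mul_queueCorrection_eq hρ0 hρ _ _ _ θ),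
      Finset.prod_mul_distrib, Finset.prod_mul_distrib, ← Complex.exp_sum]
    congr 2
    · rw [gammaChar_sum]
    · push_cast
      simp only [Finset.sum_neg_distrib, Finset.mul_sum, Finset.sum_mul]

/-! ### Networks with saturable queues -/

section TotDelta

variable {ι Ω : Type*} [MeasurableSpace Ω] {P : Measure Ω} {X : ι → Ω → ℕ} {A : Finset ι} {r : ℝ}

theorem totDelta_nonneg (P : Measure Ω) (X : ι → Ω → ℕ) (A : Finset ι) (r : ℝ) :
    0 ≤ totDelta P X A r := by
  have := totMoment_nonneg P X A (2 + r)
  exact Real.rpow_nonneg (by positivity) _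

theorem totDelta_rpow (P : Measure Ω) (X : ι → Ω → ℕ) (A : Finset ι) (hr : r ≠ 0) :
    totDelta P X A r ^ r = totSigma P X A ^ 2 / (2 * totMoment P X A (2 + r)) := by
  have := totMoment_nonneg P X A (2 + r)
  rw [totDelta, ← Real.rpow_mul (by positivity), one_div_mul_cancel hr, Real.rpow_one]
  ring

theorem totSigma_mul_totDelta_rpow_neg (hr : r ≠ 0) (hσ : 0 < totSigma P X A) :
    (totSigma P X A * totDelta P X A r) ^ (-r) =
      2 * (totMoment P X A (2 + r) / totSigma P X A ^ (2 + r)) := by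
  have hδ := totDelta_nonneg P X A r
  rw [Real.rpow_neg (by positivity), Real.mul_rpow hσ.le hδ, totDelta_rpow P X A hr,
    Real.rpow_add hσ, Real.rpow_two, mul_inv, inv_div]
  field_simp

theorem two_mul_totMoment_mul_abs_rpow_le {θ : ℝ} (hr : 0 < r) (hθ : |θ| ≤ totDelta P X A r) :
    2 * (totMoment P X A (2 + r) * |θ| ^ (2 + r)) ≤ totSigma P X A ^ 2 * θ ^ 2 := by
  have hβ := totMoment_nonneg P X A (2 + r)
  have hpow : |θ| ^ r ≤ totSigma P X A ^ 2 / (2 * totMoment P X A (2 + r)) :=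
    totDelta_rpow P X A hr.ne' ▸ Real.rpow_le_rpow (abs_nonneg θ) hθ hr.le
  rw [Real.rpow_add' (abs_nonneg θ) (by linarith), Real.rpow_two, sq_abs]
  calc _ = |θ| ^ r * (2 * totMoment P X A (2 + r)) * θ ^ 2 := by ring
    _ ≤ _ := by
        gcongr
        exact mul_le_of_le_div₀ (sq_nonneg _) (by positivity) hpow

variable [IsProbabilityMeasure P]

theorem totDelta_le_two (hX : ∀ k, Measurable (X k)) (hr : 0 < r)
    (hmom : ∀ k ∈ A, MemLp (fun ω => (X k ω : ℝ)) (ENNReal.ofReal (2 + r)) P) :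
    totDelta P X A r ≤ 2 := by
  have hβ := totMoment_nonneg P X A (2 + r)
  rw [← Real.rpow_le_rpow_iff (totDelta_nonneg P X A r) two_pos.le hr, totDelta_rpow P X A hr.ne']
  refine div_le_of_le_mul₀ (by positivity) (by positivity) ?_
  linarith [totSigma_sq_le_totMoment hX hr.le hmom]

theorem gammaRegime_of_one_le_totDelta_mul_totGamma {M ξ α : ℝ} (hX : ∀ k, Measurable (X k))
    (hr : 0 < r) (hmom : ∀ k ∈ A, MemLp (fun ω => (X k ω : ℝ)) (ENNReal.ofReal (2 + r)) P)
    (hξ : ξ ∈ Set.Icc 1 M) (hσα : totSigma P X A ≤ α)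
    (hδγ : 1 ≤ totDelta P X A r * totGamma P X A) :
    GammaRegime M r ξ α (totSigma P X A) (totMoment P X A (2 + r)) (totGamma P X A)
      (totDelta P X A r) := by
  have hγσ : totGamma P X A ≤ totSigma P X A := totGamma_le_totSigma hX fun k hk =>
    (hmom k hk).mono_exponent (by simpa using ENNReal.ofReal_le_ofReal (by linarith : 2 ≤ 2 + r))
  have hδ_nonneg := totDelta_nonneg P X A r
  have hδ : 0 < totDelta P X A r := pos_of_mul_pos_left (one_pos.trans_le hδγ) (Real.sqrt_nonneg _)
  have hγ : 0 < totGamma P X A := pos_of_mul_pos_right (one_pos.trans_le hδγ) hδ_nonneg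
  have hσ : 0 < totSigma P X A := hγ.trans_le hγσ
  exact
    { shape_mem := hξ
      sigma_pos := hσ
      sigma_le := hσα
      moment_nonneg := totMoment_nonneg P X A (2 + r)
      gamma_pos := hγ
      delta_pos := hδ
      delta_le_two := totDelta_le_two hX hr hmom
      one_le_sigma_mul_delta := hδγ.trans (by rw [mul_comm]; gcongr)
      delta_rpow := totSigma_mul_totDelta_rpow_neg hr.ne' hσ }

end TotDelta

/-- Independent queue lengths `X k` of integer mean total `m`, in which the queues of the nonempty
set `F` are saturable: their characteristic functions are powers `ξ k` of the same pole factor up to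
factors `ψ k`. The constants `M` and `B` bound the total exponent and the derivatives of the
`ψ k`; the other queues have moments of order `2 + r`. -/
structure SaturableFamily {ι Ω : Type*} [Fintype ι] [MeasurableSpace Ω] (P : Measure Ω)
    (X : ι → Ω → ℕ) (F : Finset ι) (m : ℕ) (ρ : ℝ) (ξ : ι → ℝ) (ψ : ι → ℝ → ℂ) (r M B : ℝ) :
    Prop where
  measurable : ∀ k, Measurable (X k)
  indep : iIndepFun X P
  integrable : ∀ k ∈ F, Integrable (fun ω => (X k ω : ℝ)) P
  sum_mean : ∑ k, qMean P (X k) = m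
  rho_nonneg : 0 ≤ ρ
  rho_lt_one : ρ < 1
  nonempty : F.Nonempty
  charFun_eq : ∀ k ∈ F, ∀ θ : ℝ, qCharFun P (X k) θ =
    Complex.exp (-(Complex.I * (qMean P (X k) : ℂ) * (θ : ℂ))) * poleFactor ρ θ ^ (ξ k : ℂ) * ψ k θ
  differentiable : ∀ k ∈ F, Differentiable ℝ (ψ k)
  norm_deriv_le : ∀ k ∈ F, ∀ θ, ‖deriv (ψ k) θ‖ ≤ B
  one_le_shape : ∀ k ∈ F, 1 ≤ ξ k
  sum_shape_le : ∑ k ∈ F, ξ k ≤ M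
  memLp : ∀ k ∉ F, MemLp (fun ω => (X k ω : ℝ)) (ENNReal.ofReal (2 + r)) P

namespace SaturableFamily

variable {ι Ω : Type*} [Fintype ι] [MeasurableSpace Ω] {P : Measure Ω} {X : ι → Ω → ℕ}
  {F : Finset ι} {m : ℕ} {ρ : ℝ} {ξ : ι → ℝ} {ψ : ι → ℝ → ℂ} {r M B : ℝ}

theorem sum_shape_mem (h : SaturableFamily P X F m ρ ξ ψ r M B) :
    ∑ k ∈ F, ξ k ∈ Set.Icc 1 M := by
  obtain ⟨k, hk⟩ := h.nonempty
  exact ⟨(h.one_le_shape k hk).trans (Finset.single_le_sum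
    (fun l hl => zero_le_one.trans (h.one_le_shape l hl)) hk), h.sum_shape_le⟩

theorem bound_nonneg (h : SaturableFamily P X F m ρ ξ ψ r M B) : 0 ≤ B := by
  obtain ⟨k, hk⟩ := h.nonempty
  exact (norm_nonneg _).trans (h.norm_deriv_le k hk 0)

variable [IsProbabilityMeasure P]

theorem exists_correctionFactor (h : SaturableFamily P X F m ρ ξ ψ r M B) :
    ∃ Ψ, CorrectionFactor (2 * (B + 1) * M * Real.pi) Ψ ∧
      ∀ θ : ℝ, ∏ k ∈ F, qCharFun P (X k) θ =
        gammaChar (∑ k ∈ F, ξ k) (poleScale ρ * θ) * Ψ θ *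
          Complex.exp (-(Complex.I * (poleScale ρ * ∑ k ∈ F, ξ k : ℝ) * θ)) :=
  exists_correctionFactor_prod_eq h.rho_nonneg h.rho_lt_one h.bound_nonneg h.charFun_eq
    (fun k _ => qCharFun_zero P (X k))
    (fun k hk => hasDerivAt_qCharFun_zero (h.measurable k) (h.integrable k hk))
    h.differentiable h.norm_deriv_le h.one_le_shape h.sum_shape_le

theorem fourier_inversion (h : SaturableFamily P X F m ρ ξ ψ r M B) (x : ℤ) :
    (1 / (2 * Real.pi) : ℂ) * ∫ θ in (-Real.pi)..Real.pi,
      (∏ k, qCharFun P (X k) θ) * Complex.exp (-(Complex.I * x * θ)) =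
    P.real {ω | ((∑ k, X k ω : ℕ) : ℤ) - (m : ℤ) = x} := by
  have hmeas : Measurable fun ω => ((∑ k, X k ω : ℕ) : ℤ) - (m : ℤ) :=
    (measurable_from_nat.comp (Finset.measurable_sum _ fun k _ => h.measurable k)).sub_const _
  rw [← fourier_inversion_int hmeas]
  simp_rw [prod_qCharFun_eq_integral h.measurable h.indep h.sum_mean]

variable [DecidableEq ι]

theorem exists_correctionFactor_prod_mul_cexp_eq (h : SaturableFamily P X F m ρ ξ ψ r M B)
    (hα : poleScale ρ ≠ 0) :
    ∃ Ψ, CorrectionFactor (2 * (B + 1) * M * Real.pi) Ψ ∧ ∀ (x : ℤ) (θ : ℝ),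
      (∏ k, qCharFun P (X k) θ) * Complex.exp (-(Complex.I * x * θ)) =
        gammaChar (∑ k ∈ F, ξ k) (poleScale ρ * θ) * Ψ θ * (∏ k ∈ Fᶜ, qCharFun P (X k) θ) *
          Complex.exp (-(Complex.I *
            (poleScale ρ * (∑ k ∈ F, ξ k + x / poleScale ρ) : ℝ) * θ)) := by
  obtain ⟨Ψ, hΨ, hprod⟩ := h.exists_correctionFactor
  refine ⟨Ψ, hΨ, fun x θ => ?_⟩
  rw [← Finset.prod_mul_prod_compl F, hprod, mul_add, mul_div_cancel₀ _ hα,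
    mul_right_comm _ (Complex.exp _), mul_assoc _ (Complex.exp _), ← Complex.exp_add]
  congr 2
  push_cast
  ring

end SaturableFamily

theorem norm_gammaChar_mul_mul_prod_qCharFun_le {ι Ω : Type*} [MeasurableSpace Ω] {P : Measure Ω}
    [IsProbabilityMeasure P] {X : ι → Ω → ℕ} {S : Finset ι} {A Ξ α θ : ℝ} {Ψ : ℝ → ℂ}
    (hX : ∀ k, Measurable (X k)) (hΨ : CorrectionFactor A Ψ) (hΞ : 0 ≤ Ξ) (hα : 0 < α)
    (hθ0 : θ ≠ 0) (hθ : |θ| ≤ Real.pi) :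
    ‖gammaChar Ξ (α * θ) * Ψ θ * ∏ k ∈ S, qCharFun P (X k) θ‖ ≤
      Real.exp A * ((α * |θ|) ^ (-Ξ) * Real.exp (-(totGamma P X S ^ 2 * θ ^ 2 / 5))) := by
  rw [norm_mul, norm_mul, mul_comm ‖gammaChar Ξ _‖, mul_assoc]
  gcongr
  · exact hΨ.norm_le θ hθ
  · exact norm_gammaChar_mul_le hΞ le_rfl hα hθ0
  · exact norm_prod_qCharFun_le_exp_totGamma hX S hθ

theorem mainTheorem7_general (M B : ℝ) {r ε : ℝ} (hr : 0 < r) (hr1 : r ≤ 1) (hε : 0 < ε) :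
    ∃ K : ℝ, ∀ {ι Ω : Type*} [Fintype ι] [DecidableEq ι] [MeasurableSpace Ω] {P : Measure Ω}
      [IsProbabilityMeasure P] {X : ι → Ω → ℕ} {F : Finset ι} {m : ℕ} {ρ : ℝ} {ξ : ι → ℝ}
      {ψ : ι → ℝ → ℂ}, SaturableFamily P X F m ρ ξ ψ r M B →
      totSigma P X Fᶜ ≤ poleScale ρ → 1 ≤ totDelta P X Fᶜ r * totGamma P X Fᶜ →
      ∀ x : ℤ, ε ≤ |∑ k ∈ F, ξ k + x / poleScale ρ| →
        |poleScale ρ * P.real {ω | ((∑ k, X k ω : ℕ) : ℤ) - (m : ℤ) = x} -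
            gammaPDFReal (∑ k ∈ F, ξ k) 1 (∑ k ∈ F, ξ k + x / poleScale ρ)| ≤
          K * gammaError (poleScale ρ) (∑ k ∈ F, ξ k) r (totSigma P X Fᶜ)
            (totMoment P X Fᶜ (2 + r)) (totGamma P X Fᶜ) (totDelta P X Fᶜ r) := by
  set A := |2 * (B + 1) * M * Real.pi|
  set L := max (Real.exp A) (2 * Real.exp 1)
  have hc : 0 < (1 - (2 : ℝ) ^ (-r)) / 2 := by
    linarith [Real.rpow_lt_one_of_one_lt_of_neg one_lt_two (neg_lt_zero.2 hr)]
  have hA : 0 ≤ A * Real.exp A := by positivity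
  obtain ⟨K, hK⟩ := GammaRegime.exists_norm_fourier_sub_gammaPDFReal_le M hA
    (L := L) (by positivity) hc hr hr1 hε
  refine ⟨K, ?_⟩
  intro ι Ω _ _ _ P _ X F m ρ ξ ψ h hσα hδγ x hx
  have hmom : ∀ k ∈ Fᶜ, MemLp (fun ω => (X k ω : ℝ)) (ENNReal.ofReal (2 + r)) P :=
    fun k hk => h.memLp k (Finset.mem_compl.1 hk)
  have hregime := gammaRegime_of_one_le_totDelta_mul_totGamma h.measurable hr hmom
    h.sum_shape_mem hσα hδγ
  have hδπ := hregime.delta_le_two.trans Real.two_le_pi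
  have hβ := hregime.moment_nonneg
  obtain ⟨Ψ, hΨ, hfactor⟩ :=
    h.exists_correctionFactor_prod_mul_cexp_eq hregime.scale_pos.ne'
  replace hΨ : CorrectionFactor A Ψ := hΨ.mono (le_abs_self _)
  have hcont := fun S : Finset ι =>
    continuous_finsetProd S fun k _ => continuous_qCharFun (h.measurable k) (P := P)
  rw [← Real.norm_eq_abs, ← Complex.norm_real, Complex.ofReal_sub, Complex.ofReal_mul,
    ← h.fourier_inversion x]
  refine hK _ _ _ _ _ _ _ Ψ (fun θ => ∏ k ∈ Fᶜ, qCharFun P (X k) θ) _ hregime hx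
    hΨ.differentiable (fun θ hθ => hΨ.norm_deriv_le θ (hθ.trans hδπ)) hΨ.map_zero (hcont Fᶜ)
    (fun θ hθ => ?_) ((hcont Finset.univ).mul (by fun_prop)) (fun θ _ => hfactor x θ)
    (fun θ hδθ hθπ => ?_)
  · refine (norm_prod_qCharFun_sub_gaussianChar_le h.measurable hr.le hr1 hmom
      (two_mul_totMoment_mul_abs_rpow_le hr hθ)).trans ?_
    gcongr
    exact le_max_right _ _
  · have hθ0 : θ ≠ 0 := abs_pos.1 (hregime.delta_pos.trans hδθ)
    rw [hfactor, norm_mul, norm_cexp_neg_I_mul_mul, mul_one]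
    refine (norm_gammaChar_mul_mul_prod_qCharFun_le h.measurable hΨ
      (zero_le_one.trans hregime.shape_mem.1) hregime.scale_pos hθ0 hθπ).trans ?_
    have := hregime.scale_pos
    gcongr
    exact le_max_left _ _

theorem mainTheorem7
    (C : ∀ n : ℕ+, ClosedNetwork n)
    {Ω : ℕ+ → Type*} [∀ n, MeasurableSpace (Ω n)]
    (P : ∀ n, Measure (Ω n)) [∀ n, IsProbabilityMeasure (P n)]
    (lam : ℕ+ → ℝ) (X : ∀ n : ℕ+, Fin n → Ω n → ℕ)
    -- the open system attached to the closed network, with mean total queue length `m_n`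
    (hX : ∀ n, (C n).IsOpenSystem (P n) (lam n) (X n))
    (hint : ∀ n k, Integrable (fun ω => (X n k ω : ℝ)) (P n))
    (hmean : ∀ n, ∑ k, qMean (P n) (X n k) = (C n).customers)
    -- the saturable queues and the algebraic singularity of their generating functions
    (ρ : ℕ+ → ℝ) (hρ : ∀ n, 0 ≤ ρ n ∧ ρ n < 1)
    (F : ∀ n : ℕ+, Finset (Fin n)) (hF : ∀ n, (F n).Nonempty)
    (ξ : ∀ n : ℕ+, Fin n → ℝ) (ψ : ∀ n : ℕ+, Fin n → ℝ → ℂ)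
    (hφ : ∀ n, ∀ k ∈ F n, ∀ θ : ℝ, qCharFun (P n) (X n k) θ =
      Complex.exp (-(Complex.I * (qMean (P n) (X n k) : ℂ) * (θ : ℂ))) *
        poleFactor (ρ n) θ ^ (ξ n k : ℂ) * ψ n k θ)
    (hψ : ∃ B : ℝ, ∀ n, ∀ k ∈ F n, ∀ θ : ℝ,
      DifferentiableAt ℝ (ψ n k) θ ∧ ‖deriv (ψ n k) θ‖ ≤ B)
    (hξ : ∃ ξmax : ℝ, ∀ n, ∀ k ∈ F n, 1 ≤ ξ n k ∧ ξ n k < ξmax)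
    -- finite moments of order `2 + r` of the other queues
    (r : ℝ) (hr : 0 < r ∧ r ≤ 1)
    (hmom : ∀ n, ∀ k ∉ F n, MemLp (fun ω => (X n k ω : ℝ)) (ENNReal.ofReal (2 + r)) (P n))
    -- heavy traffic conditions
    (hρ1 : Tendsto ρ atTop (𝓝 1))
    (hξb : ∃ M : ℝ, ∀ n, ∑ k ∈ F n, ξ n k ≤ M)
    (hσ : Tendsto (fun n => totSigma (P n) (X n) (F n)ᶜ / poleScale (ρ n)) atTop (𝓝 0))
    (hδγ : Tendsto (fun n => totDelta (P n) (X n) (F n)ᶜ r * totGamma (P n) (X n) (F n)ᶜ)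
      atTop atTop) :
    ∀ ε : ℝ, 0 < ε → ∃ K : ℝ, ∀ᶠ n in atTop, ∀ x : ℤ,
      ε ≤ |(∑ k ∈ F n, ξ n k) + x / poleScale (ρ n)| →
      |poleScale (ρ n) *
            (P n).real {ω | ((∑ k, X n k ω : ℕ) : ℤ) - ((C n).customers : ℤ) = x} -
          gammaPDFReal (∑ k ∈ F n, ξ n k) 1 ((∑ k ∈ F n, ξ n k) + x / poleScale (ρ n))| ≤
        K * gammaError (poleScale (ρ n)) (∑ k ∈ F n, ξ n k) r
          (totSigma (P n) (X n) (F n)ᶜ) (totMoment (P n) (X n) (F n)ᶜ (2 + r))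
          (totGamma (P n) (X n) (F n)ᶜ) (totDelta (P n) (X n) (F n)ᶜ r) := by
  intro ε hε
  obtain ⟨M, hM⟩ := hξb
  obtain ⟨B, hB⟩ := hψ
  obtain ⟨ξmax, hξ⟩ := hξ
  obtain ⟨K, hK⟩ := mainTheorem7_general M B hr.1 hr.2 hε
  refine ⟨K, ?_⟩
  filter_upwards [hρ1.eventually_const_lt one_pos, hσ.eventually_le_const one_pos,
    hδγ.eventually_ge_atTop 1] with n hρ0 hσα hδγ
  have hα : 0 < poleScale (ρ n) := div_pos hρ0 (sub_pos.2 (hρ n).2)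
  have hsat : SaturableFamily (P n) (X n) (F n) (C n).customers (ρ n) (ξ n) (ψ n) r M B :=
    ⟨(hX n).measurable, (hX n).indep, fun k _ => hint n k, hmean n, (hρ n).1, (hρ n).2, hF n, hφ n,
      fun k hk θ => (hB n k hk θ).1, fun k hk θ => (hB n k hk θ).2, fun k hk => (hξ n k hk).1,
      hM n, hmom n⟩
  exact hK hsat ((div_le_one hα).1 hσα) hδγ
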